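/- **Setting.** Let $A(\xi)$ be a real homogeneous polynomial on $\mathbb R^N$ of even degree $m=2l\ge 2$ with $A(\xi)>0$ for $\xi\ne0$. For $f\in L_2(\mathbb R^N)$ let $\hat f(\xi)=(2\pi)^{-N}\int f(x)e^{-ix\xi}dx$ (in the $L_2$ sense), and for $\sigma>0$ let $\hat A^\sigma$ be the operator given by $\widehat{\hat A^\sigma f}(\xi)=A(\xi)^\sigma\hat f(\xi)$ on all $f\in L_2$ for which the right-hand side is in $L_2$. Values $\hat f(\xi)$ at a single point are taken at Lebesgue points: $\hat f(\xi)=c$ means that the averages of $|\hat f-c|$ over balls centred at $\xi$ tend to $0$ as the radius tends to $0$. Let $E_\rho(z)=\sum_{k\ge0}z^k/\Gamma(\rho k+1)$ and $D_t^\rho h(t)=\frac1{\Gamma(1-\rho)}\int_0^t(t-s)^{-\rho}h'(s)\,ds$. Let $\tau>N/2$ and let $\varphi$ be a continuous function in $L_2^\tau(\mathbb R^N)$, i.e. $\varphi\in L_2$ and $\int(1+|\xi|^2)^\tau|\hat\varphi(\xi)|^2d\xi<\infty$. Let $T>0$. For $\rho,\sigma\in(0,1)$ consider $$D_t^\rho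 v+\hat A^\sigma v=0\ \ (x\in\mathbb R^N,\ 0<t\le T),\qquad \lim_{|x|\to\infty}v(x,t)=0\ \ (0<t\le T),\qquad v(x,0)=\varphi(x).\tag{1}$$ A solution of (1) is a function $v$ on $\mathbb R^N\times[0,T]$ such that: for each $x$, $v(x,\cdot)$ is continuous on $[0,T]$ and differentiable on $(0,T)$ with integrable derivative, and the integral defining $D_t^\rho v(x,t)$ converges absolutely for $0<t\le T$; for $0<t\le T$, $v(\cdot,t)$ is in the domain of $\hat A^\sigma$ and $\hat v(\cdot,t)\in L_1$; $D_t^\rho v$ and $\hat A^\sigma v$ are continuous on $\mathbb R^N\times(0,T]$; $\int_0^T\|\hat A^\sigma v(\cdot,t)\|_{L_2}dt<\infty$; and (1) holds pointwise. Fix $\rho_0,\sigma_0\in(0,1)$. Let $T_0=e^k$ with some $k\ge\frac1{\rho_0}\max\{\frac{B_1}{B_2},\ln(2B_2k)\}$, $B_1=43$, $B_2=4.6$; if $\rho_0>0.0075$, $T_0=2$ is also allowed. Let $T_0\le t_0\le T$, let $\xi_0$ be such that $A(\xi_0)=1$ and $\hat\varphi(\xi_0)\neq0$ (at a Lebesgue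 point), and let $d_0\in\mathbb R$. **Theorem 1.4.** For all $\rho\in[\rho_0,1)$ and $\sigma\in(0,1)$ problem (1) has exactly one solution $v=v_{\rho,\sigma}$, and whether $|\hat v(\xi_0,t_0)|=d_0$ holds does not depend on $\sigma$. 1. A unique $\rho^\star\in[\rho_0,1)$ with $|\hat v(\xi_0,t_0)|=d_0$ exists if and only if $$e^{-t_0}<\frac{d_0}{|\hat\varphi(\xi_0)|}\le E_{\rho_0}(-t_0^{\rho_0});$$ the same condition is also necessary and sufficient for the existence of some such $\rho^\star$. 2. Let $\rho^\star\in[\rho_0,1)$ satisfy $|\hat v(\xi_0,t_0)|=d_0$. Let $\xi_1$ be such that $\hat\varphi(\xi_1)\ne0$ (at a Lebesgue point) and $A(\xi_1)=\lambda_1\ge\Lambda_1$, where $\Lambda_1=e^n$ with some $n\ge\ln(5\,\Gamma(1-\rho^\star))/\sigma_0$; let $0<t_1\le T$ and $d_1\in\mathbb R$. Then $\sigma^\star\in[\sigma_0,1)$ with $|\hat v(\xi_1,t_1)|=d_1$ for the solution $v=v_{\rho^\star,\sigma^\star}$ exists if and only if $$E_{\rho^\star}(-\lambda_1t_1^{\rho^\star})<\frac{d_1}{|\hat\varphi(\xi_1)|}\le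 E_{\rho^\star}(-\lambda_1^{\sigma_0}t_1^{\rho^\star}),$$ and $\sigma^\star\in(\sigma_0,1)$ with this property exists if and only if the same holds with both inequalities strict. In either case $\sigma^\star$ is unique. -/

import Mathlib

open MeasureTheory Set Filter Topology
open scoped FourierTransform ENNReal

noncomputable section

namespace Subdiffusion

/-- The Mittag-Leffler function `E_ρ(z) = ∑ z ^ k / Γ(ρ k + 1)`. -/
def mittagLeffler (ρ z : ℝ) : ℝ :=
  ∑' k : ℕ, z ^ k / Real.Gamma (ρ * k + 1)

/-- The value at `ξ` of a real polynomial in `N` variables (the symbol of the operator). -/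
def symbol {N : ℕ} (A : MvPolynomial (Fin N) ℝ) (ξ : EuclideanSpace ℝ (Fin N)) : ℝ :=
  MvPolynomial.eval (fun j => ξ j) A

open Classical in
/-- The Fourier transform `f̂(ξ) = (2π)^{-N} ∫ f(x) e^{-i x ξ} dx` of a function in `L²(ℝ^N)`, in the
`L²` sense. Mathlib's `𝓕` has the kernel `e^{-2π i x ξ}`, hence the rescaling of the argument. As
usual, the result is meaningful up to null sets only; it is set to `0` outside `L²`. -/
def hat {N : ℕ} (f : EuclideanSpace ℝ (Fin N) → ℂ) (ξ : EuclideanSpace ℝ (Fin N)) : ℂ :=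
  if h : MemLp f 2 volume then
    (((2 * Real.pi) ^ N)⁻¹ : ℝ) • (𝓕 (h.toLp f) : Lp ℂ 2 volume) ((2 * Real.pi)⁻¹ • ξ)
  else 0

/-- `ξ` is a Lebesgue point of `f`, with value `c`: the averages of `|f - c|` over the balls around
`ξ` tend to zero. The value is unique, depends only on the almost-everywhere class of `f`, is `f ξ`
for almost every `ξ` if `f` is locally integrable, and is `f ξ` if `f` is continuous at `ξ`. -/
def HasLebesgueValue {N : ℕ} (f : EuclideanSpace ℝ (Fin N) → ℂ)
    (ξ : EuclideanSpace ℝ (Fin N)) (c : ℂ) : Prop :=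
  Tendsto (fun r : ℝ => ⨍⁻ η in Metric.ball ξ r, ‖f η - c‖ₑ ∂volume) (𝓝[>] 0) (𝓝 0)

/-- The Sobolev class `L₂^τ(ℝ^N)`: functions `f ∈ L²` with `∫ (1 + |ξ|²)^τ |f̂(ξ)|² dξ < ∞`. -/
def MemSobolevClass {N : ℕ} (τ : ℝ) (f : EuclideanSpace ℝ (Fin N) → ℂ) : Prop :=
  MemLp f 2 volume ∧
    MemLp (fun ξ => (((1 + ‖ξ‖ ^ 2) ^ (τ / 2) : ℝ) : ℂ) * hat f ξ) 2 volume

/-- `f` lies in the domain of the power `Â^σ` of the selfadjoint operator with symbol `A`, and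
`Â^σ f = g`: both are in `L²` and `ĝ(ξ) = A(ξ)^σ f̂(ξ)`. -/
def IsFractionalPower {N : ℕ} (A : MvPolynomial (Fin N) ℝ) (σ : ℝ)
    (f g : EuclideanSpace ℝ (Fin N) → ℂ) : Prop :=
  MemLp f 2 volume ∧ MemLp g 2 volume ∧
    hat g =ᵐ[volume] fun ξ => ((symbol A ξ ^ σ : ℝ) : ℂ) * hat f ξ

/-- The Caputo derivative
`D_t^ρ h(t) = Γ(1 - ρ)⁻¹ ∫_0^t (t - s)^{-ρ} h'(s) ds` of order `ρ ∈ (0, 1)`. -/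
def caputo (ρ : ℝ) (h : ℝ → ℂ) (t : ℝ) : ℂ :=
  ((Real.Gamma (1 - ρ))⁻¹ : ℝ) • ∫ s in (0 : ℝ)..t, ((t - s) ^ (-ρ) : ℝ) • deriv h s

/-- The Caputo derivative of order `ρ` of `h` exists on `(0, T]`: `h` is continuous on `[0, T]`,
differentiable inside with integrable derivative, and the integrals that define the Caputo
derivative converge absolutely. -/
structure HasCaputo (ρ T : ℝ) (h : ℝ → ℂ) : Prop where
  continuousOn : ContinuousOn h (Icc 0 T)
  differentiableAt : ∀ t ∈ Ioo 0 T, DifferentiableAt ℝ h t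
  integrable_deriv : IntegrableOn (deriv h) (Ioo 0 T)
  integrable_kernel : ∀ t ∈ Ioc 0 T,
    IntegrableOn (fun s => ((t - s) ^ (-ρ) : ℝ) • deriv h s) (Ioo 0 t)

/-- `v(x, t)` is a (classical) solution of
`D_t^ρ v + Â^σ v = 0` on `ℝ^N × (0, T]`, `v(x, t) → 0` as `|x| → ∞`, `v(x, 0) = φ(x)`.
The function `w` is `Â^σ v`. -/
structure IsSolution {N : ℕ} (A : MvPolynomial (Fin N) ℝ) (ρ σ T : ℝ)
    (φ : EuclideanSpace ℝ (Fin N) → ℂ) (v : EuclideanSpace ℝ (Fin N) → ℝ → ℂ) : Prop where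
  initial : ∀ x, v x 0 = φ x
  boundary : ∀ t ∈ Ioc 0 T, Tendsto (fun x => v x t) (cocompact _) (𝓝 0)
  hasCaputo : ∀ x, HasCaputo ρ T (v x)
  continuousOn_caputo : ContinuousOn
    (fun p : EuclideanSpace ℝ (Fin N) × ℝ => caputo ρ (v p.1) p.2) (univ ×ˢ Ioc 0 T)
  integrable_hat : ∀ t ∈ Ioc 0 T, Integrable (hat fun x => v x t) volume
  equation : ∃ w : EuclideanSpace ℝ (Fin N) → ℝ → ℂ,
    ContinuousOn (fun p : EuclideanSpace ℝ (Fin N) × ℝ => w p.1 p.2) (univ ×ˢ Ioc 0 T) ∧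
    (∀ t ∈ Ioc 0 T, IsFractionalPower A σ (fun x => v x t) (fun x => w x t)) ∧
    (∫⁻ t in Ioc 0 T, eLpNorm (fun x => w x t) 2 volume) < ∞ ∧
    ∀ x, ∀ t ∈ Ioc 0 T, caputo ρ (v x) t + w x t = 0

/-- `|v̂(ξ, t)| = d` for the solution `v` with orders `ρ`, `σ` and initial function `φ`. -/
def Observed {N : ℕ} (A : MvPolynomial (Fin N) ℝ) (ρ σ T : ℝ)
    (φ : EuclideanSpace ℝ (Fin N) → ℂ) (ξ : EuclideanSpace ℝ (Fin N)) (t d : ℝ) : Prop :=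
  ∃ v, IsSolution A ρ σ T φ v ∧ ∃ c : ℂ, HasLebesgueValue (hat fun x => v x t) ξ c ∧ ‖c‖ = d

/-- The admissible thresholds `T₀(lam, ρ₀)` for the time of the first observation: `e^k` with
`k ≥ ρ₀⁻¹ max {B₁ / B₂, ln (2 B₂ k / lam)}`, `B₁ = 43`, `B₂ = 4.6`; if `ρ₀ lam > 0.0075`, also `2`. -/
def IsTimeThreshold (lam ρ₀ T₀ : ℝ) : Prop :=
  (∃ k : ℝ, T₀ = Real.exp k ∧
    1 / ρ₀ * max (43 / 4.6) (Real.log (2 * 4.6 * k / lam)) ≤ k) ∨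
  (0.0075 < ρ₀ * lam ∧ T₀ = 2)

/-- The admissible thresholds `Λ₁(ρ, σ₀)`: `e^n` with `n ≥ ln (5 Γ(1 - ρ)) / σ₀`. -/
def IsSymbolThreshold (ρ σ₀ Λ₁ : ℝ) : Prop :=
  ∃ n : ℝ, Λ₁ = Real.exp n ∧ Real.log (5 * Real.Gamma (1 - ρ)) / σ₀ ≤ n

end Subdiffusion

end

/-!
In Fourier variables the problem decouples into the equations `D_t^ρ u = -A(ξ)^σ u`, so the
solution is the multiplier `E_ρ(-A(ξ)^σ t^ρ)` applied to `φ`, and `|v̂(ξ, t)|` at a Lebesgue point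
with value `c` of `φ̂` is `|c| E_ρ(-A(ξ)^σ t^ρ)`. Both parts of the theorem are then the
intermediate value theorem for a strictly decreasing continuous function, of `σ` if `A(ξ) > 1` and
of `ρ` if `A(ξ) = 1` and `t ≥ 1`.

Monotonicity in `ρ`: `E_ρ(-t^ρ)` is the Laplace transform of an explicit probability measure whose
density in the logarithmic variable `y` is even, so the kernel `exp(-t e^y)` may be symmetrised to
`exp(-t e^y) + exp(-t e^{-y})`, which is increasing in `y ≥ 0` as `t ≥ 1`. The densities of two
orders cross once on the half-line; subtracting from the kernel its value at the crossing gives the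
integrand of the difference a constant sign.

Uniqueness: for zero initial data Abel inversion gives `v = -I^ρ w` with `w = Â^σ v`. Pair with
`L²` functions whose Fourier transforms live in the band `A^σ ≤ R`. In the `L¹` norm in time with
weight `e^{-μ t}`, each application of `A^σ` costs a factor `R` and each `I^ρ` gains `μ^{-ρ}`; with
`μ^ρ = 2R` iteration shows that the pairing vanishes.
-/

noncomputable section

namespace Subdiffusion

open scoped Real

section RelaxationDensity

variable {ρ : ℝ}

/-- The density, in the logarithmic variable `y`, of the positive measure whose Laplace transform is
`τ ↦ E_ρ(-τ ^ ρ)`: see `relaxation` and `mittagLeffler_neg_rpow`. -/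
def relaxDensity (ρ y : ℝ) : ℝ :=
  Real.sin (π * ρ) / (2 * π * (Real.cosh (ρ * y) + Real.cos (π * ρ)))

lemma sin_pi_mul_pos (hρ : ρ ∈ Ioo (0 : ℝ) 1) : 0 < Real.sin (π * ρ) :=
  Real.sin_pos_of_pos_of_lt_pi (mul_pos Real.pi_pos hρ.1) (mul_lt_of_lt_one_right Real.pi_pos hρ.2)

lemma one_add_cos_pi_mul_pos (hρ : ρ ∈ Ioo (0 : ℝ) 1) : 0 < 1 + Real.cos (π * ρ) := by
  nlinarith [Real.neg_one_le_cos (π * ρ), sin_pi_mul_pos hρ, Real.sin_sq_add_cos_sq (π * ρ)]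

lemma cosh_add_cos_pos (hρ : ρ ∈ Ioo (0 : ℝ) 1) (y : ℝ) :
    0 < Real.cosh (ρ * y) + Real.cos (π * ρ) := by
  linarith [one_add_cos_pi_mul_pos hρ, Real.one_le_cosh (ρ * y)]

lemma relaxDensity_pos (hρ : ρ ∈ Ioo (0 : ℝ) 1) (y : ℝ) : 0 < relaxDensity ρ y :=
  div_pos (sin_pi_mul_pos hρ) (mul_pos Real.two_pi_pos (cosh_add_cos_pos hρ y))

lemma relaxDensity_neg (ρ y : ℝ) : relaxDensity ρ (-y) = relaxDensity ρ y := by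
  simp [relaxDensity]

lemma continuous_relaxDensity (hρ : ρ ∈ Ioo (0 : ℝ) 1) : Continuous (relaxDensity ρ) :=
  continuous_const.div (by fun_prop) fun y =>
    (mul_pos Real.two_pi_pos (cosh_add_cos_pos hρ y)).ne'

lemma relaxDensity_le (hρ : ρ ∈ Ioo (0 : ℝ) 1) (y : ℝ) :
    relaxDensity ρ y ≤
      2 * Real.sin (π * ρ) / (π * (1 + Real.cos (π * ρ))) * Real.exp (ρ * y) := by
  have hsin := sin_pi_mul_pos hρ
  have hcos := one_add_cos_pi_mul_pos hρ
  have hcosh : Real.exp (-(ρ * y)) / 2 ≤ Real.cosh (ρ * y) := by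
    rw [Real.cosh_eq]
    linarith [Real.exp_pos (ρ * y)]
  have hdenom : (1 + Real.cos (π * ρ)) / 2 * (Real.exp (-(ρ * y)) / 2) ≤
      Real.cosh (ρ * y) + Real.cos (π * ρ) := by
    nlinarith [Real.one_le_cosh (ρ * y), Real.cos_le_one (π * ρ)]
  calc relaxDensity ρ y
      ≤ Real.sin (π * ρ) /
          (2 * π * ((1 + Real.cos (π * ρ)) / 2 * (Real.exp (-(ρ * y)) / 2))) := by
        unfold relaxDensity
        gcongr
    _ = _ := by
        rw [Real.exp_neg]
        field_simp

lemma integrable_relaxDensity (hρ : ρ ∈ Ioo (0 : ℝ) 1) : Integrable (relaxDensity ρ) := by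
  have hleft : IntegrableOn (relaxDensity ρ) (Iic 0) := by
    refine ((integrableOn_exp_mul_Iic hρ.1 0).const_mul
      (2 * Real.sin (π * ρ) / (π * (1 + Real.cos (π * ρ))))).mono'
      (continuous_relaxDensity hρ).aestronglyMeasurable (ae_of_all _ fun y => ?_)
    rw [Real.norm_of_nonneg (relaxDensity_pos hρ y).le]
    exact relaxDensity_le hρ y
  have hright : IntegrableOn (relaxDensity ρ) (Ioi 0) := by
    have hreflect := IntegrableOn.comp_neg_Ici (c := (0 : ℝ)) (by rwa [neg_zero])
    simp only [relaxDensity_neg] at hreflect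
    exact hreflect.mono_set Ioi_subset_Ici_self
  simpa using hleft.union hright

end RelaxationDensity

section StieltjesTransform

variable {ρ : ℝ}

lemma exp_ne_neg_one_of_abs_im_lt {w : ℂ} (h : |w.im| < π) : Complex.exp w ≠ -1 := by
  intro hexp
  have hlog := Complex.log_exp (by linarith [(abs_lt.1 h).1]) (abs_lt.1 h).2.le
  rw [hexp, Complex.log_neg_one] at hlog
  simp [← hlog, abs_of_pos Real.pi_pos] at h

lemma exp_ne_one_of_abs_im_lt {w : ℂ} (h : |w.im| < 2 * π) (hw : w ≠ 0) : Complex.exp w ≠ 1 := by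
  intro hexp
  have him : |(w / 2).im| < π := by
    simp only [Complex.div_ofNat_im, abs_div, Nat.abs_ofNat]
    linarith
  have hsq : Complex.exp (w / 2) * Complex.exp (w / 2) = 1 := by
    rw [← Complex.exp_add, add_halves, hexp]
  rcases mul_self_eq_one_iff.1 hsq with hone | hneg
  · have hlog := Complex.log_exp (by linarith [(abs_lt.1 him).1]) (abs_lt.1 him).2.le
    rw [hone, Complex.log_one] at hlog
    exact hw (by linear_combination -2 * hlog)
  · exact exp_ne_neg_one_of_abs_im_lt him hneg

/-- The extension of `Real.sigmoid` to the complex plane. -/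
def logistic (z : ℂ) : ℂ := (1 + Complex.exp (-z))⁻¹

lemma logistic_ofReal (x : ℝ) : logistic x = Real.sigmoid x := by
  simp [logistic, Real.sigmoid_def]

lemma one_add_exp_neg_ne_zero {z : ℂ} (hz : |z.im| < π) : 1 + Complex.exp (-z) ≠ 0 := fun h =>
  exp_ne_neg_one_of_abs_im_lt (by simpa using hz) (eq_neg_of_add_eq_zero_right h)

lemma differentiableAt_logistic {z : ℂ} (hz : |z.im| < π) : DifferentiableAt ℂ logistic z :=
  DifferentiableAt.inv (by fun_prop) (one_add_exp_neg_ne_zero hz)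

lemma logistic_sub_logistic (hρ : ρ ∈ Ioo (0 : ℝ) 1) (y : ℝ) :
    logistic (ρ * (y + (-π : ℝ) * Complex.I)) - logistic (ρ * (y + (π : ℝ) * Complex.I)) =
      -(2 * π * Complex.I) * relaxDensity ρ y := by
  have hne : ∀ s : ℝ, |s| = π → 1 + Complex.exp (-(ρ * (y + s * Complex.I))) ≠ 0 := by
    intro s hs
    apply one_add_exp_neg_ne_zero
    simpa [abs_mul, hs, abs_of_pos hρ.1] using mul_lt_of_lt_one_left Real.pi_pos hρ.2
  have hlower := hne (-π) (by rw [abs_neg, abs_of_pos Real.pi_pos])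
  have hupper := hne π (abs_of_pos Real.pi_pos)
  have hdenom : (Real.cosh (ρ * y) + Real.cos (π * ρ) : ℂ) ≠ 0 :=
    mod_cast (cosh_add_cos_pos hρ y).ne'
  have hpi : (π : ℂ) ≠ 0 := mod_cast Real.pi_ne_zero
  have hexp_lower : Complex.exp (-(ρ * (y + (-π : ℝ) * Complex.I))) =
      Complex.exp (-(ρ * y)) * Complex.exp ((π * ρ) * Complex.I) := by
    rw [← Complex.exp_add]
    push_cast
    ring_nf
  have hexp_upper : Complex.exp (-(ρ * (y + (π : ℝ) * Complex.I))) =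
      Complex.exp (-(ρ * y)) * Complex.exp (-(π * ρ) * Complex.I) := by
    rw [← Complex.exp_add]
    ring_nf
  unfold logistic
  rw [inv_sub_inv hlower hupper, div_eq_iff (mul_ne_zero hlower hupper), hexp_lower, hexp_upper]
  simp only [relaxDensity]
  push_cast at hdenom ⊢
  rw [Complex.exp_mul_I, Complex.exp_mul_I, Complex.cos_neg, Complex.sin_neg, Complex.exp_neg]
  rw [Complex.cosh, Complex.exp_neg] at hdenom ⊢
  have hX := Complex.exp_ne_zero (ρ * y)
  have hpyth := Complex.sin_sq_add_cos_sq (π * ρ)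
  set S := Complex.sin (π * ρ)
  set K := Complex.cos (π * ρ)
  set X := Complex.exp (ρ * y)
  have hprod : (1 + X⁻¹ * (K + S * Complex.I)) * (1 + X⁻¹ * (K + -S * Complex.I)) =
      X⁻¹ * (2 * ((X + X⁻¹) / 2 + K)) := by
    field_simp
    linear_combination hpyth - S ^ 2 * Complex.I_sq
  rw [hprod]
  generalize (X + X⁻¹) / 2 + K = q at *
  field_simp
  ring

/-- The function `z ↦ (L(ρ z) - L(ρ x)) / (1 - e ^ (x - z))`, where `L` is the logistic function,
with the singularity at `x` removed: its integral over the boundary of the strip `|Im z| ≤ π` gives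
the Stieltjes transform of `relaxDensity`. -/
def contourFun (ρ x : ℝ) (z : ℂ) : ℂ :=
  dslope (fun w => logistic (ρ * w)) x z / dslope (fun w : ℂ => 1 - Complex.exp (-(w - x))) x z

lemma contourFun_of_ne {x : ℝ} {z : ℂ} (hz : z ≠ x) :
    contourFun ρ x z =
      (logistic (ρ * z) - logistic (ρ * x)) * (1 - Complex.exp (-(z - x)))⁻¹ := by
  rw [contourFun, dslope_of_ne _ hz, dslope_of_ne _ hz, slope_def_field, slope_def_field,
    div_div_div_cancel_right₀ (sub_ne_zero.2 hz), div_eq_mul_inv]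
  simp

lemma dslope_one_sub_exp_ne_zero {x z : ℂ} (hz : |(z - x).im| < 2 * π) :
    dslope (fun w : ℂ => 1 - Complex.exp (-(w - x))) x z ≠ 0 := by
  rcases eq_or_ne z x with rfl | hne
  · have hderiv : HasDerivAt (fun w : ℂ => 1 - Complex.exp (-(w - z)))
        (-(Complex.exp (-(z - z)) * (-1))) z :=
      ((hasDerivAt_id z).sub_const z).neg.cexp.const_sub 1
    rw [dslope_same, hderiv.deriv]
    simp
  · have hexp := exp_ne_one_of_abs_im_lt (w := -(z - x)) (by rwa [Complex.neg_im, abs_neg])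
      (neg_ne_zero.2 (sub_ne_zero.2 hne))
    rw [dslope_of_ne _ hne, slope_def_field, sub_self x, neg_zero, Complex.exp_zero, sub_self,
      sub_zero]
    exact div_ne_zero (sub_ne_zero.2 hexp.symm) (sub_ne_zero.2 hne)

lemma differentiableAt_contourFun (hρ : ρ ∈ Ioo (0 : ℝ) 1) (x : ℝ) {z : ℂ} (hz : |z.im| ≤ π) :
    DifferentiableAt ℂ (contourFun ρ x) z := by
  have hopen : IsOpen {w : ℂ | |ρ * w.im| < π} := isOpen_lt (by fun_prop) (by fun_prop)
  have hlogistic : DifferentiableOn ℂ (fun w => logistic (ρ * w)) {w : ℂ | |ρ * w.im| < π} :=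
    fun w hw => (DifferentiableAt.comp (f := fun w : ℂ => ρ * w) w
      (differentiableAt_logistic (by simpa using hw)) (by fun_prop)).differentiableWithinAt
  have hzmem : z ∈ {w : ℂ | |ρ * w.im| < π} := by
    rw [mem_ofPred, abs_mul, abs_of_pos hρ.1]
    nlinarith [hρ.1, hρ.2, abs_nonneg z.im, Real.pi_pos]
  refine DifferentiableAt.div ?_ ?_ (dslope_one_sub_exp_ne_zero ?_)
  · exact ((Complex.differentiableOn_dslope (hopen.mem_nhds (by simp [Real.pi_pos]))).2
      hlogistic).differentiableAt (hopen.mem_nhds hzmem)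
  · have hexp : Differentiable ℂ fun w : ℂ => 1 - Complex.exp (-(w - x)) := by fun_prop
    exact ((Complex.differentiableOn_dslope univ_mem).2 hexp.differentiableOn).differentiableAt
      univ_mem
  · rw [Complex.sub_im, Complex.ofReal_im, sub_zero]
    linarith [Real.pi_pos]

lemma contourFun_sub_contourFun (hρ : ρ ∈ Ioo (0 : ℝ) 1) (x y : ℝ) :
    contourFun ρ x (y + (-π : ℝ) * Complex.I) - contourFun ρ x (y + (π : ℝ) * Complex.I) =
      -(2 * π * Complex.I) * ((relaxDensity ρ y * Real.sigmoid (y - x) : ℝ) : ℂ) := by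
  have hne : ∀ s : ℝ, s ≠ 0 → (y + s * Complex.I : ℂ) ≠ x := fun s hs h =>
    hs (by simpa using congrArg Complex.im h)
  have hexp_lower : Complex.exp (-(y + (-π : ℝ) * Complex.I - x)) = -Real.exp (x - y) := by
    have : -(y + (-π : ℝ) * Complex.I - x : ℂ) = ((x - y : ℝ) : ℂ) + π * Complex.I := by
      push_cast
      ring
    rw [this, Complex.exp_add, Complex.exp_pi_mul_I, Complex.ofReal_exp, mul_neg_one]
  have hexp_upper : Complex.exp (-(y + (π : ℝ) * Complex.I - x)) = -Real.exp (x - y) := by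
    have : -(y + (π : ℝ) * Complex.I - x : ℂ) = ((x - y : ℝ) : ℂ) - π * Complex.I := by
      push_cast
      ring
    rw [this, Complex.exp_sub, Complex.exp_pi_mul_I, Complex.ofReal_exp, div_neg, div_one]
  rw [contourFun_of_ne (hne _ (neg_ne_zero.2 Real.pi_ne_zero)),
    contourFun_of_ne (hne _ Real.pi_ne_zero), hexp_lower, hexp_upper, ← sub_mul,
    sub_sub_sub_cancel_right, logistic_sub_logistic hρ, Real.sigmoid_def, neg_sub]
  push_cast
  ring

lemma tendsto_neg_mul_comap_re (ρ : ℝ) {l l' : Filter ℝ} (h : Tendsto (fun r => -(ρ * r)) l l') :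
    Tendsto (fun z : ℂ => -(ρ * z)) (comap Complex.re l) (comap Complex.re l') := by
  rw [tendsto_comap_iff]
  simpa [Function.comp_def] using h.comp tendsto_comap

lemma tendsto_inv_one_add_mul_exp_neg_atTop (hρ : 0 < ρ) (b : ℂ) :
    Tendsto (fun z : ℂ => (1 + b * Complex.exp (-(ρ * z)))⁻¹) (comap Complex.re atTop) (𝓝 1) := by
  have hexp := Complex.tendsto_exp_comap_re_atBot.comp (tendsto_neg_mul_comap_re ρ
    (tendsto_neg_atTop_atBot.comp (tendsto_id.const_mul_atTop hρ)))
  simpa using ((hexp.const_mul b).const_add 1).inv₀ (by simp)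

lemma tendsto_inv_one_add_mul_exp_neg_atBot (hρ : 0 < ρ) {b : ℂ} (hb : b ≠ 0) :
    Tendsto (fun z : ℂ => (1 + b * Complex.exp (-(ρ * z)))⁻¹) (comap Complex.re atBot) (𝓝 0) := by
  have hexp := Complex.tendsto_exp_comap_re_atTop.comp (tendsto_neg_mul_comap_re ρ
    (tendsto_neg_atBot_atTop.comp (tendsto_id.const_mul_atBot hρ)))
  exact tendsto_inv₀_cobounded.comp
    ((tendsto_const_add_cobounded 1).comp ((tendsto_mul_left_cobounded hb).comp hexp))

lemma contourFun_eventuallyEq {x : ℝ} {l : Filter ℝ} (hl : ∀ᶠ r in l, r ≠ x) :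
    (fun z => ((1 + 1 * Complex.exp (-(ρ * z)))⁻¹ - logistic (ρ * x)) *
      (1 + -Complex.exp x * Complex.exp (-((1 : ℝ) * z)))⁻¹) =ᶠ[comap Complex.re l]
      contourFun ρ x := by
  filter_upwards [preimage_mem_comap hl] with z hz
  rw [contourFun_of_ne fun h => hz (by simp [h]), one_mul, neg_mul, ← Complex.exp_add,
    Complex.ofReal_one, one_mul, ← sub_eq_add_neg, ← sub_eq_add_neg, neg_sub, logistic.eq_1 (ρ * z)]

lemma tendsto_contourFun_atTop (hρ : 0 < ρ) (x : ℝ) :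
    Tendsto (contourFun ρ x) (comap Complex.re atTop) (𝓝 (1 - logistic (ρ * x))) := by
  refine Tendsto.congr' (contourFun_eventuallyEq (eventually_ne_atTop x)) ?_
  simpa only [mul_one] using ((tendsto_inv_one_add_mul_exp_neg_atTop hρ 1).sub_const _).mul
    (tendsto_inv_one_add_mul_exp_neg_atTop one_pos (-Complex.exp x))

lemma tendsto_contourFun_atBot (hρ : 0 < ρ) (x : ℝ) :
    Tendsto (contourFun ρ x) (comap Complex.re atBot) (𝓝 0) := by
  refine Tendsto.congr' (contourFun_eventuallyEq (eventually_ne_atBot x)) ?_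
  have hlogistic := (tendsto_inv_one_add_mul_exp_neg_atBot hρ one_ne_zero).sub_const
    (logistic (ρ * x))
  simpa only [mul_zero] using hlogistic.mul
    (tendsto_inv_one_add_mul_exp_neg_atBot one_pos (neg_ne_zero.2 (Complex.exp_ne_zero x)))

lemma tendsto_integral_vertical {f : ℂ → ℂ} {l : Filter ℝ} [l.IsCountablyGenerated] {c : ℂ}
    {a b : ℝ} (hf : Tendsto f (comap Complex.re l) (𝓝 c)) (hab : a ≤ b)
    (hcont : ∀ r : ℝ, ContinuousOn (fun s : ℝ => f (r + s * Complex.I)) (Icc a b)) :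
    Tendsto (fun r : ℝ => ∫ s in a..b, f (r + s * Complex.I)) l (𝓝 ((b - a) * c)) := by
  have hconst : ((b - a) * c : ℂ) = ∫ _ in a..b, c := by simp
  rw [hconst]
  refine intervalIntegral.tendsto_integral_filter_of_dominated_convergence (fun _ => ‖c‖ + 1)
    (Eventually.of_forall fun r => ?_) ?_ (by simp) (ae_of_all _ fun s _ => hf.comp ?_)
  · rw [uIoc_of_le hab]
    exact ((hcont r).mono Ioc_subset_Icc_self).aestronglyMeasurable measurableSet_Ioc
  · have hbound : ∀ᶠ z in comap Complex.re l, ‖f z‖ < ‖c‖ + 1 :=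
      hf.norm.eventually (gt_mem_nhds (lt_add_one _))
    rw [eventually_comap] at hbound
    filter_upwards [hbound] with r hr
    exact ae_of_all _ fun s _ => (hr (r + s * Complex.I) (by simp)).le
  · rw [tendsto_comap_iff]
    exact tendsto_id.congr fun r => by simp

lemma continuous_contourFun_horizontal (hρ : ρ ∈ Ioo (0 : ℝ) 1) (x : ℝ) {s : ℝ} (hs : |s| ≤ π) :
    Continuous fun y : ℝ => contourFun ρ x (y + s * Complex.I) :=
  continuous_iff_continuousAt.2 fun y =>
    ContinuousAt.comp (f := fun y : ℝ => (y + s * Complex.I : ℂ))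
      (differentiableAt_contourFun hρ x (by simpa)).continuousAt (by fun_prop)

lemma continuousOn_contourFun_vertical (hρ : ρ ∈ Ioo (0 : ℝ) 1) (x r : ℝ) :
    ContinuousOn (fun s : ℝ => contourFun ρ x (r + s * Complex.I)) (Icc (-π) π) := fun s hs =>
  (ContinuousAt.comp (f := fun s : ℝ => (r + s * Complex.I : ℂ))
    (differentiableAt_contourFun hρ x (by simpa using abs_le.2 hs)).continuousAt
    (by fun_prop)).continuousWithinAt

lemma integral_contourFun_rect (hρ : ρ ∈ Ioo (0 : ℝ) 1) (x R : ℝ) :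
    -(2 * π * Complex.I) *
        ((∫ y in -R..R, relaxDensity ρ y * Real.sigmoid (y - x) : ℝ) : ℂ) +
      Complex.I * (∫ s in -π..π, contourFun ρ x (R + s * Complex.I)) -
      Complex.I * (∫ s in -π..π, contourFun ρ x ((-R : ℝ) + s * Complex.I)) = 0 := by
  have hcauchy := Complex.integral_boundary_rect_eq_zero_of_differentiableOn (contourFun ρ x)
    ⟨-R, -π⟩ ⟨R, π⟩ (by
      intro z hz
      have him := hz.2
      simp only [mem_preimage, uIcc_of_le (neg_le_self Real.pi_pos.le)] at him
      exact (differentiableAt_contourFun hρ x (abs_le.2 him)).differentiableWithinAt)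
  rw [← intervalIntegral.integral_sub
    ((continuous_contourFun_horizontal hρ x
      (by rw [abs_neg, abs_of_pos Real.pi_pos])).intervalIntegrable _ _)
    ((continuous_contourFun_horizontal hρ x
      (abs_of_pos Real.pi_pos).le).intervalIntegrable _ _)] at hcauchy
  simp only [contourFun_sub_contourFun hρ] at hcauchy
  rw [intervalIntegral.integral_const_mul, intervalIntegral.integral_ofReal] at hcauchy
  simpa using hcauchy

lemma integrable_relaxDensity_mul_sigmoid (hρ : ρ ∈ Ioo (0 : ℝ) 1) (x : ℝ) :
    Integrable fun y => relaxDensity ρ y * Real.sigmoid (y - x) :=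
  (integrable_relaxDensity hρ).mul_bdd (c := 1)
    (continuous_sigmoid.comp (continuous_id.sub continuous_const)).aestronglyMeasurable
    (ae_of_all _ fun y => by
      rw [Real.norm_of_nonneg (Real.sigmoid_nonneg _)]
      exact Real.sigmoid_le_one _)

theorem integral_relaxDensity_mul_sigmoid (hρ : ρ ∈ Ioo (0 : ℝ) 1) (x : ℝ) :
    ∫ y, relaxDensity ρ y * Real.sigmoid (y - x) = Real.sigmoid (-(ρ * x)) := by
  have hinner := intervalIntegral_tendsto_integral (integrable_relaxDensity_mul_sigmoid hρ x)
    tendsto_neg_atTop_atBot tendsto_id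
  have hright := tendsto_integral_vertical (tendsto_contourFun_atTop hρ.1 x)
    (neg_le_self Real.pi_pos.le) (continuousOn_contourFun_vertical hρ x)
  have hleft := (tendsto_integral_vertical (tendsto_contourFun_atBot hρ.1 x)
    (neg_le_self Real.pi_pos.le) (continuousOn_contourFun_vertical hρ x)).comp
    tendsto_neg_atTop_atBot
  have hsum := (((Complex.continuous_ofReal.tendsto _).comp hinner).const_mul
    (-(2 * π * Complex.I))).add (hright.const_mul Complex.I) |>.sub (hleft.const_mul Complex.I)
  have hlimit := tendsto_nhds_unique hsum
    (tendsto_const_nhds.congr fun R => (integral_contourFun_rect hρ x R).symm)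
  have hlogistic : logistic (ρ * x) = Real.sigmoid (ρ * x) := mod_cast logistic_ofReal (ρ * x)
  have hpiI : (2 * π * Complex.I : ℂ) ≠ 0 := Complex.two_pi_I_ne_zero
  rw [Real.sigmoid_neg, ← Complex.ofReal_inj, ← sub_eq_zero]
  refine (mul_eq_zero.1 ?_).resolve_left hpiI
  rw [hlogistic] at hlimit
  push_cast at hlimit ⊢
  linear_combination -hlimit

theorem integral_relaxDensity (hρ : ρ ∈ Ioo (0 : ℝ) 1) : ∫ y, relaxDensity ρ y = 1 := by
  have hhalf : ∫ y, relaxDensity ρ y * Real.sigmoid y = 2⁻¹ := by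
    simpa using integral_relaxDensity_mul_sigmoid hρ 0
  have hreflect := integral_neg_eq_self (fun y => relaxDensity ρ y * Real.sigmoid y) volume
  simp only [relaxDensity_neg, Real.sigmoid_neg, mul_sub, mul_one] at hreflect
  rw [integral_sub (integrable_relaxDensity hρ)
    (by simpa using integrable_relaxDensity_mul_sigmoid hρ 0), hhalf] at hreflect
  linarith

end StieltjesTransform

section Relaxation

lemma integral_pos_of_forall_pos {α : Type*} [MeasurableSpace α] {μ : Measure α} [NeZero μ]
    {f : α → ℝ} (hf : Integrable f μ) (hpos : ∀ x, 0 < f x) : 0 < ∫ x, f x ∂μ := by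
  have hsupport : Function.support f = univ := eq_univ_of_forall fun x => (hpos x).ne'
  rw [integral_pos_iff_support_of_nonneg (fun x => (hpos x).le) hf, hsupport]
  exact NeZero.pos (μ univ)

variable {ρ τ : ℝ}

/-- The relaxation function `τ ↦ E_ρ(-τ ^ ρ)`, presented as the Laplace transform of the positive
measure with logarithmic density `relaxDensity ρ`. -/
def relaxation (ρ τ : ℝ) : ℝ :=
  ∫ y, Real.exp (-(τ * Real.exp y)) * relaxDensity ρ y

lemma norm_exp_neg_mul_exp_le_one (hτ : 0 ≤ τ) (y : ℝ) : ‖Real.exp (-(τ * Real.exp y))‖ ≤ 1 := by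
  rw [Real.norm_of_nonneg (Real.exp_nonneg _), Real.exp_le_one_iff, neg_nonpos]
  positivity

lemma integrable_relaxation (hρ : ρ ∈ Ioo (0 : ℝ) 1) (hτ : 0 ≤ τ) :
    Integrable fun y => Real.exp (-(τ * Real.exp y)) * relaxDensity ρ y :=
  (integrable_relaxDensity hρ).bdd_mul (by fun_prop)
    (ae_of_all _ (norm_exp_neg_mul_exp_le_one hτ))

lemma relaxation_zero (hρ : ρ ∈ Ioo (0 : ℝ) 1) : relaxation ρ 0 = 1 := by
  simp [relaxation, integral_relaxDensity hρ]

lemma relaxation_pos (hρ : ρ ∈ Ioo (0 : ℝ) 1) (hτ : 0 ≤ τ) : 0 < relaxation ρ τ :=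
  integral_pos_of_forall_pos (integrable_relaxation hρ hτ) fun y =>
    mul_pos (Real.exp_pos _) (relaxDensity_pos hρ y)

lemma strictAntiOn_relaxation (hρ : ρ ∈ Ioo (0 : ℝ) 1) : StrictAntiOn (relaxation ρ) (Ici 0) := by
  intro a ha b hb hab
  rw [← sub_pos, relaxation, relaxation, ← integral_sub (integrable_relaxation hρ ha)
    (integrable_relaxation hρ hb)]
  refine integral_pos_of_forall_pos
    ((integrable_relaxation hρ ha).sub (integrable_relaxation hρ hb)) fun y => ?_
  have hexp : Real.exp (-(b * Real.exp y)) < Real.exp (-(a * Real.exp y)) := by gcongr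
  exact sub_pos.2 (mul_lt_mul_of_pos_right hexp (relaxDensity_pos hρ y))

lemma relaxation_le_one (hρ : ρ ∈ Ioo (0 : ℝ) 1) (hτ : 0 ≤ τ) : relaxation ρ τ ≤ 1 := by
  rw [← relaxation_zero hρ]
  exact (strictAntiOn_relaxation hρ).antitoneOn self_mem_Ici hτ hτ

lemma continuousOn_relaxation (hρ : ρ ∈ Ioo (0 : ℝ) 1) : ContinuousOn (relaxation ρ) (Ici 0) := by
  refine continuousOn_of_dominated (bound := relaxDensity ρ)
    (fun τ hτ => (integrable_relaxation hρ hτ).aestronglyMeasurable)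
    (fun τ hτ => ae_of_all _ fun y => ?_) (integrable_relaxDensity hρ)
    (ae_of_all _ fun y => by fun_prop)
  rw [norm_mul, Real.norm_of_nonneg (relaxDensity_pos hρ y).le]
  exact mul_le_of_le_one_left (relaxDensity_pos hρ y).le (norm_exp_neg_mul_exp_le_one hτ y)

lemma mul_exp_neg_le_one (x : ℝ) : x * Real.exp (-x) ≤ 1 :=
  (Real.mul_exp_neg_le_exp_neg_one x).trans (Real.exp_le_one_iff.2 (by norm_num))

lemma integrable_and_hasDerivAt_relaxation (hρ : ρ ∈ Ioo (0 : ℝ) 1) (hτ : 0 < τ) :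
    Integrable (fun y => -(Real.exp y * Real.exp (-(τ * Real.exp y))) * relaxDensity ρ y) ∧
    HasDerivAt (relaxation ρ)
      (∫ y, -(Real.exp y * Real.exp (-(τ * Real.exp y))) * relaxDensity ρ y) τ := by
  have hcont := continuous_relaxDensity hρ
  refine hasDerivAt_integral_of_dominated_loc_of_deriv_le
    (F := fun τ y => Real.exp (-(τ * Real.exp y)) * relaxDensity ρ y)
    (F' := fun τ y => -(Real.exp y * Real.exp (-(τ * Real.exp y))) * relaxDensity ρ y)
    (bound := fun y => (2 / τ) * relaxDensity ρ y) (Ioi_mem_nhds (half_lt_self hτ))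
    (Eventually.of_forall fun x => Continuous.aestronglyMeasurable (by fun_prop))
    (integrable_relaxation hρ hτ.le) (Continuous.aestronglyMeasurable (by fun_prop))
    (ae_of_all _ fun y x hx => ?_) ((integrable_relaxDensity hρ).const_mul _)
    (ae_of_all _ fun y x _ => ?_)
  · rw [norm_mul, norm_neg, Real.norm_of_nonneg (relaxDensity_pos hρ y).le,
      Real.norm_of_nonneg (by positivity)]
    refine mul_le_mul_of_nonneg_right ?_ (relaxDensity_pos hρ y).le
    have hle := mul_exp_neg_le_one (x * Real.exp y)
    have hnonneg : 0 ≤ Real.exp y * Real.exp (-(x * Real.exp y)) := by positivity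
    rw [le_div_iff₀ hτ]
    nlinarith [mem_Ioi.1 hx]
  · have hderiv := ((hasDerivAt_mul_const (x := x) (Real.exp y)).neg.exp).mul_const
      (relaxDensity ρ y)
    exact hderiv.congr_deriv (by simp only [Pi.neg_apply]; ring)

lemma hasDerivAt_relaxation (hρ : ρ ∈ Ioo (0 : ℝ) 1) (hτ : 0 < τ) :
    HasDerivAt (relaxation ρ) (deriv (relaxation ρ) τ) τ :=
  (integrable_and_hasDerivAt_relaxation hρ hτ).2.differentiableAt.hasDerivAt

lemma deriv_relaxation_nonpos (hρ : ρ ∈ Ioo (0 : ℝ) 1) (hτ : 0 < τ) :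
    deriv (relaxation ρ) τ ≤ 0 := by
  rw [(integrable_and_hasDerivAt_relaxation hρ hτ).2.deriv]
  exact integral_nonpos fun y =>
    mul_nonpos_of_nonpos_of_nonneg (neg_nonpos.2 (by positivity)) (relaxDensity_pos hρ y).le

lemma mul_abs_deriv_relaxation_le (hρ : ρ ∈ Ioo (0 : ℝ) 1) (hτ : 0 < τ) :
    τ * |deriv (relaxation ρ) τ| ≤ 1 := by
  obtain ⟨hint, hderiv⟩ := integrable_and_hasDerivAt_relaxation hρ hτ
  rw [abs_of_nonpos (deriv_relaxation_nonpos hρ hτ), hderiv.deriv, ← integral_neg,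
    ← integral_const_mul, ← integral_relaxDensity hρ]
  refine integral_mono (hint.neg.const_mul τ) (integrable_relaxDensity hρ) fun y => ?_
  have hle := mul_le_mul_of_nonneg_right (mul_exp_neg_le_one (τ * Real.exp y))
    (relaxDensity_pos hρ y).le
  simp only
  linarith

lemma integrableOn_exp_mul_relaxation (hρ : ρ ∈ Ioo (0 : ℝ) 1) {s : ℝ} (hs : 0 < s) :
    IntegrableOn (fun τ => Real.exp (-(s * τ)) * relaxation ρ τ) (Ioi 0) := by
  have hexp : IntegrableOn (fun τ => Real.exp (-(s * τ))) (Ioi 0) := by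
    simpa using integrableOn_exp_mul_Ioi (neg_lt_zero.2 hs) 0
  refine hexp.mul_bdd (c := 1) (((continuousOn_relaxation hρ).mono
    Ioi_subset_Ici_self).aestronglyMeasurable measurableSet_Ioi) ?_
  filter_upwards [ae_restrict_mem measurableSet_Ioi] with τ hτ
  rw [Real.norm_of_nonneg (relaxation_pos hρ (mem_Ioi.1 hτ).le).le]
  exact relaxation_le_one hρ (mem_Ioi.1 hτ).le

lemma integral_exp_mul_exp_neg_mul_exp {s : ℝ} (hs : 0 < s) (y : ℝ) :
    ∫ τ in Ioi (0 : ℝ), Real.exp (-(s * τ)) * Real.exp (-(τ * Real.exp y)) =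
      s⁻¹ * Real.sigmoid (-y - -Real.log s) := by
  have hcombine : ∀ τ : ℝ, Real.exp (-(s * τ)) * Real.exp (-(τ * Real.exp y)) =
      Real.exp (-(s + Real.exp y) * τ) := fun τ => by
    rw [← Real.exp_add]
    ring_nf
  simp_rw [hcombine]
  rw [integral_exp_mul_Ioi (neg_lt_zero.2 (by positivity)), Real.sigmoid_def, neg_sub,
    sub_neg_eq_add, ← sub_eq_neg_add, Real.exp_sub, Real.exp_log hs, mul_zero, Real.exp_zero]
  field_simp

lemma integrable_exp_mul_exp_mul_relaxDensity (hρ : ρ ∈ Ioo (0 : ℝ) 1) {s : ℝ} (hs : 0 < s) :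
    Integrable (Function.uncurry fun τ y : ℝ =>
      Real.exp (-(s * τ)) * (Real.exp (-(τ * Real.exp y)) * relaxDensity ρ y))
      ((volume.restrict (Ioi 0)).prod volume) := by
  have hcont := continuous_relaxDensity hρ
  have hexp : IntegrableOn (fun τ => Real.exp (-(s * τ))) (Ioi 0) := by
    simpa using integrableOn_exp_mul_Ioi (neg_lt_zero.2 hs) 0
  have hmem : ∀ᵐ p : ℝ × ℝ ∂((volume.restrict (Ioi (0 : ℝ))).prod volume), p.1 ∈ Ioi (0 : ℝ) :=
    Measure.quasiMeasurePreserving_fst.ae (ae_restrict_mem measurableSet_Ioi)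
  refine (hexp.mul_prod (integrable_relaxDensity hρ)).mono'
    (by fun_prop : Continuous _).aestronglyMeasurable ?_
  filter_upwards [hmem] with p hp
  have hle := norm_exp_neg_mul_exp_le_one (mem_Ioi.1 hp).le p.2
  have hpos := relaxDensity_pos hρ p.2
  simp only [Function.uncurry]
  rw [norm_mul, norm_mul, Real.norm_of_nonneg (Real.exp_nonneg (-(s * p.1))),
    Real.norm_of_nonneg hpos.le]
  gcongr
  exact mul_le_of_le_one_left hpos.le hle

theorem integral_exp_mul_relaxation (hρ : ρ ∈ Ioo (0 : ℝ) 1) {s : ℝ} (hs : 0 < s) :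
    ∫ τ in Ioi 0, Real.exp (-(s * τ)) * relaxation ρ τ = s⁻¹ * (1 + s ^ (-ρ))⁻¹ := by
  calc ∫ τ in Ioi 0, Real.exp (-(s * τ)) * relaxation ρ τ
      = ∫ y, ∫ τ in Ioi (0 : ℝ), Real.exp (-(s * τ)) *
          (Real.exp (-(τ * Real.exp y)) * relaxDensity ρ y) := by
        simp_rw [relaxation, ← integral_const_mul]
        exact integral_integral_swap (integrable_exp_mul_exp_mul_relaxDensity hρ hs)
    _ = ∫ y, s⁻¹ * (relaxDensity ρ (-y) * Real.sigmoid (-y - -Real.log s)) := by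
        congr 1 with y
        simp_rw [← mul_assoc]
        rw [integral_mul_const, integral_exp_mul_exp_neg_mul_exp hs, relaxDensity_neg]
        ring
    _ = s⁻¹ * Real.sigmoid (-(ρ * -Real.log s)) := by
        rw [integral_const_mul, integral_neg_eq_self
          (fun y => relaxDensity ρ y * Real.sigmoid (y - -Real.log s)) volume,
          integral_relaxDensity_mul_sigmoid hρ]
    _ = s⁻¹ * (1 + s ^ (-ρ))⁻¹ := by
        rw [Real.sigmoid_def, Real.rpow_def_of_pos hs]
        ring_nf

/- Monotonicity bounds `τ e⁻¹ relaxation ρ τ` by the Laplace transform at `1 / τ`. -/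
lemma rpow_mul_relaxation_le (hρ : ρ ∈ Ioo (0 : ℝ) 1) (hτ : 0 ≤ τ) :
    τ ^ ρ * relaxation ρ τ ≤ Real.exp 1 := by
  rcases hτ.eq_or_lt with rfl | hτ
  · rw [Real.zero_rpow hρ.1.ne', zero_mul]
    positivity
  have hrelax := relaxation_pos hρ hτ.le
  have hconst : τ * (Real.exp (-1) * relaxation ρ τ) ≤ τ⁻¹⁻¹ * (1 + τ⁻¹ ^ (-ρ))⁻¹ := calc
    τ * (Real.exp (-1) * relaxation ρ τ)
      = ∫ _ in Ioc 0 τ, Real.exp (-1) * relaxation ρ τ := by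
        simp [hτ.le]
    _ ≤ ∫ u in Ioc 0 τ, Real.exp (-(τ⁻¹ * u)) * relaxation ρ u := by
        refine setIntegral_mono_on (integrableOn_const measure_Ioc_lt_top.ne)
          ((integrableOn_exp_mul_relaxation hρ (inv_pos.2 hτ)).mono_set Ioc_subset_Ioi_self)
          measurableSet_Ioc fun u hu => ?_
        have hdiv : τ⁻¹ * u ≤ 1 := by
          rw [inv_mul_le_iff₀ hτ, mul_one]
          exact hu.2
        have hanti := (strictAntiOn_relaxation hρ).antitoneOn hu.1.le hτ.le hu.2
        gcongr
    _ ≤ ∫ u in Ioi 0, Real.exp (-(τ⁻¹ * u)) * relaxation ρ u := by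
        refine setIntegral_mono_set (integrableOn_exp_mul_relaxation hρ (inv_pos.2 hτ)) ?_
          Ioc_subset_Ioi_self.eventuallyLE
        filter_upwards [ae_restrict_mem measurableSet_Ioi] with u hu
        exact mul_nonneg (Real.exp_nonneg _) (relaxation_pos hρ (mem_Ioi.1 hu).le).le
    _ = τ⁻¹⁻¹ * (1 + τ⁻¹ ^ (-ρ))⁻¹ := integral_exp_mul_relaxation hρ (inv_pos.2 hτ)
  rw [Real.inv_rpow hτ.le, Real.rpow_neg hτ.le, inv_inv, inv_inv, Real.exp_neg,
    mul_le_mul_iff_right₀ hτ, inv_mul_le_iff₀ (Real.exp_pos 1),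
    ← div_eq_mul_inv, le_div_iff₀ (by positivity)] at hconst
  linarith

end Relaxation

section LaplaceUniqueness

variable {f : ℝ → ℝ}

lemma exp_neg_mem_Icc {τ : ℝ} (hτ : τ ∈ Ioi (0 : ℝ)) : Real.exp (-τ) ∈ Icc (0 : ℝ) 1 :=
  ⟨Real.exp_nonneg _, Real.exp_le_one_iff.2 (neg_nonpos.2 (mem_Ioi.1 hτ).le)⟩

lemma integrableOn_comp_exp_neg_mul (hf : IntegrableOn f (Ioi 0)) {g : ℝ → ℝ}
    (hg : ContinuousOn g (Icc 0 1)) : IntegrableOn (fun τ => g (Real.exp (-τ)) * f τ) (Ioi 0) := by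
  obtain ⟨C, hC⟩ := isCompact_Icc.exists_bound_of_continuousOn hg
  refine hf.bdd_mul (c := C) ((hg.comp (by fun_prop) fun τ =>
    exp_neg_mem_Icc).aestronglyMeasurable measurableSet_Ioi) ?_
  filter_upwards [ae_restrict_mem measurableSet_Ioi] with τ hτ using hC _ (exp_neg_mem_Icc hτ)

lemma integral_eval_exp_neg_mul_eq_zero (hf : IntegrableOn f (Ioi 0))
    (h : ∀ n : ℕ, ∫ τ in Ioi 0, Real.exp (-τ) ^ n * f τ = 0) (p : Polynomial ℝ) :
    ∫ τ in Ioi 0, p.eval (Real.exp (-τ)) * f τ = 0 := by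
  simp_rw [Polynomial.eval_eq_sum_range, Finset.sum_mul]
  rw [integral_finsetSum _ fun n _ =>
    integrableOn_comp_exp_neg_mul hf (g := fun x => p.coeff n * x ^ n) (by fun_prop)]
  refine Finset.sum_eq_zero fun n _ => ?_
  simp_rw [mul_assoc]
  rw [integral_const_mul, h, mul_zero]

lemma integral_comp_exp_neg_mul_eq_zero (hf : IntegrableOn f (Ioi 0))
    (h : ∀ n : ℕ, ∫ τ in Ioi 0, Real.exp (-τ) ^ n * f τ = 0) {g : ℝ → ℝ}
    (hg : ContinuousOn g (Icc 0 1)) : ∫ τ in Ioi 0, g (Real.exp (-τ)) * f τ = 0 := by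
  set M := ∫ τ in Ioi 0, ‖f τ‖
  have hM : 0 ≤ M := integral_nonneg fun _ => norm_nonneg _
  rw [← norm_le_zero_iff]
  refine le_of_forall_pos_le_add fun ε hε => ?_
  obtain ⟨p, hp⟩ := exists_polynomial_near_of_continuousOn 0 1 g hg (ε / (M + 1)) (by positivity)
  have hsub : ∫ τ in Ioi 0, g (Real.exp (-τ)) * f τ =
      ∫ τ in Ioi 0, (g (Real.exp (-τ)) * f τ - p.eval (Real.exp (-τ)) * f τ) := by
    rw [integral_sub (integrableOn_comp_exp_neg_mul hf hg)
      (integrableOn_comp_exp_neg_mul hf p.continuous.continuousOn),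
      integral_eval_exp_neg_mul_eq_zero hf h, sub_zero]
  rw [hsub, zero_add]
  calc _ ≤ ∫ τ in Ioi 0, ε / (M + 1) * ‖f τ‖ := by
        refine norm_integral_le_of_norm_le (hf.norm.const_mul _) ?_
        filter_upwards [ae_restrict_mem measurableSet_Ioi] with τ hτ
        rw [← sub_mul, norm_mul, norm_sub_rev]
        gcongr
        exact (hp _ (exp_neg_mem_Icc hτ)).le
    _ = ε / (M + 1) * M := integral_const_mul _ _
    _ ≤ ε := by
        rw [div_mul_eq_mul_div, div_le_iff₀ (by positivity)]
        linarith [mul_nonneg hε.le hM]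

lemma continuous_comp_neg_log {g : ℝ → ℝ} (hg : Continuous g) (hcompact : HasCompactSupport g)
    (hzero : g 0 = 0) : Continuous fun x => g (-Real.log x) := by
  refine continuous_iff_continuousAt.2 fun x => ?_
  rcases eq_or_ne x 0 with rfl | hx
  · rw [continuousAt_iff_punctured_nhds, Real.log_zero, neg_zero, hzero]
    exact (hcompact.is_zero_at_infty.mono_left atTop_le_cocompact).comp
      (tendsto_neg_atBot_atTop.comp Real.tendsto_log_nhdsNE_zero)
  · exact hg.continuousAt.comp (Real.continuousAt_log hx).neg

/- In the variable `e ^ (-τ)` this is the density of polynomials in `C([0, 1])`. -/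
theorem ae_eq_zero_of_laplace_eq_zero (hf : IntegrableOn f (Ioi 0))
    (h : ∀ n : ℕ, ∫ τ in Ioi 0, Real.exp (-τ) ^ n * f τ = 0) :
    ∀ᵐ τ, τ ∈ Ioi (0 : ℝ) → f τ = 0 := by
  refine isOpen_Ioi.ae_eq_zero_of_integral_contDiff_smul_eq_zero hf.locallyIntegrableOn
    fun g hg hcompact hsupport => ?_
  have hzero : ∀ τ ∉ Ioi (0 : ℝ), g τ = 0 := fun τ hτ =>
    image_eq_zero_of_notMem_tsupport fun hmem => hτ (hsupport hmem)
  have hlog := integral_comp_exp_neg_mul_eq_zero hf h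
    (continuous_comp_neg_log hg.continuous hcompact (hzero 0 self_notMem_Ioi)).continuousOn
  simp only [Real.log_exp, neg_neg] at hlog
  rw [← hlog, setIntegral_eq_integral_of_forall_compl_eq_zero
    fun τ hτ => by rw [hzero τ hτ, zero_mul]]
  simp only [smul_eq_mul]

end LaplaceUniqueness

section MittagLefflerSeries

variable {ρ : ℝ}

lemma exp_neg_mul_rpow_le_Gamma {R x : ℝ} (hR : 0 < R) (hx : 0 ≤ x) :
    Real.exp (-R) * R ^ x ≤ Real.Gamma (x + 1) := by
  have hconv := Real.GammaIntegral_convergent (s := x + 1) (by linarith)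
  have hexp : IntegrableOn (fun u => Real.exp (-u)) (Ioi R) := by
    simpa using integrableOn_exp_mul_Ioi (a := -1) (by norm_num) R
  calc Real.exp (-R) * R ^ x = ∫ u in Ioi R, Real.exp (-u) * R ^ x := by
        rw [integral_mul_const, integral_exp_neg_Ioi]
    _ ≤ ∫ u in Ioi R, Real.exp (-u) * u ^ (x + 1 - 1) := by
        refine setIntegral_mono_on (hexp.mul_const _)
          (hconv.mono_set (Ioi_subset_Ioi hR.le)) measurableSet_Ioi fun u hu => ?_
        rw [add_sub_cancel_right]
        gcongr
        exact (mem_Ioi.1 hu).le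
    _ ≤ ∫ u in Ioi 0, Real.exp (-u) * u ^ (x + 1 - 1) := by
        refine setIntegral_mono_set hconv ?_ (Ioi_subset_Ioi hR.le).eventuallyLE
        filter_upwards [ae_restrict_mem measurableSet_Ioi] with u hu
        exact mul_nonneg (Real.exp_nonneg _) (Real.rpow_nonneg (mem_Ioi.1 hu).le _)
    _ = Real.Gamma (x + 1) := (Real.Gamma_eq_integral (by linarith)).symm

lemma Gamma_mul_natCast_add_one_pos (hρ : 0 ≤ ρ) (k : ℕ) : 0 < Real.Gamma (ρ * k + 1) :=
  Real.Gamma_pos_of_pos (by positivity)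

lemma rpow_pow_eq_rpow_mul {τ : ℝ} (hτ : 0 ≤ τ) (ρ : ℝ) (k : ℕ) :
    (τ ^ ρ) ^ k = τ ^ (ρ * k) := by
  rw [Real.rpow_mul hτ, Real.rpow_natCast]

lemma pow_div_Gamma_le (hρ : 0 ≤ ρ) {R B : ℝ} (hR : 0 < R) (hB : 0 ≤ B) (k : ℕ) :
    B ^ k / Real.Gamma (ρ * k + 1) ≤ Real.exp R * (B / R ^ ρ) ^ k := by
  have hGamma := exp_neg_mul_rpow_le_Gamma hR (by positivity : 0 ≤ ρ * k)
  rw [← rpow_pow_eq_rpow_mul hR.le] at hGamma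
  calc B ^ k / Real.Gamma (ρ * k + 1) ≤ B ^ k / (Real.exp (-R) * (R ^ ρ) ^ k) := by gcongr
    _ = Real.exp R * (B / R ^ ρ) ^ k := by
        rw [Real.exp_neg, div_pow]
        field_simp

lemma summable_pow_div_Gamma (hρ : 0 < ρ) {B : ℝ} (hB : 0 ≤ B) :
    Summable fun k : ℕ => B ^ k / Real.Gamma (ρ * k + 1) := by
  set R := (2 * B + 1) ^ (1 / ρ)
  have hR : 0 < R := Real.rpow_pos_of_pos (by linarith) _
  have hRρ : R ^ ρ = 2 * B + 1 := by
    rw [← Real.rpow_mul (by linarith), one_div_mul_cancel hρ.ne', Real.rpow_one]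
  have hratio : B / R ^ ρ < 1 := by
    rw [hRρ, div_lt_one (by linarith)]
    linarith
  exact Summable.of_nonneg_of_le
    (fun k => div_nonneg (pow_nonneg hB k) (Gamma_mul_natCast_add_one_pos hρ.le k).le)
    (pow_div_Gamma_le hρ.le hR hB)
    ((summable_geometric_of_lt_one (by positivity) hratio).mul_left _)

lemma norm_pow_div_Gamma_le (hρ : 0 ≤ ρ) {z B : ℝ} (hz : |z| ≤ B) (k : ℕ) :
    ‖z ^ k / Real.Gamma (ρ * k + 1)‖ ≤ B ^ k / Real.Gamma (ρ * k + 1) := by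
  have hGamma := Gamma_mul_natCast_add_one_pos hρ k
  rw [norm_div, norm_pow, Real.norm_of_nonneg hGamma.le, Real.norm_eq_abs]
  exact div_le_div_of_nonneg_right (pow_le_pow_left₀ (abs_nonneg z) hz k) hGamma.le

lemma summable_mittagLeffler (hρ : 0 < ρ) (z : ℝ) :
    Summable fun k : ℕ => z ^ k / Real.Gamma (ρ * k + 1) :=
  Summable.of_norm_bounded (summable_pow_div_Gamma hρ (abs_nonneg z))
    (norm_pow_div_Gamma_le hρ.le le_rfl)

lemma continuous_mittagLeffler (hρ : 0 < ρ) : Continuous (mittagLeffler ρ) := by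
  refine continuous_iff_continuousAt.2 fun z => ?_
  have hball : ContinuousOn (mittagLeffler ρ) (Metric.ball 0 (|z| + 1)) :=
    continuousOn_tsum (fun k => by fun_prop)
      (summable_pow_div_Gamma hρ (by positivity : 0 ≤ |z| + 1)) fun k x hx =>
        norm_pow_div_Gamma_le hρ.le (by simpa using (Metric.mem_ball.1 hx).le) k
  exact hball.continuousAt (Metric.isOpen_ball.mem_nhds (by simp))

lemma mittagLeffler_zero (ρ : ℝ) : mittagLeffler ρ 0 = 1 := by
  rw [mittagLeffler, tsum_eq_single 0 fun k hk => by simp [hk]]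
  simp

end MittagLefflerSeries

section MittagLefflerLaplace

variable {ρ s c : ℝ}

lemma integrableOn_exp_mul_rpow {a : ℝ} (hs : 0 < s) (ha : 0 < a) :
    IntegrableOn (fun τ : ℝ => Real.exp (-(s * τ)) * τ ^ (a - 1)) (Ioi 0) := by
  refine Integrable.of_integral_ne_zero ?_
  simp_rw [mul_comm (Real.exp _)]
  rw [Real.integral_rpow_mul_exp_neg_mul_Ioi ha hs]
  exact (mul_pos (Real.rpow_pos_of_pos (one_div_pos.2 hs) a) (Real.Gamma_pos_of_pos ha)).ne'

lemma exp_mul_mittagLeffler_term_eqOn (ρ s c : ℝ) (k : ℕ) :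
    EqOn (fun τ : ℝ => Real.exp (-(s * τ)) * ((c * τ ^ ρ) ^ k / Real.Gamma (ρ * k + 1)))
      (fun τ => c ^ k / Real.Gamma (ρ * k + 1) * (Real.exp (-(s * τ)) * τ ^ (ρ * k + 1 - 1)))
      (Ioi 0) := by
  intro τ hτ
  simp only
  rw [mul_pow, rpow_pow_eq_rpow_mul (mem_Ioi.1 hτ).le, add_sub_cancel_right]
  ring

lemma integrableOn_exp_mul_mittagLeffler_term (hρ : 0 < ρ) (hs : 0 < s) (c : ℝ) (k : ℕ) :
    IntegrableOn (fun τ : ℝ => Real.exp (-(s * τ)) *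
      ((c * τ ^ ρ) ^ k / Real.Gamma (ρ * k + 1))) (Ioi 0) :=
  IntegrableOn.congr_fun ((integrableOn_exp_mul_rpow hs (by positivity)).const_mul _)
    (exp_mul_mittagLeffler_term_eqOn ρ s c k).symm measurableSet_Ioi

lemma integral_exp_mul_mittagLeffler_term (hρ : 0 < ρ) (hs : 0 < s) (c : ℝ) (k : ℕ) :
    ∫ τ in Ioi (0 : ℝ), Real.exp (-(s * τ)) * ((c * τ ^ ρ) ^ k / Real.Gamma (ρ * k + 1)) =
      s⁻¹ * (c * s ^ (-ρ)) ^ k := by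
  have hGamma := (Gamma_mul_natCast_add_one_pos hρ.le k).ne'
  have hpos : 0 < ρ * k + 1 := by positivity
  rw [setIntegral_congr_fun measurableSet_Ioi (exp_mul_mittagLeffler_term_eqOn ρ s c k),
    integral_const_mul]
  simp_rw [mul_comm (Real.exp _)]
  rw [Real.integral_rpow_mul_exp_neg_mul_Ioi hpos hs, mul_pow, rpow_pow_eq_rpow_mul hs.le,
    Real.rpow_add (by positivity), Real.rpow_one, one_div, Real.inv_rpow hs.le,
    ← Real.rpow_neg hs.le, ← neg_mul]
  field_simp [hGamma]

lemma integral_norm_exp_mul_mittagLeffler_term (hρ : 0 < ρ) (hs : 0 < s) (c : ℝ) (k : ℕ) :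
    ∫ τ in Ioi (0 : ℝ), ‖Real.exp (-(s * τ)) * ((c * τ ^ ρ) ^ k / Real.Gamma (ρ * k + 1))‖ =
      s⁻¹ * (|c| * s ^ (-ρ)) ^ k := by
  rw [← integral_exp_mul_mittagLeffler_term hρ hs]
  refine setIntegral_congr_fun measurableSet_Ioi fun τ hτ => ?_
  simp only [norm_mul, norm_div, norm_pow, Real.norm_eq_abs, Real.abs_exp,
    abs_of_pos (Gamma_mul_natCast_add_one_pos hρ.le k),
    abs_of_pos (Real.rpow_pos_of_pos (mem_Ioi.1 hτ) ρ)]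

theorem integral_exp_mul_mittagLeffler (hρ : 0 < ρ) (hs : 0 < s) (hc : |c| * s ^ (-ρ) < 1) :
    ∫ τ in Ioi (0 : ℝ), Real.exp (-(s * τ)) * mittagLeffler ρ (c * τ ^ ρ) =
      s⁻¹ * (1 - c * s ^ (-ρ))⁻¹ := by
  have hsummable : Summable fun k : ℕ => ∫ τ in Ioi (0 : ℝ),
      ‖Real.exp (-(s * τ)) * ((c * τ ^ ρ) ^ k / Real.Gamma (ρ * k + 1))‖ := by
    simp_rw [integral_norm_exp_mul_mittagLeffler_term hρ hs]
    exact (summable_geometric_of_lt_one (by positivity) hc).mul_left _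
  have htsum := (hasSum_integral_of_summable_integral_norm
    (integrableOn_exp_mul_mittagLeffler_term hρ hs c) hsummable).tsum_eq
  have habs : |c * s ^ (-ρ)| < 1 := by
    rwa [abs_mul, abs_of_nonneg (Real.rpow_nonneg hs.le _)]
  simp only [integral_exp_mul_mittagLeffler_term hρ hs, tsum_mul_left,
    tsum_geometric_of_abs_lt_one habs] at htsum
  exact htsum.symm

lemma integral_exp_mul_mittagLeffler_neg_rpow (hρ : 0 < ρ) (hs : 1 < s) :
    ∫ τ in Ioi (0 : ℝ), Real.exp (-(s * τ)) * mittagLeffler ρ (-τ ^ ρ) =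
      s⁻¹ * (1 + s ^ (-ρ))⁻¹ := by
  have hlaplace := integral_exp_mul_mittagLeffler (c := -1) hρ (zero_lt_one.trans hs)
    (by simpa using Real.rpow_lt_one_of_one_lt_of_neg hs (neg_lt_zero.2 hρ))
  simpa only [neg_one_mul, sub_neg_eq_add] using hlaplace

lemma integrableOn_exp_mul_mittagLeffler_neg_rpow (hρ : 0 < ρ) (hs : 1 < s) :
    IntegrableOn (fun τ => Real.exp (-(s * τ)) * mittagLeffler ρ (-τ ^ ρ)) (Ioi 0) := by
  refine Integrable.of_integral_ne_zero ?_
  rw [integral_exp_mul_mittagLeffler_neg_rpow hρ hs]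
  positivity

lemma laplace_mittagLeffler_sub_relaxation (hρ : ρ ∈ Ioo (0 : ℝ) 1) (hs : 1 < s) :
    IntegrableOn (fun τ => Real.exp (-(s * τ)) * (mittagLeffler ρ (-τ ^ ρ) - relaxation ρ τ))
      (Ioi 0) ∧
    ∫ τ in Ioi 0, Real.exp (-(s * τ)) * (mittagLeffler ρ (-τ ^ ρ) - relaxation ρ τ) = 0 := by
  have hs0 : 0 < s := zero_lt_one.trans hs
  have hml := integrableOn_exp_mul_mittagLeffler_neg_rpow hρ.1 hs
  have hrelax := integrableOn_exp_mul_relaxation hρ hs0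
  simp_rw [mul_sub]
  refine ⟨hml.sub hrelax, ?_⟩
  rw [integral_sub hml hrelax, integral_exp_mul_mittagLeffler_neg_rpow hρ.1 hs,
    integral_exp_mul_relaxation hρ hs0, sub_self]

lemma mittagLeffler_neg_rpow_ae_eq_relaxation (hρ : ρ ∈ Ioo (0 : ℝ) 1) :
    (fun τ : ℝ => mittagLeffler ρ (-τ ^ ρ)) =ᵐ[volume.restrict (Ioi 0)] relaxation ρ := by
  have hzero := ae_eq_zero_of_laplace_eq_zero
    (laplace_mittagLeffler_sub_relaxation hρ one_lt_two).1 fun n => by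
      have hn : (1 : ℝ) < 2 + n := by linarith [n.cast_nonneg (α := ℝ)]
      refine Eq.trans ?_ (laplace_mittagLeffler_sub_relaxation hρ hn).2
      congr 1 with τ
      rw [← mul_assoc, ← Real.exp_nat_mul, ← Real.exp_add]
      ring_nf
  rw [EventuallyEq, ae_restrict_iff' measurableSet_Ioi]
  filter_upwards [hzero] with τ hτ hpos
  exact sub_eq_zero.1 ((mul_eq_zero.1 (hτ hpos)).resolve_left (Real.exp_pos _).ne')

theorem mittagLeffler_neg_rpow (hρ : ρ ∈ Ioo (0 : ℝ) 1) {τ : ℝ} (hτ : 0 ≤ τ) :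
    mittagLeffler ρ (-τ ^ ρ) = relaxation ρ τ := by
  rcases hτ.eq_or_lt with rfl | hτ
  · rw [Real.zero_rpow hρ.1.ne', neg_zero, mittagLeffler_zero, relaxation_zero hρ]
  · exact Measure.eqOn_open_of_ae_eq (mittagLeffler_neg_rpow_ae_eq_relaxation hρ) isOpen_Ioi
      ((continuous_mittagLeffler hρ.1).comp (Real.continuous_rpow_const hρ.1.le).neg).continuousOn
      ((continuousOn_relaxation hρ).mono Ioi_subset_Ici_self) hτ

lemma mittagLeffler_neg_mul_rpow (hρ : ρ ∈ Ioo (0 : ℝ) 1) {t : ℝ} (hc : 0 ≤ c) (ht : 0 ≤ t) :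
    mittagLeffler ρ (-(c * t ^ ρ)) = relaxation ρ (c ^ (1 / ρ) * t) := by
  rw [← mittagLeffler_neg_rpow hρ (by positivity), Real.mul_rpow (by positivity) ht, one_div,
    Real.rpow_inv_rpow hc hρ.1.ne']

end MittagLefflerLaplace

section RelaxationEquation

variable {ρ t : ℝ}

lemma integral_rpow_mul_rpow_sub {a b : ℝ} (ha : 0 < a) (hb : 0 < b) (ht : 0 < t) :
    ∫ s in Ioo 0 t, (t - s) ^ (b - 1) * s ^ (a - 1) =
      t ^ (a + b - 1) * (Real.Gamma a * Real.Gamma b / Real.Gamma (a + b)) := by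
  have hbeta := Complex.betaIntegral_scaled a b ht
  rw [Complex.betaIntegral_eq_Gamma_mul_div _ _ (by simpa) (by simpa)] at hbeta
  have hreal : ∫ s in (0 : ℝ)..t, (s : ℂ) ^ ((a : ℂ) - 1) * ((t : ℂ) - s) ^ ((b : ℂ) - 1) =
      ((∫ s in Ioo 0 t, (t - s) ^ (b - 1) * s ^ (a - 1) : ℝ) : ℂ) := by
    rw [intervalIntegral.integral_of_le ht.le, integral_Ioc_eq_integral_Ioo,
      ← integral_complex_ofReal]
    refine setIntegral_congr_fun measurableSet_Ioo fun s hs => ?_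
    push_cast
    rw [Complex.ofReal_cpow hs.1.le, Complex.ofReal_cpow (sub_pos.2 hs.2).le]
    push_cast
    ring
  have hpow : (t : ℂ) ^ (((a + b : ℝ) : ℂ) - 1) = ((t ^ (a + b - 1) : ℝ) : ℂ) := by
    rw [Complex.ofReal_cpow ht.le]
    push_cast
    rfl
  rw [hreal, ← Complex.ofReal_add, Complex.Gamma_ofReal, Complex.Gamma_ofReal,
    Complex.Gamma_ofReal, hpow] at hbeta
  exact_mod_cast hbeta

lemma integrableOn_rpow_mul_rpow_sub {a b : ℝ} (ha : 0 < a) (hb : 0 < b) (ht : 0 < t) :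
    IntegrableOn (fun s => (t - s) ^ (b - 1) * s ^ (a - 1)) (Ioo 0 t) := by
  refine Integrable.of_integral_ne_zero ?_
  rw [integral_rpow_mul_rpow_sub ha hb ht]
  exact (mul_pos (Real.rpow_pos_of_pos ht _) (div_pos
    (mul_pos (Real.Gamma_pos_of_pos ha) (Real.Gamma_pos_of_pos hb))
    (Real.Gamma_pos_of_pos (add_pos ha hb)))).ne'

lemma relaxation_eq_one_add_tsum (hρ : ρ ∈ Ioo (0 : ℝ) 1) (ht : 0 ≤ t) :
    relaxation ρ t = 1 + ∑' k : ℕ, (-1) ^ (k + 1) *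
      (t ^ (ρ * (k + 1 : ℕ)) / Real.Gamma (ρ * (k + 1 : ℕ) + 1)) := by
  rw [← mittagLeffler_neg_rpow hρ ht, mittagLeffler,
    (summable_mittagLeffler hρ.1 _).tsum_eq_zero_add]
  congr 1
  · simp
  · refine tsum_congr fun k => ?_
    rw [neg_pow, rpow_pow_eq_rpow_mul ht, mul_div_assoc]

lemma rpow_sub_one_div_Gamma_le (hρ : 0 < ρ) (ht : 0 < t) {k : ℕ} (hk : k ≠ 0) {y : ℝ}
    (hy : y ∈ Ioo (t / 2) (2 * t)) :
    y ^ (ρ * k - 1) / Real.Gamma (ρ * k) ≤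
      2 / t * ρ * ((2 * (2 * t) ^ ρ) ^ k / Real.Gamma (ρ * k + 1)) := by
  have hy0 : 0 < y := (half_pos ht).trans hy.1
  have hρk : 0 < ρ * k := by positivity
  have := Real.Gamma_pos_of_pos hρk
  have hinv : y⁻¹ ≤ 2 / t := by
    rw [inv_le_comm₀ hy0 (by positivity), inv_div]
    exact hy.1.le
  have hpow : y ^ (ρ * k) ≤ ((2 * t) ^ ρ) ^ k := by
    rw [rpow_pow_eq_rpow_mul (by positivity)]
    exact Real.rpow_le_rpow hy0.le hy.2.le hρk.le
  have hk2 : (k : ℝ) ≤ 2 ^ k := mod_cast Nat.lt_two_pow_self.le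
  rw [Real.Gamma_add_one hρk.ne', Real.rpow_sub_one hy0.ne', div_eq_inv_mul (y ^ (ρ * k))]
  calc y⁻¹ * y ^ (ρ * k) / Real.Gamma (ρ * k)
      ≤ 2 / t * ((2 * t) ^ ρ) ^ k / Real.Gamma (ρ * k) := by gcongr
    _ ≤ 2 / t * ((2 * t) ^ ρ) ^ k / Real.Gamma (ρ * k) * (2 ^ k / k) :=
        le_mul_of_one_le_right (by positivity) ((one_le_div (by positivity)).2 hk2)
    _ = 2 / t * ρ * ((2 * (2 * t) ^ ρ) ^ k / (ρ * k * Real.Gamma (ρ * k))) := by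
        rw [mul_pow]
        field_simp

lemma hasDerivAt_rpow_div_Gamma {a : ℝ} (ha : 0 < a) (ht : 0 < t) :
    HasDerivAt (fun τ : ℝ => τ ^ a / Real.Gamma (a + 1)) (t ^ (a - 1) / Real.Gamma a) t := by
  refine ((Real.hasDerivAt_rpow_const (Or.inl ht.ne')).div_const _).congr_deriv ?_
  rw [Real.Gamma_add_one ha.ne', mul_div_mul_left _ _ ha.ne']

lemma deriv_relaxation_eq_tsum (hρ : ρ ∈ Ioo (0 : ℝ) 1) (ht : 0 < t) :
    deriv (relaxation ρ) t = ∑' k : ℕ, (-1) ^ (k + 1) *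
      (t ^ (ρ * (k + 1 : ℕ) - 1) / Real.Gamma (ρ * (k + 1 : ℕ))) := by
  have hexponent : ∀ k : ℕ, 0 < ρ * (k + 1 : ℕ) := fun k => mul_pos hρ.1 (by positivity)
  have hmem : t ∈ Ioo (t / 2) (2 * t) := ⟨half_lt_self ht, by linarith⟩
  have hsummable := (summable_nat_add_iff 1).2
    (summable_pow_div_Gamma hρ.1 (by positivity : 0 ≤ 2 * (2 * t) ^ ρ))
  have hseries := hasDerivAt_tsum_of_isPreconnected
    (g := fun (k : ℕ) (τ : ℝ) => (-1) ^ (k + 1) *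
      (τ ^ (ρ * (k + 1 : ℕ)) / Real.Gamma (ρ * (k + 1 : ℕ) + 1)))
    (g' := fun (k : ℕ) (τ : ℝ) => (-1) ^ (k + 1) *
      (τ ^ (ρ * (k + 1 : ℕ) - 1) / Real.Gamma (ρ * (k + 1 : ℕ))))
    (hsummable.mul_left (2 / t * ρ)) isOpen_Ioo isPreconnected_Ioo
    (fun k y hy => (hasDerivAt_rpow_div_Gamma (hexponent k)
      ((half_pos ht).trans hy.1)).const_mul _)
    (fun k y hy => ?_) hmem ?_ hmem
  · refine HasDerivAt.deriv ((hseries.const_add 1).congr_of_eventuallyEq ?_)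
    filter_upwards [Ioi_mem_nhds ht] with τ hτ
    exact relaxation_eq_one_add_tsum hρ (mem_Ioi.1 hτ).le
  · have hy0 := (half_pos ht).trans hy.1
    have := Real.Gamma_pos_of_pos (hexponent k)
    rw [norm_mul, norm_pow, norm_neg, norm_one, one_pow, one_mul,
      Real.norm_of_nonneg (by positivity)]
    exact rpow_sub_one_div_Gamma_le hρ.1 ht k.succ_ne_zero hy
  · refine ((summable_nat_add_iff 1).2 (summable_mittagLeffler hρ.1 (-t ^ ρ))).congr fun k => ?_
    rw [neg_pow, rpow_pow_eq_rpow_mul ht.le, mul_div_assoc]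

lemma integral_rpow_mul_rpow_div_Gamma (hρ : ρ ∈ Ioo (0 : ℝ) 1) (ht : 0 < t) (k : ℕ) :
    ∫ s in Ioo 0 t, (t - s) ^ (-ρ) *
      (s ^ (ρ * (k + 1 : ℕ) - 1) / Real.Gamma (ρ * (k + 1 : ℕ))) =
      Real.Gamma (1 - ρ) * ((t ^ ρ) ^ k / Real.Gamma (ρ * k + 1)) := by
  have hexponent : 0 < ρ * (k + 1 : ℕ) := mul_pos hρ.1 (by positivity)
  have hGamma := (Real.Gamma_pos_of_pos hexponent).ne'
  have hsum : ρ * (k + 1 : ℕ) + (1 - ρ) = ρ * k + 1 := by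
    push_cast
    ring
  have hbeta := integral_rpow_mul_rpow_sub hexponent (sub_pos.2 hρ.2) ht
  rw [hsum, add_sub_cancel_right, sub_sub_cancel_left] at hbeta
  simp_rw [mul_div_assoc']
  rw [integral_div, hbeta, rpow_pow_eq_rpow_mul ht.le]
  field_simp [hGamma]

lemma integrableOn_rpow_mul_rpow_div_Gamma (hρ : ρ ∈ Ioo (0 : ℝ) 1) (ht : 0 < t) (k : ℕ) :
    IntegrableOn (fun s => (t - s) ^ (-ρ) *
      (s ^ (ρ * (k + 1 : ℕ) - 1) / Real.Gamma (ρ * (k + 1 : ℕ)))) (Ioo 0 t) := by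
  have hbeta := integrableOn_rpow_mul_rpow_sub (a := ρ * (k + 1 : ℕ))
    (mul_pos hρ.1 (by positivity)) (sub_pos.2 hρ.2) ht
  simp only [sub_sub_cancel_left] at hbeta
  simp_rw [mul_div_assoc']
  exact hbeta.div_const _

theorem integral_rpow_mul_deriv_relaxation (hρ : ρ ∈ Ioo (0 : ℝ) 1) (ht : 0 < t) :
    ∫ s in Ioo 0 t, (t - s) ^ (-ρ) * deriv (relaxation ρ) s =
      -(Real.Gamma (1 - ρ) * relaxation ρ t) := by
  set F : ℕ → ℝ → ℝ := fun k s => (t - s) ^ (-ρ) *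
    (s ^ (ρ * (k + 1 : ℕ) - 1) / Real.Gamma (ρ * (k + 1 : ℕ)))
  have hnorm : ∀ k, ∫ s in Ioo 0 t, ‖(-1) ^ (k + 1) * F k s‖ =
      Real.Gamma (1 - ρ) * ((t ^ ρ) ^ k / Real.Gamma (ρ * k + 1)) := fun k => by
    rw [← integral_rpow_mul_rpow_div_Gamma hρ ht]
    refine setIntegral_congr_fun measurableSet_Ioo fun s hs => ?_
    have hexponent : 0 < ρ * (k + 1 : ℕ) := mul_pos hρ.1 (by positivity)
    have hF : 0 ≤ F k s := mul_nonneg (Real.rpow_nonneg (sub_pos.2 hs.2).le _)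
      (div_nonneg (Real.rpow_nonneg hs.1.le _) (Real.Gamma_pos_of_pos hexponent).le)
    rw [norm_mul, norm_pow, norm_neg, norm_one, one_pow, one_mul, Real.norm_of_nonneg hF]
  have hsummable : Summable fun k => ∫ s in Ioo 0 t, ‖(-1) ^ (k + 1) * F k s‖ := by
    simp_rw [hnorm]
    exact (summable_mittagLeffler hρ.1 (t ^ ρ)).mul_left _
  have hseries := (hasSum_integral_of_summable_integral_norm
    (fun k => (integrableOn_rpow_mul_rpow_div_Gamma hρ ht k).const_mul _) hsummable).tsum_eq
  calc ∫ s in Ioo 0 t, (t - s) ^ (-ρ) * deriv (relaxation ρ) s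
      = ∫ s in Ioo 0 t, ∑' k, (-1) ^ (k + 1) * F k s := by
        refine setIntegral_congr_fun measurableSet_Ioo fun s hs => ?_
        simp only [F]
        rw [deriv_relaxation_eq_tsum hρ hs.1, ← tsum_mul_left]
        exact tsum_congr fun k => mul_left_comm _ _ _
    _ = ∑' k : ℕ, -Real.Gamma (1 - ρ) * ((-t ^ ρ) ^ k / Real.Gamma (ρ * k + 1)) := by
        rw [← hseries]
        refine tsum_congr fun k => ?_
        rw [integral_const_mul, integral_rpow_mul_rpow_div_Gamma hρ ht, neg_pow (t ^ ρ)]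
        ring
    _ = -(Real.Gamma (1 - ρ) * relaxation ρ t) := by
        rw [tsum_mul_left, ← mittagLeffler_neg_rpow hρ ht.le, mittagLeffler, neg_mul]

end RelaxationEquation

section DensityCrossing

variable {α β : ℝ}

lemma mul_sin_pi_mul_lt (hα : 0 < α) (hαβ : α < β) (hβ : β ≤ 1) :
    α * Real.sin (π * β) < β * Real.sin (π * α) := by
  have hβ0 : 0 < β := hα.trans hαβ
  have hconcave := strictConcaveOn_sin_Icc.2
    (⟨by positivity, mul_le_of_le_one_right Real.pi_nonneg hβ⟩ : π * β ∈ Icc 0 π)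
    (left_mem_Icc.2 Real.pi_nonneg) (by positivity) (div_pos hα hβ0)
    (sub_pos.2 ((div_lt_one hβ0).2 hαβ)) (add_sub_cancel _ _)
  have hpoint : α / β * (π * β) = π * α := by field_simp
  simp only [smul_eq_mul, Real.sin_zero, mul_zero, add_zero, hpoint] at hconcave
  rwa [div_mul_eq_mul_div, div_lt_iff₀' hβ0] at hconcave

lemma sin_pi_mul_mul_one_add_cos_lt (hα : 0 < α) (hαβ : α < β) (hβ : β < 1) :
    Real.sin (π * α) * (1 + Real.cos (π * β)) < Real.sin (π * β) * (1 + Real.cos (π * α)) := by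
  have hsin : ∀ x, Real.sin (π * x) =
      2 * Real.sin (π * x / 2) * Real.cos (π * x / 2) := fun x => by
    rw [← Real.sin_two_mul, mul_div_cancel₀ _ two_ne_zero]
  have hcos : ∀ x, 1 + Real.cos (π * x) = 2 * Real.cos (π * x / 2) ^ 2 := fun x => by
    rw [Real.cos_sq, mul_div_cancel₀ _ two_ne_zero]
    ring
  have hcos_pos : ∀ x ∈ Ioo (0 : ℝ) 1, 0 < Real.cos (π * x / 2) := fun x hx =>
    Real.cos_pos_of_mem_Ioo ⟨by nlinarith [Real.pi_pos, hx.1], by nlinarith [Real.pi_pos, hx.2]⟩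
  have hsin_sub : 0 < Real.sin (π * β / 2 - π * α / 2) :=
    Real.sin_pos_of_pos_of_lt_pi (by nlinarith [Real.pi_pos]) (by nlinarith [Real.pi_pos])
  have hprod := mul_pos (mul_pos (hcos_pos α ⟨hα, hαβ.trans hβ⟩)
    (hcos_pos β ⟨hα.trans hαβ, hβ⟩)) hsin_sub
  rw [Real.sin_sub] at hprod
  rw [hsin, hsin, hcos, hcos]
  linear_combination 4 * hprod

/-- The numerator of the difference `relaxDensity β y - relaxDensity α y`, which carries its
sign. -/
def densityGap (α β y : ℝ) : ℝ :=
  Real.sin (π * β) * (Real.cosh (α * y) + Real.cos (π * α)) -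
    Real.sin (π * α) * (Real.cosh (β * y) + Real.cos (π * β))

lemma continuous_densityGap (α β : ℝ) : Continuous (densityGap α β) := by
  unfold densityGap
  fun_prop

lemma densityGap_abs (α β y : ℝ) : densityGap α β |y| = densityGap α β y := by
  rcases abs_choice y with h | h <;> simp only [h, densityGap, mul_neg, Real.cosh_neg]

lemma relaxDensity_lt_relaxDensity_iff (hα : α ∈ Ioo (0 : ℝ) 1) (hβ : β ∈ Ioo (0 : ℝ) 1) (y : ℝ) :
    relaxDensity α y < relaxDensity β y ↔ 0 < densityGap α β y := by
  have hscale : Real.sin (π * β) * (2 * π * (Real.cosh (α * y) + Real.cos (π * α))) -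
      Real.sin (π * α) * (2 * π * (Real.cosh (β * y) + Real.cos (π * β))) =
      2 * π * densityGap α β y := by
    rw [densityGap]
    ring
  rw [relaxDensity, relaxDensity,
    div_lt_div_iff₀ (mul_pos Real.two_pi_pos (cosh_add_cos_pos hα y))
      (mul_pos Real.two_pi_pos (cosh_add_cos_pos hβ y)),
    ← sub_pos, hscale, mul_pos_iff_of_pos_left Real.two_pi_pos]

lemma relaxDensity_lt_relaxDensity_iff' (hα : α ∈ Ioo (0 : ℝ) 1) (hβ : β ∈ Ioo (0 : ℝ) 1)
    (y : ℝ) : relaxDensity β y < relaxDensity α y ↔ densityGap α β y < 0 := by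
  rw [relaxDensity_lt_relaxDensity_iff hβ hα, ← neg_pos (a := densityGap α β y), densityGap,
    densityGap, neg_sub]

lemma strictAntiOn_densityGap (hα : 0 < α) (hαβ : α < β) (hβ : β ≤ 1) :
    StrictAntiOn (densityGap α β) (Ici 0) := by
  refine strictAntiOn_of_deriv_neg (convex_Ici 0) (continuous_densityGap α β).continuousOn
    fun y hy => ?_
  have hy0 : 0 < y := by simpa only [interior_Ici, mem_Ioi] using hy
  have hcosh : ∀ c : ℝ, HasDerivAt (fun y => Real.cosh (c * y)) (Real.sinh (c * y) * c) y :=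
    fun c => by simpa using ((hasDerivAt_id y).const_mul c).cosh
  have hderiv : HasDerivAt (densityGap α β) (Real.sin (π * β) * (Real.sinh (α * y) * α) -
      Real.sin (π * α) * (Real.sinh (β * y) * β)) y :=
    (((hcosh α).add_const _).const_mul _).sub (((hcosh β).add_const _).const_mul _)
  have hsin : 0 < β * Real.sin (π * α) :=
    mul_pos (hα.trans hαβ) (sin_pi_mul_pos ⟨hα, hαβ.trans_le hβ⟩)
  rw [hderiv.deriv, sub_neg]
  calc Real.sin (π * β) * (Real.sinh (α * y) * α)
      = α * Real.sin (π * β) * Real.sinh (α * y) := by ring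
    _ < β * Real.sin (π * α) * Real.sinh (α * y) :=
        mul_lt_mul_of_pos_right (mul_sin_pi_mul_lt hα hαβ hβ)
          (Real.sinh_pos_iff.2 (mul_pos hα hy0))
    _ < β * Real.sin (π * α) * Real.sinh (β * y) :=
        mul_lt_mul_of_pos_left (Real.sinh_lt_sinh.2 (mul_lt_mul_of_pos_right hαβ hy0)) hsin
    _ = Real.sin (π * α) * (Real.sinh (β * y) * β) := by ring

lemma densityGap_zero_pos (hα : 0 < α) (hαβ : α < β) (hβ : β < 1) : 0 < densityGap α β 0 := by
  simp only [densityGap, mul_zero, Real.cosh_zero]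
  exact sub_pos.2 (sin_pi_mul_mul_one_add_cos_lt hα hαβ hβ)

/- Both densities have integral one, so neither can dominate the other everywhere. -/
lemma exists_densityGap_nonpos (hα : α ∈ Ioo (0 : ℝ) 1) (hβ : β ∈ Ioo (0 : ℝ) 1) :
    ∃ y, densityGap α β y ≤ 0 := by
  by_contra! hpos
  have hintegral := integral_pos_of_forall_pos
    ((integrable_relaxDensity hβ).sub (integrable_relaxDensity hα)) fun y =>
      sub_pos.2 ((relaxDensity_lt_relaxDensity_iff hα hβ y).2 (hpos y))
  rw [integral_sub' (integrable_relaxDensity hβ) (integrable_relaxDensity hα),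
    integral_relaxDensity hβ, integral_relaxDensity hα, sub_self] at hintegral
  exact hintegral.false

lemma exists_densityGap_eq_zero (hα : 0 < α) (hαβ : α < β) (hβ : β < 1) :
    ∃ y₀, 0 < y₀ ∧ densityGap α β y₀ = 0 := by
  have hzero := densityGap_zero_pos hα hαβ hβ
  obtain ⟨y₁, hy₁⟩ := exists_densityGap_nonpos (α := α) (β := β) ⟨hα, hαβ.trans hβ⟩
    ⟨hα.trans hαβ, hβ⟩
  rw [← densityGap_abs] at hy₁
  obtain ⟨y, hy, hgap⟩ := intermediate_value_Icc' (abs_nonneg y₁)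
    (continuous_densityGap α β).continuousOn ⟨hy₁, hzero.le⟩
  refine ⟨y, hy.1.lt_of_ne ?_, hgap⟩
  rintro rfl
  exact hzero.ne' hgap

theorem exists_relaxDensity_crossing (hα : 0 < α) (hαβ : α < β) (hβ : β < 1) :
    ∃ y₀, 0 < y₀ ∧ (∀ y, |y| < y₀ → relaxDensity α y < relaxDensity β y) ∧
      ∀ y, y₀ < |y| → relaxDensity β y < relaxDensity α y := by
  obtain ⟨y₀, hy₀, hgap⟩ := exists_densityGap_eq_zero hα hαβ hβ
  have hα' : α ∈ Ioo (0 : ℝ) 1 := ⟨hα, hαβ.trans hβ⟩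
  have hβ' : β ∈ Ioo (0 : ℝ) 1 := ⟨hα.trans hαβ, hβ⟩
  have hanti := strictAntiOn_densityGap hα hαβ hβ.le
  refine ⟨y₀, hy₀, fun y hy => ?_, fun y hy => ?_⟩
  · rw [relaxDensity_lt_relaxDensity_iff hα' hβ', ← densityGap_abs, ← hgap]
    exact hanti (abs_nonneg y) hy₀.le hy
  · rw [relaxDensity_lt_relaxDensity_iff' hα' hβ', ← densityGap_abs, ← hgap]
    exact hanti hy₀.le (abs_nonneg y) hy

end DensityCrossing

section MonotoneInOrder

variable {α β ρ t : ℝ}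

/-- The symmetrization of the kernel `y ↦ exp (-t * exp y)`. It has the same integral as twice the
kernel against the even function `relaxDensity ρ`, and unlike the kernel it is increasing in `|y|`
for `1 ≤ t`. -/
def symExp (t y : ℝ) : ℝ :=
  Real.exp (-(t * Real.exp y)) + Real.exp (-(t * Real.exp (-y)))

lemma symExp_abs (t y : ℝ) : symExp t |y| = symExp t y := by
  rcases abs_choice y with h | h <;> simp only [h, symExp, neg_neg, add_comm]

lemma strictMonoOn_symExp (ht : 1 ≤ t) : StrictMonoOn (symExp t) (Ici 0) := by
  refine strictMonoOn_of_deriv_pos (convex_Ici 0)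
    (by unfold symExp; fun_prop : Continuous (symExp t)).continuousOn fun y hy => ?_
  have hy0 : 0 < y := by simpa only [interior_Ici, mem_Ioi] using hy
  have hexp_neg : HasDerivAt (fun y => Real.exp (-y)) (-Real.exp (-y)) y := by
    simpa using (hasDerivAt_id y).neg.exp
  have hderiv : HasDerivAt (symExp t) (Real.exp (-(t * Real.exp y)) * -(t * Real.exp y) +
      Real.exp (-(t * Real.exp (-y))) * -(t * -Real.exp (-y))) y :=
    ((Real.hasDerivAt_exp y).const_mul t).neg.exp.add (hexp_neg.const_mul t).neg.exp
  have hlt : Real.exp (-(t * Real.exp y)) * Real.exp y <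
      Real.exp (-(t * Real.exp (-y))) * Real.exp (-y) := by
    rw [← Real.exp_add, ← Real.exp_add, Real.exp_lt_exp]
    have hsinh := Real.self_lt_sinh_iff.2 hy0
    rw [Real.sinh_eq] at hsinh
    nlinarith
  rw [hderiv.deriv]
  nlinarith

lemma symExp_mul_relaxDensity (ρ t y : ℝ) : symExp t y * relaxDensity ρ y =
    Real.exp (-(t * Real.exp y)) * relaxDensity ρ y +
      Real.exp (-(t * Real.exp (-y))) * relaxDensity ρ (-y) := by
  rw [symExp, relaxDensity_neg, add_mul]

lemma integrable_symExp_mul_relaxDensity (hρ : ρ ∈ Ioo (0 : ℝ) 1) (ht : 0 ≤ t) :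
    Integrable fun y => symExp t y * relaxDensity ρ y := by
  simp_rw [symExp_mul_relaxDensity]
  exact (integrable_relaxation hρ ht).add (integrable_relaxation hρ ht).comp_neg

lemma integral_symExp_mul_relaxDensity (hρ : ρ ∈ Ioo (0 : ℝ) 1) (ht : 0 ≤ t) :
    ∫ y, symExp t y * relaxDensity ρ y = 2 * relaxation ρ t := by
  have hreflect : ∫ y, Real.exp (-(t * Real.exp (-y))) * relaxDensity ρ (-y) = relaxation ρ t :=
    integral_neg_eq_self (fun y => Real.exp (-(t * Real.exp y)) * relaxDensity ρ y) volume
  simp_rw [symExp_mul_relaxDensity]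
  rw [integral_add (integrable_relaxation hρ ht) (integrable_relaxation hρ ht).comp_neg, hreflect,
    two_mul, relaxation]

lemma symExp_sub_mul_relaxDensity_sub (α β t c y : ℝ) :
    (symExp t y - c) * (relaxDensity α y - relaxDensity β y) =
      symExp t y * relaxDensity α y - symExp t y * relaxDensity β y -
        (c * relaxDensity α y - c * relaxDensity β y) := by
  ring

lemma integrable_symExp_sub_mul_relaxDensity_sub (hα : α ∈ Ioo (0 : ℝ) 1)
    (hβ : β ∈ Ioo (0 : ℝ) 1) (ht : 0 ≤ t) (c : ℝ) :
    Integrable fun y => (symExp t y - c) * (relaxDensity α y - relaxDensity β y) := by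
  simp_rw [symExp_sub_mul_relaxDensity_sub]
  exact ((integrable_symExp_mul_relaxDensity hα ht).sub
    (integrable_symExp_mul_relaxDensity hβ ht)).sub
    (((integrable_relaxDensity hα).const_mul c).sub ((integrable_relaxDensity hβ).const_mul c))

lemma integral_symExp_sub_mul_relaxDensity_sub (hα : α ∈ Ioo (0 : ℝ) 1)
    (hβ : β ∈ Ioo (0 : ℝ) 1) (ht : 0 ≤ t) (c : ℝ) :
    ∫ y, (symExp t y - c) * (relaxDensity α y - relaxDensity β y) =
      2 * relaxation α t - 2 * relaxation β t := by
  have hkα := integrable_symExp_mul_relaxDensity hα ht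
  have hkβ := integrable_symExp_mul_relaxDensity hβ ht
  have hcα := (integrable_relaxDensity hα).const_mul c
  have hcβ := (integrable_relaxDensity hβ).const_mul c
  simp_rw [symExp_sub_mul_relaxDensity_sub]
  refine (integral_sub (hkα.sub hkβ) (hcα.sub hcβ)).trans ?_
  rw [integral_sub' hkα hkβ, integral_sub' hcα hcβ,
    integral_symExp_mul_relaxDensity hα ht, integral_symExp_mul_relaxDensity hβ ht,
    integral_const_mul, integral_const_mul, integral_relaxDensity hα, integral_relaxDensity hβ,
    sub_self, sub_zero]

/- As the densities have the same integral, a constant may be subtracted from the kernel; choosing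
its value at the crossing makes the integrand nonnegative. -/
theorem strictAntiOn_relaxation_order (ht : 1 ≤ t) :
    StrictAntiOn (fun ρ => relaxation ρ t) (Ioo 0 1) := by
  intro α hα β hβ hαβ
  have ht0 : 0 ≤ t := zero_le_one.trans ht
  obtain ⟨y₀, hy₀, hinside, houtside⟩ := exists_relaxDensity_crossing hα.1 hαβ hβ.2
  set g : ℝ → ℝ := fun y => (symExp t y - symExp t y₀) * (relaxDensity α y - relaxDensity β y)
  have hpos_outside : ∀ y, y₀ < |y| → 0 < g y := fun y hy => by
    have hsym := strictMonoOn_symExp ht hy₀.le (abs_nonneg y) hy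
    rw [symExp_abs] at hsym
    exact mul_pos (sub_pos.2 hsym) (sub_pos.2 (houtside y hy))
  have hnonneg : ∀ y, 0 ≤ g y := fun y => by
    rcases lt_trichotomy |y| y₀ with hy | hy | hy
    · have hsym := strictMonoOn_symExp ht (abs_nonneg y) hy₀.le hy
      rw [symExp_abs] at hsym
      exact (mul_pos_of_neg_of_neg (sub_neg.2 hsym) (sub_neg.2 (hinside y hy))).le
    · simp only [g, ← hy, symExp_abs, sub_self, zero_mul, le_refl]
    · exact (hpos_outside y hy).le
  have hintegral : 0 < ∫ y, g y := by
    rw [integral_pos_iff_support_of_nonneg hnonneg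
      (integrable_symExp_sub_mul_relaxDensity_sub hα hβ ht0 _)]
    refine lt_of_lt_of_le ?_ (measure_mono (s := Ioi y₀) fun y hy => ?_)
    · rw [Real.volume_Ioi]
      exact ENNReal.zero_lt_top
    · exact (hpos_outside y ((mem_Ioi.1 hy).trans_le (le_abs_self y))).ne'
  rw [integral_symExp_sub_mul_relaxDensity_sub hα hβ ht0] at hintegral
  simp only
  linarith

lemma continuousOn_mittagLeffler_order (ht : 0 < t) {ρ₀ : ℝ} (hρ₀ : 0 < ρ₀) :
    ContinuousOn (fun ρ => mittagLeffler ρ (-t ^ ρ)) (Ici ρ₀) := by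
  have hratio : (1 / 2 : ℝ) ^ ρ₀ < 1 := Real.rpow_lt_one (by norm_num) (by norm_num) hρ₀
  refine continuousOn_tsum (u := fun k : ℕ => Real.exp (2 * t) * ((1 / 2 : ℝ) ^ ρ₀) ^ k)
    (fun k => ?_)
    ((summable_geometric_of_lt_one (by positivity) hratio).mul_left _) fun k ρ hρ => ?_
  · have hpow : Continuous fun ρ : ℝ => t ^ ρ := Real.continuous_const_rpow ht.ne'
    refine ContinuousOn.div (by fun_prop) (fun ρ hρ => ?_) fun ρ hρ =>
      (Gamma_mul_natCast_add_one_pos (hρ₀.le.trans hρ) k).ne'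
    have hρk : 0 ≤ ρ * k := mul_nonneg (hρ₀.le.trans hρ) k.cast_nonneg
    refine ContinuousAt.continuousWithinAt (ContinuousAt.comp (f := fun ρ : ℝ => ρ * k + 1)
      (Real.differentiableAt_Gamma fun m => ?_).continuousAt (by fun_prop))
    linarith [m.cast_nonneg (α := ℝ)]
  · have hρ0 : 0 ≤ ρ := hρ₀.le.trans hρ
    have hhalf : t / (2 * t) = 1 / 2 := by field_simp
    calc ‖(-t ^ ρ) ^ k / Real.Gamma (ρ * k + 1)‖ ≤ (t ^ ρ) ^ k / Real.Gamma (ρ * k + 1) :=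
          norm_pow_div_Gamma_le hρ0 (by rw [abs_neg, abs_of_nonneg (by positivity)]) k
      _ ≤ Real.exp (2 * t) * (t ^ ρ / (2 * t) ^ ρ) ^ k :=
          pow_div_Gamma_le hρ0 (by positivity) (by positivity) k
      _ = Real.exp (2 * t) * ((1 / 2) ^ ρ) ^ k := by
          rw [← Real.div_rpow ht.le (by positivity), hhalf]
      _ ≤ Real.exp (2 * t) * ((1 / 2) ^ ρ₀) ^ k := by
          gcongr ?_ * ?_ ^ k
          exact Real.rpow_le_rpow_of_exponent_ge (by norm_num) (by norm_num) hρ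

lemma mittagLeffler_one (z : ℝ) : mittagLeffler 1 z = Real.exp z := by
  rw [mittagLeffler, Real.exp_eq_exp_ℝ, NormedSpace.exp_eq_tsum_div]
  refine tsum_congr fun k => ?_
  rw [one_mul, Real.Gamma_nat_eq_factorial]

lemma strictAntiOn_Icc_of_Ico {f : ℝ → ℝ} {a b : ℝ} (hcont : ContinuousOn f (Icc a b))
    (hanti : StrictAntiOn f (Ico a b)) : StrictAntiOn f (Icc a b) := by
  intro x hx y hy hxy
  rcases hy.2.lt_or_eq with hyb | rfl
  · exact hanti ⟨hx.1, hxy.trans hyb⟩ ⟨hy.1, hyb⟩ hxy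
  obtain ⟨m, hxm, hmy⟩ := exists_between hxy
  have hm : m ∈ Ico a y := ⟨hx.1.trans hxm.le, hmy⟩
  have := right_nhdsWithin_Ioo_neBot hmy
  have hle : f y ≤ f m := by
    have hsubset : Ioo m y ⊆ Icc a y := fun z hz => ⟨hm.1.trans hz.1.le, hz.2.le⟩
    refine le_of_tendsto ((hcont y hy).mono hsubset) ?_
    filter_upwards [self_mem_nhdsWithin] with z hz
    exact (hanti hm ⟨hm.1.trans hz.1.le, hz.2⟩ hz.1).le
  exact hle.trans_lt (hanti ⟨hx.1, hxy⟩ hm hxm)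

theorem strictAntiOn_mittagLeffler_order (ht : 1 ≤ t) {ρ₀ : ℝ} (hρ₀ : 0 < ρ₀) :
    StrictAntiOn (fun ρ => mittagLeffler ρ (-t ^ ρ)) (Icc ρ₀ 1) := by
  have ht0 : 0 < t := zero_lt_one.trans_le ht
  have hsubset : Ico ρ₀ 1 ⊆ Ioo 0 1 := fun ρ hρ => ⟨hρ₀.trans_le hρ.1, hρ.2⟩
  refine strictAntiOn_Icc_of_Ico
    ((continuousOn_mittagLeffler_order ht0 hρ₀).mono Icc_subset_Ici_self) ?_
  exact ((strictAntiOn_relaxation_order ht).mono hsubset).congr fun ρ hρ =>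
    (mittagLeffler_neg_rpow (hsubset hρ) ht0.le).symm

theorem image_mittagLeffler_order (ht : 1 ≤ t) {ρ₀ : ℝ} (hρ₀ : ρ₀ ∈ Ioc (0 : ℝ) 1) :
    (fun ρ => mittagLeffler ρ (-t ^ ρ)) '' Ico ρ₀ 1 =
      Ioc (Real.exp (-t)) (mittagLeffler ρ₀ (-t ^ ρ₀)) := by
  rw [ContinuousOn.image_Ico_of_strictAntiOn hρ₀.2
    ((continuousOn_mittagLeffler_order (zero_lt_one.trans_le ht) hρ₀.1).mono Icc_subset_Ici_self)
    (strictAntiOn_mittagLeffler_order ht hρ₀.1), mittagLeffler_one, Real.rpow_one]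

end MonotoneInOrder

section FourierInversion

variable {V : Type*} [NormedAddCommGroup V] [InnerProductSpace ℝ V] [FiniteDimensional ℝ V]
  [MeasurableSpace V] [BorelSpace V] {f g : V → ℂ}

lemma continuous_fourierInv (hg : Integrable g) : Continuous (𝓕⁻ g) :=
  VectorFourier.fourierIntegral_continuous Real.continuous_fourierChar
    (by simp only [LinearMap.neg_apply, innerₗ_apply_apply]; fun_prop) hg

lemma integral_fourierInv_smul_eq (hf : Integrable f) (hg : Integrable g) :
    ∫ x, 𝓕⁻ f x • g x = ∫ x, f x • 𝓕⁻ g x := by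
  have hflip : (-innerₗ V).flip = -innerₗ V := by
    ext x y; simp [real_inner_comm]
  have h := VectorFourier.integral_fourierIntegral_smul_eq_flip (e := Real.fourierChar)
    (μ := volume) (ν := volume) (L := -innerₗ V) Real.continuous_fourierChar
    (by simp only [LinearMap.neg_apply, innerₗ_apply_apply]; fun_prop) hf hg
  rwa [hflip] at h

theorem fourierInv_toLp_ae_eq (hg : Integrable g) (hg2 : MemLp g 2) :
    ⇑(𝓕⁻ (hg2.toLp g) : Lp ℂ 2 (volume : Measure V)) =ᵐ[volume] 𝓕⁻ g := by
  refine ae_eq_of_integral_contDiff_smul_eq ((Lp.memLp _).locallyIntegrable (by norm_num))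
    (continuous_fourierInv hg).locallyIntegrable fun h hsmooth hsupp => ?_
  have hsupp' : HasCompactSupport (Complex.ofRealCLM ∘ h) := hsupp.comp_left rfl
  let ψ := hsupp'.toSchwartzMap (Complex.ofRealCLM.contDiff.comp hsmooth)
  have hψ : ∀ x (z : ℂ), h x • z = ψ x • z := fun x z => Complex.real_smul
  have hdual := congrArg (fun T => T ψ) (Lp.fourierInv_toTemperedDistribution_eq (hg2.toLp g))
  simp only [TemperedDistribution.fourierInv_apply, Lp.toTemperedDistribution_apply] at hdual
  simp only [hψ]
  calc ∫ x, ψ x • (𝓕⁻ (hg2.toLp g) : Lp ℂ 2 (volume : Measure V)) x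
      = ∫ x, 𝓕⁻ ψ x • hg2.toLp g x := hdual.symm
    _ = ∫ x, 𝓕⁻ (ψ : V → ℂ) x • g x := by
        refine integral_congr_ae (hg2.coeFn_toLp.mono fun x hx => ?_)
        simp only [hx, SchwartzMap.fourierInv_coe]
    _ = ∫ x, ψ x • 𝓕⁻ g x := integral_fourierInv_smul_eq ψ.integrable hg

lemma memLp_fourierInv (hg : Integrable g) (hg2 : MemLp g 2) : MemLp (𝓕⁻ g) 2 :=
  (memLp_congr_ae (fourierInv_toLp_ae_eq hg hg2)).1 (Lp.memLp _)

lemma fourier_toLp_fourierInv (hg : Integrable g) (hg2 : MemLp g 2) :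
    (𝓕 ((memLp_fourierInv hg hg2).toLp _) : Lp ℂ 2 (volume : Measure V)) = hg2.toLp g := by
  have h : (memLp_fourierInv hg hg2).toLp _ = 𝓕⁻ (hg2.toLp g) :=
    Lp.ext ((MemLp.coeFn_toLp _).trans (fourierInv_toLp_ae_eq hg hg2).symm)
  rw [h]
  exact FourierTransform.fourier_fourierInv_eq _

lemma eLpNorm_fourierInv (hg : Integrable g) (hg2 : MemLp g 2) :
    eLpNorm (𝓕⁻ g) 2 volume = eLpNorm g 2 volume := by
  have h := congrArg (fun f : Lp ℂ 2 (volume : Measure V) => ENNReal.ofReal ‖f‖)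
    (fourier_toLp_fourierInv hg hg2)
  simpa [Lp.norm_toLp, ENNReal.ofReal_toReal, (memLp_fourierInv hg hg2).eLpNorm_ne_top,
    hg2.eLpNorm_ne_top] using h

lemma tendsto_fourierInv_cocompact (g : V → ℂ) : Tendsto (𝓕⁻ g) (cocompact V) (𝓝 0) := by
  have h := (tendsto_integral_exp_inner_smul_cocompact g).comp
    (Homeomorph.neg V).isClosedEmbedding.tendsto_cocompact
  exact h.congr fun x => by simp [Real.fourierInv_eq]

end FourierInversion

section Hat

variable {N : ℕ} {φ : EuclideanSpace ℝ (Fin N) → ℂ}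

lemma hat_of_memLp (hφ : MemLp φ 2) (ξ : EuclideanSpace ℝ (Fin N)) :
    hat φ ξ = (((2 * π) ^ N)⁻¹ : ℝ) •
      (𝓕 (hφ.toLp φ) : Lp ℂ 2 volume) ((2 * π)⁻¹ • ξ) := by
  rw [hat, dif_pos hφ]

lemma fourier_eq_hat (hφ : MemLp φ 2) (η : EuclideanSpace ℝ (Fin N)) :
    (𝓕 (hφ.toLp φ) : Lp ℂ 2 volume) η = ((2 * π) ^ N : ℝ) • hat φ ((2 * π) • η) := by
  have h2pi : 2 * π ≠ 0 := by positivity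
  rw [hat_of_memLp hφ, smul_smul, smul_smul, inv_mul_cancel₀ h2pi,
    mul_inv_cancel₀ (pow_ne_zero _ h2pi), one_smul, one_smul]

lemma hat_fourierInv {g : EuclideanSpace ℝ (Fin N) → ℂ} (hg : Integrable g) (hg2 : MemLp g 2) :
    hat (𝓕⁻ g) =ᵐ[volume] fun ξ => (((2 * π) ^ N)⁻¹ : ℝ) • g ((2 * π)⁻¹ • ξ) := by
  have hdilate := (Measure.quasiMeasurePreserving_smul
    (volume : Measure (EuclideanSpace ℝ (Fin N)))
    (show (2 * π)⁻¹ ≠ 0 by positivity)).ae_eq_comp hg2.coeFn_toLp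
  filter_upwards [hdilate] with ξ hξ
  rw [hat_of_memLp (memLp_fourierInv hg hg2), fourier_toLp_fourierInv hg hg2]
  exact congrArg _ hξ

lemma memLp_bessel_weight {V : Type*} [NormedAddCommGroup V] [InnerProductSpace ℝ V]
    [FiniteDimensional ℝ V] [MeasurableSpace V] [BorelSpace V] {τ : ℝ}
    (hτ : (Module.finrank ℝ V : ℝ) / 2 < τ) :
    MemLp (fun ξ : V => (((1 + ‖ξ‖ ^ 2) ^ (-(τ / 2)) : ℝ) : ℂ)) 2 volume := by
  have hpos (ξ : V) : 0 < 1 + ‖ξ‖ ^ 2 := by positivity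
  have hcont : Continuous fun ξ : V => (((1 + ‖ξ‖ ^ 2) ^ (-(τ / 2)) : ℝ) : ℂ) :=
    Complex.continuous_ofReal.comp
      (Continuous.rpow_const (by fun_prop) fun ξ => Or.inl (hpos ξ).ne')
  rw [memLp_two_iff_integrable_sq_norm hcont.aestronglyMeasurable]
  have hint := integrable_rpow_neg_one_add_norm_sq (E := V) (μ := volume) (r := 2 * τ)
    (by linarith)
  refine hint.congr (Eventually.of_forall fun ξ => ?_)
  simp only [Complex.norm_real, Real.norm_eq_abs, sq_abs]
  rw [← Real.rpow_mul_natCast (hpos ξ).le]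
  congr 1; push_cast; ring

lemma integrable_hat_of_memSobolevClass {τ : ℝ} (hτ : (N : ℝ) / 2 < τ)
    (hφ : MemSobolevClass τ φ) : Integrable (hat φ) := by
  have hweight := memLp_bessel_weight (V := EuclideanSpace ℝ (Fin N)) (τ := τ) (by simpa using hτ)
  refine (hweight.integrable_mul hφ.2).congr (Eventually.of_forall fun ξ => ?_)
  have hpos : 0 < 1 + ‖ξ‖ ^ 2 := by positivity
  simp only [Pi.mul_apply]
  rw [← mul_assoc, ← Complex.ofReal_mul, ← Real.rpow_add hpos]
  simp

lemma exists_eq_fourierInv (hφ : MemLp φ 2) (hhat : Integrable (hat φ)) (hcont : Continuous φ) :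
    ∃ a : EuclideanSpace ℝ (Fin N) → ℂ, Integrable a ∧ MemLp a 2 ∧ φ = 𝓕⁻ a := by
  set a := (𝓕 (hφ.toLp φ) : Lp ℂ 2 volume) with ha
  have hint : Integrable a :=
    ((hhat.comp_smul (show 2 * π ≠ 0 by positivity)).smul ((2 * π) ^ N : ℝ)).congr
      (Eventually.of_forall fun η => (fourier_eq_hat hφ η).symm)
  have hinv : (𝓕⁻ ((Lp.memLp a).toLp a) : Lp ℂ 2 volume) = hφ.toLp φ := by
    rw [Lp.toLp_coeFn, ha]
    exact FourierTransform.fourierInv_fourier_eq _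
  refine ⟨a, hint, Lp.memLp _, ?_⟩
  refine (Continuous.ae_eq_iff_eq volume hcont (continuous_fourierInv hint)).1 ?_
  exact (hφ.coeFn_toLp.symm.trans (by rw [hinv])).trans
    (fourierInv_toLp_ae_eq hint (Lp.memLp a))

end Hat

section Mode

variable {ρ lam t : ℝ}

/-- The solution `E_ρ(-lam t ^ ρ)` of `D_t^ρ e = -lam e`, `e(0) = 1`, written as a dilation of the
one for `lam = 1`. -/
def mode (ρ lam t : ℝ) : ℝ := relaxation ρ (lam ^ (1 / ρ) * t)

/-- The derivative of `mode ρ lam` in time. -/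
def modeDeriv (ρ lam t : ℝ) : ℝ :=
  lam ^ (1 / ρ) * deriv (relaxation ρ) (lam ^ (1 / ρ) * t)

lemma mode_eq_mittagLeffler (hρ : ρ ∈ Ioo (0 : ℝ) 1) (hlam : 0 ≤ lam) (ht : 0 ≤ t) :
    mode ρ lam t = mittagLeffler ρ (-(lam * t ^ ρ)) :=
  (mittagLeffler_neg_mul_rpow hρ hlam ht).symm

lemma mode_zero (hρ : ρ ∈ Ioo (0 : ℝ) 1) (lam : ℝ) : mode ρ lam 0 = 1 := by
  rw [mode, mul_zero, relaxation_zero hρ]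

lemma mode_pos (hρ : ρ ∈ Ioo (0 : ℝ) 1) (hlam : 0 ≤ lam) (ht : 0 ≤ t) : 0 < mode ρ lam t :=
  relaxation_pos hρ (by positivity)

lemma mode_le_one (hρ : ρ ∈ Ioo (0 : ℝ) 1) (hlam : 0 ≤ lam) (ht : 0 ≤ t) : mode ρ lam t ≤ 1 :=
  relaxation_le_one hρ (by positivity)

lemma norm_mode_le_one (hρ : ρ ∈ Ioo (0 : ℝ) 1) (hlam : 0 ≤ lam) (ht : 0 ≤ t) :
    ‖(mode ρ lam t : ℂ)‖ ≤ 1 := by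
  rw [Complex.norm_real, Real.norm_of_nonneg (mode_pos hρ hlam ht).le]
  exact mode_le_one hρ hlam ht

lemma mul_mode_le (hρ : ρ ∈ Ioo (0 : ℝ) 1) (hlam : 0 ≤ lam) (ht : 0 < t) :
    lam * mode ρ lam t ≤ Real.exp 1 * t ^ (-ρ) := by
  have hbound := rpow_mul_relaxation_le hρ (τ := lam ^ (1 / ρ) * t) (by positivity)
  rw [Real.mul_rpow (by positivity) ht.le, one_div, Real.rpow_inv_rpow hlam hρ.1.ne',
    ← one_div] at hbound
  rw [Real.rpow_neg ht.le, ← div_eq_mul_inv, le_div_iff₀ (Real.rpow_pos_of_pos ht ρ)]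
  calc lam * mode ρ lam t * t ^ ρ = lam * t ^ ρ * relaxation ρ (lam ^ (1 / ρ) * t) := by
        rw [mode]; ring
    _ ≤ Real.exp 1 := hbound

lemma norm_mul_mode_le (hρ : ρ ∈ Ioo (0 : ℝ) 1) (hlam : 0 ≤ lam) (ht : 0 < t) :
    ‖((lam * mode ρ lam t : ℝ) : ℂ)‖ ≤ Real.exp 1 * t ^ (-ρ) := by
  rw [Complex.norm_real, Real.norm_of_nonneg (mul_nonneg hlam (mode_pos hρ hlam ht.le).le)]
  exact mul_mode_le hρ hlam ht

lemma continuousOn_mode (hρ : ρ ∈ Ioo (0 : ℝ) 1) (hlam : 0 ≤ lam) :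
    ContinuousOn (mode ρ lam) (Ici 0) :=
  (continuousOn_relaxation hρ).comp (by fun_prop) fun _ ht =>
    mul_nonneg (Real.rpow_nonneg hlam _) (mem_Ici.1 ht)

lemma continuous_mode_comp {X : Type*} [TopologicalSpace X] {f : X → ℝ} (hρ : ρ ∈ Ioo (0 : ℝ) 1)
    (hf : Continuous f) (hf₀ : ∀ x, 0 ≤ f x) (ht : 0 ≤ t) :
    Continuous fun x => mode ρ (f x) t := by
  have hrpow : Continuous fun x => f x ^ (1 / ρ) :=
    hf.rpow_const fun x => Or.inr (one_div_pos.2 hρ.1).le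
  exact (continuousOn_relaxation hρ).comp_continuous (by fun_prop) fun x =>
    mul_nonneg (Real.rpow_nonneg (hf₀ x) _) ht

lemma measurable_modeDeriv (ρ : ℝ) : Measurable fun p : ℝ × ℝ => modeDeriv ρ p.1 p.2 := by
  have hrpow : Measurable fun p : ℝ × ℝ => p.1 ^ (1 / ρ) := measurable_fst.pow_const _
  exact hrpow.mul ((measurable_deriv _).comp (hrpow.mul measurable_snd))

lemma modeDeriv_zero (hρ : 0 < ρ) (t : ℝ) : modeDeriv ρ 0 t = 0 := by
  rw [modeDeriv, Real.zero_rpow (one_div_pos.2 hρ).ne', zero_mul]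

lemma hasDerivAt_mode (hρ : ρ ∈ Ioo (0 : ℝ) 1) (hlam : 0 ≤ lam) (ht : 0 < t) :
    HasDerivAt (mode ρ lam) (modeDeriv ρ lam t) t := by
  rcases hlam.eq_or_lt with rfl | hlam
  · have hconst : mode ρ 0 = fun _ => relaxation ρ 0 := by
      ext s
      rw [mode, Real.zero_rpow (one_div_pos.2 hρ.1).ne', zero_mul]
    rw [hconst, modeDeriv_zero hρ.1]
    exact hasDerivAt_const _ _
  · exact ((hasDerivAt_relaxation hρ (by positivity)).comp t
      ((hasDerivAt_id t).const_mul _)).congr_deriv (by simp only [modeDeriv, id]; ring)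

lemma modeDeriv_nonpos (hρ : ρ ∈ Ioo (0 : ℝ) 1) (hlam : 0 ≤ lam) (ht : 0 < t) :
    modeDeriv ρ lam t ≤ 0 := by
  rcases hlam.eq_or_lt with rfl | hlam
  · exact (modeDeriv_zero hρ.1 t).le
  · exact mul_nonpos_of_nonneg_of_nonpos (by positivity)
      (deriv_relaxation_nonpos hρ (by positivity))

lemma abs_modeDeriv_le (hρ : ρ ∈ Ioo (0 : ℝ) 1) (hlam : 0 ≤ lam) (ht : 0 < t) :
    |modeDeriv ρ lam t| ≤ 1 / t := by
  rcases hlam.eq_or_lt with rfl | hlam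
  · rw [modeDeriv_zero hρ.1, abs_zero]
    positivity
  · have hκ : 0 < lam ^ (1 / ρ) := by positivity
    have hbound := mul_abs_deriv_relaxation_le hρ (mul_pos hκ ht)
    rw [le_div_iff₀ ht, modeDeriv, abs_mul, abs_of_pos hκ]
    linarith

lemma integral_rpow_mul_modeDeriv (hρ : ρ ∈ Ioo (0 : ℝ) 1) (hlam : 0 ≤ lam) (ht : 0 < t) :
    ∫ s in Ioo 0 t, (t - s) ^ (-ρ) * modeDeriv ρ lam s =
      -(Real.Gamma (1 - ρ) * (lam * mode ρ lam t)) := by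
  rcases hlam.eq_or_lt with rfl | hlam
  · simp only [modeDeriv_zero hρ.1, mul_zero, integral_zero, zero_mul, neg_zero]
  set κ := lam ^ (1 / ρ) with hκdef
  have hκ : 0 < κ := Real.rpow_pos_of_pos hlam _
  have hκρ : κ ^ ρ = lam := by
    rw [hκdef, one_div, Real.rpow_inv_rpow hlam.le hρ.1.ne']
  have hscale : ∀ s ∈ Icc 0 t, (t - s) ^ (-ρ) * modeDeriv ρ lam s =
      lam * κ * ((κ * t - κ * s) ^ (-ρ) * deriv (relaxation ρ) (κ * s)) := fun s hs => by
    rw [← mul_sub, Real.mul_rpow hκ.le (sub_nonneg.2 hs.2), Real.rpow_neg hκ.le, hκρ, modeDeriv,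
      ← hκdef]
    field_simp
  have hbase := integral_rpow_mul_deriv_relaxation hρ (mul_pos hκ ht)
  have hsubst := intervalIntegral.integral_comp_mul_left (a := 0) (b := t)
    (fun u => (κ * t - u) ^ (-ρ) * deriv (relaxation ρ) u) hκ.ne'
  rw [← integral_Ioc_eq_integral_Ioo, ← intervalIntegral.integral_of_le (by positivity)]
    at hbase ⊢
  rw [intervalIntegral.integral_congr fun s hs => hscale s (by rwa [uIcc_of_le ht.le] at hs),
    intervalIntegral.integral_const_mul, hsubst, mul_zero, hbase, smul_eq_mul, mode, ← hκdef]
  field_simp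

lemma integrableOn_rpow_mul_modeDeriv (hρ : ρ ∈ Ioo (0 : ℝ) 1) (hlam : 0 ≤ lam) (ht : 0 < t) :
    IntegrableOn (fun s => (t - s) ^ (-ρ) * modeDeriv ρ lam s) (Ioo 0 t) := by
  rcases hlam.eq_or_lt with rfl | hlam
  · simp only [modeDeriv_zero hρ.1, mul_zero]
    exact integrableOn_zero
  · refine Integrable.of_integral_ne_zero ?_
    rw [integral_rpow_mul_modeDeriv hρ hlam.le ht]
    exact (neg_neg_of_pos (mul_pos (Real.Gamma_pos_of_pos (by linarith [hρ.2]))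
      (mul_pos hlam (mode_pos hρ hlam.le ht.le)))).ne

end Mode

section ModeSuperposition

variable {X : Type*} {ρ t : ℝ} {lam : X → ℝ} {b : X → ℂ}

lemma norm_mul_mode_mul_le (hρ : ρ ∈ Ioo (0 : ℝ) 1) (hlam₀ : ∀ η, 0 ≤ lam η) (ht : 0 < t) (η : X) :
    ‖((lam η * mode ρ (lam η) t : ℝ) : ℂ) * b η‖ ≤ Real.exp 1 * t ^ (-ρ) * ‖b η‖ := by
  rw [norm_mul]
  exact mul_le_mul_of_nonneg_right (norm_mul_mode_le hρ (hlam₀ η) ht) (norm_nonneg _)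

variable [MeasurableSpace X] {μ : Measure X}

/-- The superposition of the modes with rates `lam` and amplitudes `b`. -/
def superposition (μ : Measure X) (ρ : ℝ) (lam : X → ℝ) (b : X → ℂ) (t : ℝ) : ℂ :=
  ∫ η, (mode ρ (lam η) t : ℂ) * b η ∂μ

lemma measurable_mode_comp (hρ : ρ ∈ Ioo (0 : ℝ) 1) (hlam : Measurable lam) (hlam₀ : ∀ η, 0 ≤ lam η)
    (ht : 0 ≤ t) : Measurable fun η => (mode ρ (lam η) t : ℂ) := by
  have hclamp : Continuous fun l : ℝ => mode ρ (max 0 l) t :=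
    continuous_mode_comp hρ (by fun_prop) (fun l => le_max_left 0 l) ht
  simpa only [Function.comp_def, max_eq_right (hlam₀ _)] using
    Complex.measurable_ofReal.comp (hclamp.measurable.comp hlam)

lemma memLp_mode_mul {p : ℝ≥0∞} (hρ : ρ ∈ Ioo (0 : ℝ) 1) (hlam : Measurable lam)
    (hlam₀ : ∀ η, 0 ≤ lam η) (hb : MemLp b p μ) (ht : 0 ≤ t) :
    MemLp (fun η => (mode ρ (lam η) t : ℂ) * b η) p μ := by
  refine MemLp.of_le_mul (c := 1) hb
    ((measurable_mode_comp hρ hlam hlam₀ ht).aestronglyMeasurable.mul hb.1)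
    (Eventually.of_forall fun η => ?_)
  rw [norm_mul]
  exact mul_le_mul_of_nonneg_right (norm_mode_le_one hρ (hlam₀ η) ht) (norm_nonneg _)

lemma memLp_mul_mode_mul {p : ℝ≥0∞} (hρ : ρ ∈ Ioo (0 : ℝ) 1) (hlam : Measurable lam)
    (hlam₀ : ∀ η, 0 ≤ lam η) (hb : MemLp b p μ) (ht : 0 < t) :
    MemLp (fun η => ((lam η * mode ρ (lam η) t : ℝ) : ℂ) * b η) p μ := by
  refine MemLp.of_le_mul hb (AEStronglyMeasurable.mul ?_ hb.1)
    (Eventually.of_forall (norm_mul_mode_mul_le hρ hlam₀ ht))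
  simp only [Complex.ofReal_mul]
  exact ((Complex.measurable_ofReal.comp hlam).mul
    (measurable_mode_comp hρ hlam hlam₀ ht.le)).aestronglyMeasurable

lemma continuousOn_superposition (hρ : ρ ∈ Ioo (0 : ℝ) 1) (hlam : Measurable lam)
    (hlam₀ : ∀ η, 0 ≤ lam η) (hb : Integrable b μ) :
    ContinuousOn (superposition μ ρ lam b) (Ici 0) := by
  refine continuousOn_of_dominated (bound := fun η => ‖b η‖)
    (fun t ht => (memLp_mode_mul hρ hlam hlam₀ (memLp_one_iff_integrable.2 hb) ht).1)
    (fun t ht => Eventually.of_forall fun η => ?_) hb.norm (Eventually.of_forall fun η => ?_)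
  · rw [norm_mul]
    exact mul_le_of_le_one_left (norm_nonneg _) (norm_mode_le_one hρ (hlam₀ η) ht)
  · exact (Complex.continuous_ofReal.comp_continuousOn
      (continuousOn_mode hρ (hlam₀ η))).mul continuousOn_const

lemma hasDerivAt_superposition (hρ : ρ ∈ Ioo (0 : ℝ) 1) (hlam : Measurable lam)
    (hlam₀ : ∀ η, 0 ≤ lam η) (hb : Integrable b μ) (ht : 0 < t) :
    HasDerivAt (superposition μ ρ lam b) (∫ η, (modeDeriv ρ (lam η) t : ℂ) * b η ∂μ) t := by
  have hpos : ∀ s ∈ Ioi (t / 2), 0 < s := fun s hs => (half_pos ht).trans hs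
  have hint : ∀ s, 0 ≤ s → Integrable (fun η => (mode ρ (lam η) s : ℂ) * b η) μ := fun s hs =>
    memLp_one_iff_integrable.1
      (memLp_mode_mul hρ hlam hlam₀ (memLp_one_iff_integrable.2 hb) hs)
  have hmeas : Measurable fun η => modeDeriv ρ (lam η) t :=
    (measurable_modeDeriv ρ).comp (hlam.prodMk measurable_const)
  refine (hasDerivAt_integral_of_dominated_loc_of_deriv_le
    (F' := fun t η => (modeDeriv ρ (lam η) t : ℂ) * b η) (bound := fun η => 2 / t * ‖b η‖)
    (Ioi_mem_nhds (half_lt_self ht)) ?_ (hint t ht.le)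
    ((Complex.measurable_ofReal.comp hmeas).aestronglyMeasurable.mul hb.1)
    (Eventually.of_forall fun η s hs => ?_) (hb.norm.const_mul _)
    (Eventually.of_forall fun η s hs => ?_)).2
  · filter_upwards [Ioi_mem_nhds ht] with s hs using (hint s (le_of_lt hs)).1
  · rw [norm_mul, Complex.norm_real]
    refine mul_le_mul_of_nonneg_right
      ((abs_modeDeriv_le hρ (hlam₀ η) (hpos s hs)).trans ?_) (norm_nonneg _)
    rw [div_le_div_iff₀ (hpos s hs) ht]
    linarith [mem_Ioi.1 hs]
  · exact (hasDerivAt_mode hρ (hlam₀ η) (hpos s hs)).ofReal_comp.mul_const _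

lemma setIntegral_norm_rpow_mul_modeDeriv_mul (hρ : ρ ∈ Ioo (0 : ℝ) 1) {l : ℝ} (hl : 0 ≤ l)
    (ht : 0 < t) (z : ℂ) :
    ∫ s in Ioo 0 t, ‖(((t - s) ^ (-ρ) * modeDeriv ρ l s : ℝ) : ℂ) * z‖ =
      Real.Gamma (1 - ρ) * ‖((l * mode ρ l t : ℝ) : ℂ) * z‖ := by
  have hnorm : EqOn (fun s => ‖(((t - s) ^ (-ρ) * modeDeriv ρ l s : ℝ) : ℂ) * z‖)
      (fun s => -‖z‖ * ((t - s) ^ (-ρ) * modeDeriv ρ l s)) (Ioo 0 t) := fun s hs => by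
    have hneg := mul_nonpos_of_nonneg_of_nonpos
      (Real.rpow_nonneg (sub_nonneg.2 hs.2.le) (-ρ)) (modeDeriv_nonpos hρ hl hs.1)
    simp only [norm_mul, Complex.norm_real]
    rw [← norm_mul, Real.norm_of_nonpos hneg]
    ring
  rw [setIntegral_congr_fun measurableSet_Ioo hnorm, integral_const_mul,
    integral_rpow_mul_modeDeriv hρ hl ht, norm_mul, Complex.norm_real,
    Real.norm_of_nonneg (mul_nonneg hl (mode_pos hρ hl ht.le).le)]
  ring

lemma integrable_prod_rpow_mul_modeDeriv_mul [SFinite μ] (hρ : ρ ∈ Ioo (0 : ℝ) 1)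
    (hlam : Measurable lam) (hlam₀ : ∀ η, 0 ≤ lam η) (hb : Integrable b μ) (ht : 0 < t) :
    Integrable (fun p : ℝ × X =>
      (((t - p.1) ^ (-ρ) * modeDeriv ρ (lam p.2) p.1 : ℝ) : ℂ) * b p.2)
      ((volume.restrict (Ioo 0 t)).prod μ) := by
  have hkernel : Measurable fun p : ℝ × X => (t - p.1) ^ (-ρ) :=
    (measurable_const.sub measurable_fst).pow_const _
  have hderiv : Measurable fun p : ℝ × X => modeDeriv ρ (lam p.2) p.1 :=
    (measurable_modeDeriv ρ).comp ((hlam.comp measurable_snd).prodMk measurable_fst)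
  refine (integrable_prod_iff' ((Complex.measurable_ofReal.comp
    (hkernel.mul hderiv)).aestronglyMeasurable.mul hb.1.comp_snd)).2 ⟨?_, ?_⟩
  · exact Eventually.of_forall fun η =>
      (integrableOn_rpow_mul_modeDeriv hρ (hlam₀ η) ht).ofReal.mul_const (b η)
  · exact ((memLp_one_iff_integrable.1 (memLp_mul_mode_mul hρ hlam hlam₀
      (memLp_one_iff_integrable.2 hb) ht)).norm.const_mul _).congr (Eventually.of_forall fun η =>
        (setIntegral_norm_rpow_mul_modeDeriv_mul hρ (hlam₀ η) ht (b η)).symm)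

lemma rpow_smul_deriv_superposition (hρ : ρ ∈ Ioo (0 : ℝ) 1) (hlam : Measurable lam)
    (hlam₀ : ∀ η, 0 ≤ lam η) (hb : Integrable b μ) {s : ℝ} (hs : 0 < s) :
    (t - s) ^ (-ρ) • deriv (superposition μ ρ lam b) s =
      ∫ η, (((t - s) ^ (-ρ) * modeDeriv ρ (lam η) s : ℝ) : ℂ) * b η ∂μ := by
  simp only [(hasDerivAt_superposition hρ hlam hlam₀ hb hs).deriv, Complex.ofReal_mul, mul_assoc,
    integral_const_mul, Complex.real_smul]

lemma integrableOn_rpow_smul_deriv_superposition [SFinite μ] (hρ : ρ ∈ Ioo (0 : ℝ) 1)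
    (hlam : Measurable lam) (hlam₀ : ∀ η, 0 ≤ lam η) (hb : Integrable b μ) (ht : 0 < t) :
    IntegrableOn (fun s => (t - s) ^ (-ρ) • deriv (superposition μ ρ lam b) s) (Ioo 0 t) :=
  IntegrableOn.congr_fun
    (integrable_prod_rpow_mul_modeDeriv_mul hρ hlam hlam₀ hb ht).integral_prod_left
    (fun _ hs => (rpow_smul_deriv_superposition hρ hlam hlam₀ hb hs.1).symm) measurableSet_Ioo

theorem caputo_superposition [SFinite μ] (hρ : ρ ∈ Ioo (0 : ℝ) 1) (hlam : Measurable lam)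
    (hlam₀ : ∀ η, 0 ≤ lam η) (hb : Integrable b μ) (ht : 0 < t) :
    caputo ρ (superposition μ ρ lam b) t =
      -∫ η, ((lam η * mode ρ (lam η) t : ℝ) : ℂ) * b η ∂μ := by
  have hΓ : 0 < Real.Gamma (1 - ρ) := Real.Gamma_pos_of_pos (by linarith [hρ.2])
  have hinner : ∀ η, ∫ s in Ioo 0 t, (((t - s) ^ (-ρ) * modeDeriv ρ (lam η) s : ℝ) : ℂ) * b η =
      -(Real.Gamma (1 - ρ) : ℂ) * (((lam η * mode ρ (lam η) t : ℝ) : ℂ) * b η) := fun η => by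
    rw [integral_mul_const, integral_complex_ofReal,
      integral_rpow_mul_modeDeriv hρ (hlam₀ η) ht]
    push_cast; ring
  rw [caputo, intervalIntegral.integral_of_le ht.le, integral_Ioc_eq_integral_Ioo,
    setIntegral_congr_fun measurableSet_Ioo fun s hs =>
      rpow_smul_deriv_superposition hρ hlam hlam₀ hb hs.1,
    integral_integral_swap (integrable_prod_rpow_mul_modeDeriv_mul hρ hlam hlam₀ hb ht)]
  simp_rw [hinner]
  rw [integral_const_mul, Complex.real_smul, neg_mul, mul_neg, ← mul_assoc, ← Complex.ofReal_mul,
    inv_mul_cancel₀ hΓ.ne', Complex.ofReal_one, one_mul]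

lemma hasCaputo_superposition [SFinite μ] (hρ : ρ ∈ Ioo (0 : ℝ) 1) (hlam : Measurable lam)
    (hlam₀ : ∀ η, 0 ≤ lam η) (hb : Integrable b μ) {T : ℝ} (hT : 0 < T) :
    HasCaputo ρ T (superposition μ ρ lam b) where
  continuousOn := (continuousOn_superposition hρ hlam hlam₀ hb).mono Icc_subset_Ici_self
  differentiableAt t ht := (hasDerivAt_superposition hρ hlam hlam₀ hb ht.1).differentiableAt
  integrable_deriv := by
    have hweighted := integrableOn_rpow_smul_deriv_superposition hρ hlam hlam₀ hb hT
    have hbound : ∀ᵐ s ∂volume.restrict (Ioo 0 T), ‖(((T - s) ^ ρ : ℝ) : ℂ)‖ ≤ T ^ ρ := by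
      filter_upwards [ae_restrict_mem measurableSet_Ioo] with s hs
      have hs' : 0 ≤ T - s := sub_nonneg.2 hs.2.le
      rw [Complex.norm_real, Real.norm_of_nonneg (by positivity)]
      exact Real.rpow_le_rpow hs' (by linarith [hs.1]) hρ.1.le
    have hmeas : Measurable fun s : ℝ => (((T - s) ^ ρ : ℝ) : ℂ) :=
      Complex.measurable_ofReal.comp ((measurable_const.sub measurable_id).pow_const _)
    refine IntegrableOn.congr_fun (hweighted.bdd_mul hmeas.aestronglyMeasurable hbound)
      (fun s hs => ?_) measurableSet_Ioo
    rw [Complex.real_smul, ← mul_assoc, ← Complex.ofReal_mul, ← Real.rpow_add (sub_pos.2 hs.2),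
      add_neg_cancel, Real.rpow_zero, Complex.ofReal_one, one_mul]
  integrable_kernel t ht := integrableOn_rpow_smul_deriv_superposition hρ hlam hlam₀ hb ht.1

end ModeSuperposition

section Evolution

variable {V : Type*} [NormedAddCommGroup V] [InnerProductSpace ℝ V]

/-- The wave `e^{2 π i ⟨η, x⟩}`, the kernel of Mathlib's inverse Fourier transform. -/
def planeWave (x η : V) : ℂ := Complex.exp (((2 * π * inner ℝ η x : ℝ) : ℂ) * Complex.I)

lemma norm_planeWave (x η : V) : ‖planeWave x η‖ = 1 := Complex.norm_exp_ofReal_mul_I _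

lemma continuous_planeWave : Continuous fun p : V × V => planeWave p.1 p.2 := by
  unfold planeWave; fun_prop

variable [FiniteDimensional ℝ V] [MeasurableSpace V] [BorelSpace V] {ρ t : ℝ} {lam : V → ℝ}
  {a : V → ℂ}

lemma fourierInv_eq_integral_planeWave (f : V → ℂ) (x : V) :
    𝓕⁻ f x = ∫ η, planeWave x η * f η := by
  rw [Real.fourierInv_eq']; rfl

lemma integrable_planeWave_mul (ha : Integrable a) (x : V) :
    Integrable fun η => planeWave x η * a η :=
  ha.bdd_mul (c := 1) (continuous_planeWave.comp (.prodMk_right x)).aestronglyMeasurable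
    (Eventually.of_forall fun η => (norm_planeWave x η).le)

/-- The evolution with the symbol `lam` of the function with Fourier transform `a`. -/
def evolution (ρ : ℝ) (lam : V → ℝ) (a : V → ℂ) (x : V) (t : ℝ) : ℂ :=
  𝓕⁻ (fun η => (mode ρ (lam η) t : ℂ) * a η) x

/-- The operator with the symbol `lam` applied to the evolution. -/
def evolutionSymbol (ρ : ℝ) (lam : V → ℝ) (a : V → ℂ) (x : V) (t : ℝ) : ℂ :=
  𝓕⁻ (fun η => ((lam η * mode ρ (lam η) t : ℝ) : ℂ) * a η) x

lemma evolution_zero (hρ : ρ ∈ Ioo (0 : ℝ) 1) (x : V) : evolution ρ lam a x 0 = 𝓕⁻ a x := by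
  simp only [evolution, mode_zero hρ, Complex.ofReal_one, one_mul]

lemma evolution_eq_superposition (x : V) :
    evolution ρ lam a x = superposition volume ρ lam fun η => planeWave x η * a η := by
  ext t
  simp only [evolution, superposition, fourierInv_eq_integral_planeWave]
  exact integral_congr_ae (Eventually.of_forall fun η => mul_left_comm _ _ _)

lemma hasCaputo_evolution (hρ : ρ ∈ Ioo (0 : ℝ) 1) (hlam : Measurable lam)
    (hlam₀ : ∀ η, 0 ≤ lam η) (ha : Integrable a) (x : V) {T : ℝ} (hT : 0 < T) :
    HasCaputo ρ T (evolution ρ lam a x) :=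
  evolution_eq_superposition x ▸
    hasCaputo_superposition hρ hlam hlam₀ (integrable_planeWave_mul ha x) hT

theorem caputo_evolution (hρ : ρ ∈ Ioo (0 : ℝ) 1) (hlam : Measurable lam)
    (hlam₀ : ∀ η, 0 ≤ lam η) (ha : Integrable a) (x : V) (ht : 0 < t) :
    caputo ρ (evolution ρ lam a x) t = -evolutionSymbol ρ lam a x t := by
  rw [evolution_eq_superposition,
    caputo_superposition hρ hlam hlam₀ (integrable_planeWave_mul ha x) ht, evolutionSymbol,
    fourierInv_eq_integral_planeWave]
  simp only [mul_left_comm (planeWave x _)]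

lemma continuousOn_evolutionSymbol (hρ : ρ ∈ Ioo (0 : ℝ) 1) (hlam : Measurable lam)
    (hlam₀ : ∀ η, 0 ≤ lam η) (ha : Integrable a) :
    ContinuousOn (fun p : V × ℝ => evolutionSymbol ρ lam a p.1 p.2) (univ ×ˢ Ioi 0) := by
  rintro ⟨x, t⟩ ⟨-, ht⟩
  simp only [mem_Ioi] at ht
  refine ContinuousAt.continuousWithinAt ?_
  simp only [evolutionSymbol, fourierInv_eq_integral_planeWave]
  have hlate : ∀ᶠ p : V × ℝ in 𝓝 (x, t), t / 2 < p.2 :=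
    (continuous_snd.tendsto (x, t)).eventually (lt_mem_nhds (half_lt_self ht))
  refine continuousAt_of_dominated (bound := fun η => Real.exp 1 * (t / 2) ^ (-ρ) * ‖a η‖) ?_ ?_
    (ha.norm.const_mul _) (Eventually.of_forall fun η => ?_)
  · filter_upwards [hlate] with p hp
    exact (continuous_planeWave.comp (.prodMk_right p.1)).aestronglyMeasurable.mul
      (memLp_mul_mode_mul hρ hlam hlam₀ (memLp_one_iff_integrable.2 ha) (by linarith)).1
  · filter_upwards [hlate] with p hp
    refine Eventually.of_forall fun η => ?_
    rw [norm_mul, norm_planeWave, one_mul]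
    refine (norm_mul_mode_mul_le hρ hlam₀ (by linarith) η).trans ?_
    exact mul_le_mul_of_nonneg_right (mul_le_mul_of_nonneg_left (Real.rpow_le_rpow_of_nonpos
      (by linarith) hp.le (by linarith [hρ.1])) (Real.exp_pos 1).le) (norm_nonneg _)
  · have hmode : ContinuousAt (fun p : V × ℝ => mode ρ (lam η) p.2) (x, t) :=
      ContinuousAt.comp (f := Prod.snd)
        ((continuousOn_mode hρ (hlam₀ η)).continuousAt (Ici_mem_nhds ht))
        continuous_snd.continuousAt
    have hwave : Continuous fun p : V × ℝ => planeWave p.1 η :=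
      continuous_planeWave.comp (continuous_fst.prodMk continuous_const)
    exact hwave.continuousAt.mul ((Complex.continuous_ofReal.continuousAt.comp
      (continuousAt_const.mul hmode)).mul continuousAt_const)

lemma eLpNorm_evolutionSymbol_le (hρ : ρ ∈ Ioo (0 : ℝ) 1) (hlam : Measurable lam)
    (hlam₀ : ∀ η, 0 ≤ lam η) (ha : Integrable a) (ha2 : MemLp a 2) (ht : 0 < t) :
    eLpNorm (fun x => evolutionSymbol ρ lam a x t) 2 volume ≤
      ENNReal.ofReal (Real.exp 1 * t ^ (-ρ)) * eLpNorm a 2 volume := by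
  have hplancherel := eLpNorm_fourierInv (memLp_one_iff_integrable.1
    (memLp_mul_mode_mul hρ hlam hlam₀ (memLp_one_iff_integrable.2 ha) ht))
    (memLp_mul_mode_mul hρ hlam hlam₀ ha2 ht)
  exact hplancherel.le.trans (eLpNorm_le_mul_eLpNorm_of_ae_le_mul
    (Eventually.of_forall (norm_mul_mode_mul_le hρ hlam₀ ht)) 2)

lemma lintegral_eLpNorm_evolutionSymbol_lt_top (hρ : ρ ∈ Ioo (0 : ℝ) 1) (hlam : Measurable lam)
    (hlam₀ : ∀ η, 0 ≤ lam η) (ha : Integrable a) (ha2 : MemLp a 2) (T : ℝ) :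
    (∫⁻ t in Ioc 0 T, eLpNorm (fun x => evolutionSymbol ρ lam a x t) 2 volume) < ∞ := by
  refine (setLIntegral_mono' measurableSet_Ioc fun t ht =>
    eLpNorm_evolutionSymbol_le hρ hlam hlam₀ ha ha2 ht.1).trans_lt ?_
  rw [lintegral_mul_const' _ _ ha2.eLpNorm_ne_top]
  refine ENNReal.mul_lt_top ?_ ha2.eLpNorm_lt_top
  have hint : Integrable (fun t : ℝ => Real.exp 1 * t ^ (-ρ)) (volume.restrict (Ioc 0 T)) :=
    ((intervalIntegral.intervalIntegrable_rpow' (a := 0) (b := T) (r := -ρ)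
    (by linarith [hρ.2])).1).const_mul _
  exact hint.lintegral_lt_top

end Evolution

section Solution

variable {N l : ℕ} {A : MvPolynomial (Fin N) ℝ}

lemma symbol_nonneg (hl : 0 < l) (hA : A.IsHomogeneous (2 * l))
    (hApos : ∀ ξ : EuclideanSpace ℝ (Fin N), ξ ≠ 0 → 0 < symbol A ξ)
    (ξ : EuclideanSpace ℝ (Fin N)) : 0 ≤ symbol A ξ := by
  rcases eq_or_ne ξ 0 with rfl | hξ
  · have hconst : MvPolynomial.constantCoeff A = 0 := hA.coeff_eq_zero (by simp; omega)
    rw [← hconst, ← MvPolynomial.eval_zero]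
    exact le_rfl
  · exact (hApos ξ hξ).le

lemma continuous_symbol (A : MvPolynomial (Fin N) ℝ) : Continuous (symbol A) :=
  (MvPolynomial.continuous_eval A).comp (by fun_prop)

/-- The symbol of `Â^σ` in the variable of Mathlib's Fourier transform. -/
def powerSymbol (A : MvPolynomial (Fin N) ℝ) (σ : ℝ) (η : EuclideanSpace ℝ (Fin N)) : ℝ :=
  symbol A ((2 * π) • η) ^ σ

lemma powerSymbol_smul (σ : ℝ) (ξ : EuclideanSpace ℝ (Fin N)) :
    powerSymbol A σ ((2 * π)⁻¹ • ξ) = symbol A ξ ^ σ := by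
  rw [powerSymbol, smul_smul, mul_inv_cancel₀ (by positivity), one_smul]

lemma measurable_powerSymbol (A : MvPolynomial (Fin N) ℝ) (σ : ℝ) : Measurable (powerSymbol A σ) :=
  ((continuous_symbol A).comp (continuous_const_smul _)).measurable.pow_const σ

lemma powerSymbol_nonneg (hA₀ : ∀ ξ, 0 ≤ symbol A ξ) (σ : ℝ) (η : EuclideanSpace ℝ (Fin N)) :
    0 ≤ powerSymbol A σ η := Real.rpow_nonneg (hA₀ _) _

section Existence

variable {ρ σ T t : ℝ} {a m : EuclideanSpace ℝ (Fin N) → ℂ}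

lemma integrable_hat_fourierInv (ha : Integrable a) (ha2 : MemLp a 2) : Integrable (hat (𝓕⁻ a)) :=
  ((ha.comp_smul (by positivity)).smul (((2 * π) ^ N)⁻¹ : ℝ)).congr (hat_fourierInv ha ha2).symm

lemma hat_fourierInv_mul (ha : Integrable a) (ha2 : MemLp a 2)
    (hma : Integrable fun η => m η * a η) (hma2 : MemLp (fun η => m η * a η) 2) :
    hat (𝓕⁻ fun η => m η * a η) =ᵐ[volume] fun ξ => m ((2 * π)⁻¹ • ξ) * hat (𝓕⁻ a) ξ := by
  filter_upwards [hat_fourierInv ha ha2, hat_fourierInv hma hma2] with ξ haξ hmaξ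
  rw [haξ, hmaξ, mul_smul_comm]

lemma hat_evolution (hρ : ρ ∈ Ioo (0 : ℝ) 1) (hA₀ : ∀ ξ, 0 ≤ symbol A ξ) (σ : ℝ)
    (ha : Integrable a) (ha2 : MemLp a 2) (ht : 0 ≤ t) :
    hat (fun x => evolution ρ (powerSymbol A σ) a x t) =ᵐ[volume] fun ξ =>
      (mode ρ (symbol A ξ ^ σ) t : ℂ) * hat (𝓕⁻ a) ξ := by
  have hmem {p : ℝ≥0∞} (hp : MemLp a p) :=
    memLp_mode_mul hρ (measurable_powerSymbol A σ) (powerSymbol_nonneg hA₀ σ) hp ht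
  have hhat := hat_fourierInv_mul ha ha2
    (memLp_one_iff_integrable.1 (hmem (memLp_one_iff_integrable.2 ha))) (hmem ha2)
  simp only [powerSymbol_smul] at hhat
  exact hhat

lemma hat_evolutionSymbol (hρ : ρ ∈ Ioo (0 : ℝ) 1) (hA₀ : ∀ ξ, 0 ≤ symbol A ξ) (σ : ℝ)
    (ha : Integrable a) (ha2 : MemLp a 2) (ht : 0 < t) :
    hat (fun x => evolutionSymbol ρ (powerSymbol A σ) a x t) =ᵐ[volume] fun ξ =>
      ((symbol A ξ ^ σ * mode ρ (symbol A ξ ^ σ) t : ℝ) : ℂ) * hat (𝓕⁻ a) ξ := by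
  have hmem {p : ℝ≥0∞} (hp : MemLp a p) :=
    memLp_mul_mode_mul hρ (measurable_powerSymbol A σ) (powerSymbol_nonneg hA₀ σ) hp ht
  have hhat := hat_fourierInv_mul ha ha2
    (memLp_one_iff_integrable.1 (hmem (memLp_one_iff_integrable.2 ha))) (hmem ha2)
  simp only [powerSymbol_smul] at hhat
  exact hhat

lemma isFractionalPower_evolution (hρ : ρ ∈ Ioo (0 : ℝ) 1) (hA₀ : ∀ ξ, 0 ≤ symbol A ξ) (σ : ℝ)
    (ha : Integrable a) (ha2 : MemLp a 2) (ht : 0 < t) :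
    IsFractionalPower A σ (fun x => evolution ρ (powerSymbol A σ) a x t)
      (fun x => evolutionSymbol ρ (powerSymbol A σ) a x t) := by
  have hlam := measurable_powerSymbol A σ
  have hlam₀ := powerSymbol_nonneg hA₀ σ
  have ha1 : MemLp a 1 := memLp_one_iff_integrable.2 ha
  refine ⟨memLp_fourierInv (memLp_one_iff_integrable.1 (memLp_mode_mul hρ hlam hlam₀ ha1 ht.le))
      (memLp_mode_mul hρ hlam hlam₀ ha2 ht.le),
    memLp_fourierInv (memLp_one_iff_integrable.1 (memLp_mul_mode_mul hρ hlam hlam₀ ha1 ht))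
      (memLp_mul_mode_mul hρ hlam hlam₀ ha2 ht), ?_⟩
  filter_upwards [hat_evolution hρ hA₀ σ ha ha2 ht.le, hat_evolutionSymbol hρ hA₀ σ ha ha2 ht]
    with ξ hv hw
  rw [hv, hw, Complex.ofReal_mul, mul_assoc]

theorem isSolution_evolution (hρ : ρ ∈ Ioo (0 : ℝ) 1) (hA₀ : ∀ ξ, 0 ≤ symbol A ξ) (σ : ℝ)
    (ha : Integrable a) (ha2 : MemLp a 2) (hT : 0 < T) :
    IsSolution A ρ σ T (𝓕⁻ a) (evolution ρ (powerSymbol A σ) a) := by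
  have hlam := measurable_powerSymbol A σ
  have hlam₀ := powerSymbol_nonneg hA₀ σ
  have hcont := (continuousOn_evolutionSymbol hρ hlam hlam₀ ha).mono
    (prod_mono_right (s := univ) (Ioc_subset_Ioi_self : Ioc 0 T ⊆ Ioi 0))
  exact
    { initial := evolution_zero hρ
      boundary := fun t _ => tendsto_fourierInv_cocompact _
      hasCaputo := fun x => hasCaputo_evolution hρ hlam hlam₀ ha x hT
      continuousOn_caputo := hcont.neg.congr fun p hp =>
        caputo_evolution hρ hlam hlam₀ ha p.1 hp.2.1
      integrable_hat := fun t ht => integrable_hat_fourierInv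
        (memLp_one_iff_integrable.1
          (memLp_mode_mul hρ hlam hlam₀ (memLp_one_iff_integrable.2 ha) ht.1.le))
        (memLp_mode_mul hρ hlam hlam₀ ha2 ht.1.le)
      equation := ⟨evolutionSymbol ρ (powerSymbol A σ) a, hcont,
        fun t ht => isFractionalPower_evolution hρ hA₀ σ ha ha2 ht.1,
        lintegral_eLpNorm_evolutionSymbol_lt_top hρ hlam hlam₀ ha ha2 T,
        fun x t ht => by rw [caputo_evolution hρ hlam hlam₀ ha x ht.1, neg_add_cancel]⟩ }

end Existence

section LebesgueValue

lemma laverage_add_left {α : Type*} [MeasurableSpace α] {μ : Measure α} {f : α → ℝ≥0∞}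
    (hf : AEMeasurable f μ) (g : α → ℝ≥0∞) :
    ⨍⁻ x, (f x + g x) ∂μ = (⨍⁻ x, f x ∂μ) + ⨍⁻ x, g x ∂μ :=
  lintegral_add_left' (hf.smul_measure _) g

variable {f g : EuclideanSpace ℝ (Fin N) → ℂ} {ξ : EuclideanSpace ℝ (Fin N)} {c c' : ℂ}

lemma setLAverage_ball_const (ξ : EuclideanSpace ℝ (Fin N)) {r : ℝ} (hr : 0 < r) (k : ℝ≥0∞) :
    ⨍⁻ _ in Metric.ball ξ r, k ∂volume = k :=
  setLAverage_const (Metric.measure_ball_pos volume ξ hr).ne' measure_ball_lt_top.ne k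

lemma HasLebesgueValue.congr (h : HasLebesgueValue f ξ c) (hfg : f =ᵐ[volume] g) :
    HasLebesgueValue g ξ c := by
  refine Tendsto.congr (fun r => laverage_congr (ae_restrict_of_ae ?_)) h
  filter_upwards [hfg] with η hη
  rw [hη]

lemma HasLebesgueValue.unique (hf : AEStronglyMeasurable f volume) (h : HasLebesgueValue f ξ c)
    (h' : HasLebesgueValue f ξ c') : c = c' := by
  have hle : ∀ᶠ r : ℝ in 𝓝[>] 0, ‖c - c'‖ₑ ≤ (⨍⁻ η in Metric.ball ξ r, ‖f η - c‖ₑ ∂volume) +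
      ⨍⁻ η in Metric.ball ξ r, ‖f η - c'‖ₑ ∂volume := by
    have htriangle : ∀ η, ‖c - c'‖ₑ ≤ ‖f η - c‖ₑ + ‖f η - c'‖ₑ := fun η => by
      rw [← sub_sub_sub_cancel_left c' c (f η), add_comm]
      exact enorm_sub_le
    filter_upwards [self_mem_nhdsWithin] with r hr
    rw [← setLAverage_ball_const ξ hr ‖c - c'‖ₑ,
      ← laverage_add_left (f := fun η => ‖f η - c‖ₑ)
        (hf.restrict.sub aestronglyMeasurable_const).enorm]
    exact laverage_mono_ae (Eventually.of_forall htriangle)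
  have hzero := ge_of_tendsto (Tendsto.add h h') hle
  rwa [add_zero, nonpos_iff_eq_zero, enorm_eq_zero, sub_eq_zero] at hzero

lemma HasLebesgueValue.mul (hf : AEStronglyMeasurable f volume) (h : HasLebesgueValue f ξ c)
    (hg : ContinuousAt g ξ) : HasLebesgueValue (fun η => g η * f η) ξ (g ξ * c) := by
  have hscaled := ENNReal.Tendsto.const_mul (a := ‖g ξ‖ₑ + 1) h (.inr (by finiteness))
  rw [mul_zero, ENNReal.tendsto_nhds_zero] at hscaled
  have hincrement : Tendsto (fun η => ‖(g η - g ξ) * c‖ₑ) (𝓝 ξ) (𝓝 0) := by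
    simpa using ((hg.sub_const (g ξ)).mul_const c).enorm
  rw [ENNReal.tendsto_nhds_zero] at hincrement
  have hbounded : ∀ᶠ η in 𝓝 ξ, ‖g η‖ₑ < ‖g ξ‖ₑ + 1 :=
    hg.enorm.eventually (gt_mem_nhds (ENNReal.lt_add_right (by finiteness) one_ne_zero))
  refine ENNReal.tendsto_nhds_zero.2 fun ε hε => ?_
  have hε₂ : 0 < ε / 2 := ENNReal.half_pos hε.ne'
  obtain ⟨δ, hδ, hball⟩ := Metric.eventually_nhds_iff_ball.1 (hbounded.and (hincrement _ hε₂))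
  filter_upwards [hscaled _ hε₂, Ioo_mem_nhdsGT hδ] with r hr hrδ
  have hmeas : AEMeasurable (fun η => ‖f η - c‖ₑ) (volume.restrict (Metric.ball ξ r)) :=
    (hf.restrict.sub aestronglyMeasurable_const).enorm
  have hpointwise : ∀ η ∈ Metric.ball ξ r,
      ‖g η * f η - g ξ * c‖ₑ ≤ (‖g ξ‖ₑ + 1) * ‖f η - c‖ₑ + ε / 2 := fun η hη => by
    obtain ⟨hgη, hincη⟩ := hball η (Metric.ball_subset_ball hrδ.2.le hη)
    have hsplit : g η * f η - g ξ * c = g η * (f η - c) + (g η - g ξ) * c := by ring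
    rw [hsplit]
    refine (enorm_add_le _ _).trans (add_le_add ?_ hincη)
    rw [enorm_mul]
    gcongr
  calc ⨍⁻ η in Metric.ball ξ r, ‖g η * f η - g ξ * c‖ₑ ∂volume
      ≤ ⨍⁻ η in Metric.ball ξ r, ((‖g ξ‖ₑ + 1) * ‖f η - c‖ₑ + ε / 2) ∂volume :=
        laverage_mono_ae ((ae_restrict_mem measurableSet_ball).mono hpointwise)
    _ = (‖g ξ‖ₑ + 1) * (⨍⁻ η in Metric.ball ξ r, ‖f η - c‖ₑ ∂volume) + ε / 2 := by
        rw [laverage_add_left (hmeas.const_mul _), setLAverage_ball_const ξ hrδ.1]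
        congr 1
        exact lintegral_const_mul'' _ (hmeas.smul_measure _)
    _ ≤ ε / 2 + ε / 2 := by gcongr
    _ = ε := ENNReal.add_halves ε

lemma aestronglyMeasurable_hat (hf : MemLp f 2) : AEStronglyMeasurable (hat f) volume := by
  simp only [funext (hat_of_memLp hf)]
  exact (((Lp.stronglyMeasurable (𝓕 (hf.toLp f) : Lp ℂ 2 volume)).comp_measurable
    (measurable_const_smul (2 * π)⁻¹)).const_smul (((2 * π) ^ N)⁻¹ : ℝ)).aestronglyMeasurable

end LebesgueValue

end Solution

section Abel

variable {ρ t T : ℝ} {h : ℝ → ℂ}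

/-- The kernel of the composition of the (unnormalised) fractional integrals of orders `ρ` and
`1 - ρ`, extended by zero outside `r < s`. -/
def abelKernel (ρ t s r : ℝ) : ℝ :=
  if r < s then (t - s) ^ (ρ - 1) * (s - r) ^ (-ρ) else 0

lemma measurable_abelKernel (ρ t : ℝ) : Measurable fun p : ℝ × ℝ => abelKernel ρ t p.1 p.2 :=
  Measurable.ite (measurableSet_lt measurable_snd measurable_fst)
    (((measurable_const.sub measurable_fst).pow_const _).mul
      ((measurable_fst.sub measurable_snd).pow_const _)) measurable_const

lemma abelKernel_nonneg {s r : ℝ} (hs : s ≤ t) : 0 ≤ abelKernel ρ t s r := by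
  unfold abelKernel
  split_ifs with hr
  · exact mul_nonneg (Real.rpow_nonneg (sub_nonneg.2 hs) _) (Real.rpow_nonneg (by linarith) _)
  · exact le_rfl

lemma integral_abelKernel (hρ : ρ ∈ Ioo (0 : ℝ) 1) {r : ℝ} (hr : r ∈ Ioo 0 t) :
    ∫ s in Ioo 0 t, abelKernel ρ t s r = Real.Gamma (1 - ρ) * Real.Gamma ρ := by
  have hkernel : (fun s => abelKernel ρ t s r) =
      (Ioi r).indicator fun s => (t - r - (s - r)) ^ (ρ - 1) * (s - r) ^ (1 - ρ - 1) := by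
    ext s
    simp only [abelKernel, indicator_apply, mem_Ioi, sub_sub_sub_cancel_right, sub_sub_cancel_left]
  have hIoo : Ioo 0 t ∩ Ioi r = Ioo r t := by
    rw [inter_comm, Ioi_inter_Ioo, max_eq_left hr.1.le]
  rw [hkernel, setIntegral_indicator measurableSet_Ioi, hIoo, ← integral_Ioc_eq_integral_Ioo,
    ← intervalIntegral.integral_of_le hr.2.le,
    intervalIntegral.integral_comp_sub_right
      (fun u => (t - r - u) ^ (ρ - 1) * u ^ (1 - ρ - 1)) r, sub_self,
    intervalIntegral.integral_of_le (sub_nonneg.2 hr.2.le), integral_Ioc_eq_integral_Ioo,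
    integral_rpow_mul_rpow_sub (sub_pos.2 hρ.2) hρ.1 (sub_pos.2 hr.2)]
  simp only [sub_add_cancel, sub_self, Real.rpow_zero, Real.Gamma_one, div_one, one_mul]

lemma integrableOn_abelKernel (hρ : ρ ∈ Ioo (0 : ℝ) 1) {r : ℝ} (hr : r ∈ Ioo 0 t) :
    IntegrableOn (fun s => abelKernel ρ t s r) (Ioo 0 t) := by
  refine Integrable.of_integral_ne_zero ?_
  rw [integral_abelKernel hρ hr]
  exact (mul_pos (Real.Gamma_pos_of_pos (sub_pos.2 hρ.2)) (Real.Gamma_pos_of_pos hρ.1)).ne'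

lemma integrable_abelKernel_smul (hρ : ρ ∈ Ioo (0 : ℝ) 1) {f : ℝ → ℂ}
    (hf : IntegrableOn f (Ioo 0 t)) :
    Integrable (fun p : ℝ × ℝ => abelKernel ρ t p.1 p.2 • f p.2)
      ((volume.restrict (Ioo 0 t)).prod (volume.restrict (Ioo 0 t))) := by
  have hmeas : AEStronglyMeasurable (fun p : ℝ × ℝ => abelKernel ρ t p.1 p.2 • f p.2)
      ((volume.restrict (Ioo 0 t)).prod (volume.restrict (Ioo 0 t))) :=
    (measurable_abelKernel ρ t).aestronglyMeasurable.smul hf.1.comp_snd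
  rw [integrable_prod_iff' hmeas]
  refine ⟨?_, (hf.norm.const_mul (Real.Gamma (1 - ρ) * Real.Gamma ρ)).congr ?_⟩
  · filter_upwards [ae_restrict_mem measurableSet_Ioo] with r hr
    exact (integrableOn_abelKernel hρ hr).smul_const _
  · filter_upwards [ae_restrict_mem measurableSet_Ioo] with r hr
    rw [← integral_abelKernel hρ hr, ← integral_mul_const]
    refine setIntegral_congr_fun measurableSet_Ioo fun s hs => ?_
    rw [norm_smul, Real.norm_of_nonneg (abelKernel_nonneg hs.2.le)]

lemma integral_abelKernel_smul_deriv (hρ : ρ < 1) (h : ℝ → ℂ) {s : ℝ} (hs : s ∈ Ioo 0 t) :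
    ∫ r in Ioo 0 t, abelKernel ρ t s r • deriv h r =
      Real.Gamma (1 - ρ) • ((t - s) ^ (ρ - 1) : ℝ) • caputo ρ h s := by
  have hkernel : (fun r => abelKernel ρ t s r • deriv h r) = (Iio s).indicator
      fun r => ((t - s) ^ (ρ - 1) : ℝ) • ((s - r) ^ (-ρ) : ℝ) • deriv h r := by
    ext r
    simp only [abelKernel, indicator_apply, mem_Iio, ite_smul, mul_smul, zero_smul]
  have hIoo : Ioo 0 t ∩ Iio s = Ioo 0 s := by
    rw [Ioo_inter_Iio, min_eq_right hs.2.le]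
  rw [hkernel, setIntegral_indicator measurableSet_Iio, hIoo, integral_smul, smul_comm, caputo,
    smul_inv_smul₀ (Real.Gamma_pos_of_pos (sub_pos.2 hρ)).ne',
    intervalIntegral.integral_of_le hs.1.le, integral_Ioc_eq_integral_Ioo]

lemma HasCaputo.integrableOn_deriv (hh : HasCaputo ρ T h) (ht : t ≤ T) :
    IntegrableOn (deriv h) (Ioo 0 t) :=
  hh.integrable_deriv.mono_set (Ioo_subset_Ioo_right ht)

lemma HasCaputo.integral_deriv (hh : HasCaputo ρ T h) (ht : t ∈ Ioc 0 T) :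
    ∫ r in Ioo 0 t, deriv h r = h t - h 0 := by
  rw [← integral_Ioc_eq_integral_Ioo, ← intervalIntegral.integral_of_le ht.1.le]
  refine intervalIntegral.integral_eq_sub_of_hasDerivAt_of_le ht.1.le
    (hh.continuousOn.mono (Icc_subset_Icc_right ht.2))
    (fun r hr => (hh.differentiableAt r ⟨hr.1, hr.2.trans_le ht.2⟩).hasDerivAt) ?_
  rw [intervalIntegrable_iff_integrableOn_Ioo_of_le ht.1.le]
  exact hh.integrableOn_deriv ht.2

theorem HasCaputo.integral_rpow_smul_caputo (hρ : ρ ∈ Ioo (0 : ℝ) 1) (hh : HasCaputo ρ T h)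
    (ht : t ∈ Ioc 0 T) :
    ∫ s in Ioo 0 t, ((t - s) ^ (ρ - 1) : ℝ) • caputo ρ h s = Real.Gamma ρ • (h t - h 0) := by
  have hΓ := (Real.Gamma_pos_of_pos (sub_pos.2 hρ.2)).ne'
  refine smul_right_injective ℂ hΓ ?_
  calc Real.Gamma (1 - ρ) • ∫ s in Ioo 0 t, ((t - s) ^ (ρ - 1) : ℝ) • caputo ρ h s
      = ∫ s in Ioo 0 t, ∫ r in Ioo 0 t, abelKernel ρ t s r • deriv h r := by
        rw [← integral_smul]
        exact setIntegral_congr_fun measurableSet_Ioo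
          fun s hs => (integral_abelKernel_smul_deriv hρ.2 h hs).symm
    _ = ∫ r in Ioo 0 t, ∫ s in Ioo 0 t, abelKernel ρ t s r • deriv h r :=
        integral_integral_swap (integrable_abelKernel_smul hρ (hh.integrableOn_deriv ht.2))
    _ = ∫ r in Ioo 0 t, (Real.Gamma (1 - ρ) * Real.Gamma ρ) • deriv h r :=
        setIntegral_congr_fun measurableSet_Ioo fun r hr => by
          simp only [integral_smul_const, integral_abelKernel hρ hr]
    _ = Real.Gamma (1 - ρ) • Real.Gamma ρ • (h t - h 0) := by
        rw [integral_smul, hh.integral_deriv ht, mul_smul]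

end Abel

section FractionalLIntegral

variable {ρ μ T : ℝ} {F : ℝ → ℝ≥0∞}

/-- The fractional integral of order `ρ` of a nonnegative function, without the factor `Γ(ρ)⁻¹`. -/
def fractionalLIntegral (ρ : ℝ) (F : ℝ → ℝ≥0∞) (t : ℝ) : ℝ≥0∞ :=
  ∫⁻ s in Ioo 0 t, ENNReal.ofReal ((t - s) ^ (ρ - 1)) * F s

lemma measurable_fractionalLIntegral (ρ : ℝ) (hF : Measurable F) :
    Measurable (fractionalLIntegral ρ F) := by
  have hindicator : fractionalLIntegral ρ F = fun t =>
      ∫⁻ s, {p : ℝ × ℝ | 0 < p.2 ∧ p.2 < p.1}.indicator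
        (fun p => ENNReal.ofReal ((p.1 - p.2) ^ (ρ - 1)) * F p.2) (t, s) := by
    ext t
    rw [fractionalLIntegral, ← lintegral_indicator measurableSet_Ioo]
    rfl
  rw [hindicator]
  exact Measurable.lintegral_prod_right' (((ENNReal.measurable_ofReal.comp
    ((measurable_fst.sub measurable_snd).pow_const _)).mul (hF.comp measurable_snd)).indicator
    ((measurableSet_lt measurable_const measurable_snd).inter
      (measurableSet_lt measurable_snd measurable_fst)))

/-- The weighted Abel kernel `e^{-μ u} u^{ρ - 1}` on `u > 0`, extended by zero. -/
def expAbelKernel (ρ μ u : ℝ) : ℝ≥0∞ :=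
  (Ioi 0).indicator (fun u => ENNReal.ofReal (Real.exp (-(μ * u)) * u ^ (ρ - 1))) u

@[fun_prop]
lemma measurable_expAbelKernel (ρ μ : ℝ) : Measurable (expAbelKernel ρ μ) :=
  (ENNReal.measurable_ofReal.comp ((by fun_prop : Measurable fun u : ℝ => Real.exp (-(μ * u))).mul
    (measurable_id.pow_const _))).indicator measurableSet_Ioi

lemma lintegral_expAbelKernel (hρ : 0 < ρ) (hμ : 0 < μ) :
    ∫⁻ u, expAbelKernel ρ μ u = ENNReal.ofReal (μ ^ (-ρ) * Real.Gamma ρ) := by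
  have hGamma := Real.integral_rpow_mul_exp_neg_mul_Ioi hρ hμ
  simp_rw [mul_comm (_ ^ (ρ - 1))] at hGamma
  have hnonneg : 0 ≤ᵐ[volume.restrict (Ioi 0)]
      fun u : ℝ => Real.exp (-(μ * u)) * u ^ (ρ - 1) := by
    filter_upwards [ae_restrict_mem measurableSet_Ioi] with u hu
    exact mul_nonneg (Real.exp_pos _).le (Real.rpow_nonneg (le_of_lt hu) _)
  simp only [expAbelKernel]
  rw [lintegral_indicator measurableSet_Ioi,
    ← ofReal_integral_eq_lintegral_ofReal (integrableOn_exp_mul_rpow hμ hρ) hnonneg, hGamma,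
    one_div, Real.inv_rpow hμ.le, ← Real.rpow_neg hμ.le]

lemma exp_mul_rpow_eq_expAbelKernel_mul (ρ μ : ℝ) {s t : ℝ} (hst : s < t) :
    ENNReal.ofReal (Real.exp (-(μ * t))) * ENNReal.ofReal ((t - s) ^ (ρ - 1)) =
      expAbelKernel ρ μ (t - s) * ENNReal.ofReal (Real.exp (-(μ * s))) := by
  have hpos : 0 < t - s := sub_pos.2 hst
  have hexp : Real.exp (-(μ * t)) = Real.exp (-(μ * (t - s))) * Real.exp (-(μ * s)) := by
    rw [← Real.exp_add]; ring_nf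
  rw [expAbelKernel, indicator_of_mem (mem_Ioi.2 hpos), ← ENNReal.ofReal_mul (by positivity),
    ← ENNReal.ofReal_mul (by positivity), hexp, mul_right_comm]

/- After the exponential weight is distributed, the fractional integral is a convolution. Its norm
on `L¹` is at most the mass of the weighted kernel, which is small for large `μ`. -/
lemma lintegral_exp_mul_fractionalLIntegral_le (hρ : 0 < ρ) (hμ : 0 < μ) (T : ℝ)
    (hF : Measurable F) :
    ∫⁻ t in Ioc 0 T, ENNReal.ofReal (Real.exp (-(μ * t))) * fractionalLIntegral ρ F t ≤
      ENNReal.ofReal (μ ^ (-ρ) * Real.Gamma ρ) *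
        ∫⁻ s in Ioc 0 T, ENNReal.ofReal (Real.exp (-(μ * s))) * F s := by
  have hweighted : Measurable fun s => ENNReal.ofReal (Real.exp (-(μ * s))) * F s :=
    (ENNReal.measurable_ofReal.comp (by fun_prop)).mul hF
  have hconv : ∀ t ∈ Ioc 0 T, ENNReal.ofReal (Real.exp (-(μ * t))) * fractionalLIntegral ρ F t ≤
      ∫⁻ s in Ioc 0 T,
        expAbelKernel ρ μ (t - s) * (ENNReal.ofReal (Real.exp (-(μ * s))) * F s) := fun t ht => by
    rw [fractionalLIntegral, ← lintegral_const_mul' _ _ ENNReal.ofReal_ne_top]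
    refine (setLIntegral_congr_fun measurableSet_Ioo fun s hs => ?_).trans_le
      (lintegral_mono_set (Ioo_subset_Ioc_self.trans (Ioc_subset_Ioc_right ht.2)))
    simp only [← mul_assoc, exp_mul_rpow_eq_expAbelKernel_mul ρ μ hs.2]
  calc _ ≤ ∫⁻ t in Ioc 0 T, ∫⁻ s in Ioc 0 T,
        expAbelKernel ρ μ (t - s) * (ENNReal.ofReal (Real.exp (-(μ * s))) * F s) :=
        setLIntegral_mono' measurableSet_Ioc hconv
    _ ≤ ∫⁻ t, ∫⁻ s in Ioc 0 T,
        expAbelKernel ρ μ (t - s) * (ENNReal.ofReal (Real.exp (-(μ * s))) * F s) :=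
        setLIntegral_le_lintegral _ _
    _ = ∫⁻ s in Ioc 0 T, ∫⁻ t,
        expAbelKernel ρ μ (t - s) * (ENNReal.ofReal (Real.exp (-(μ * s))) * F s) :=
        lintegral_lintegral_swap (((measurable_expAbelKernel ρ μ).comp
          (measurable_fst.sub measurable_snd)).mul (hweighted.comp measurable_snd)).aemeasurable
    _ = ∫⁻ s in Ioc 0 T, ENNReal.ofReal (μ ^ (-ρ) * Real.Gamma ρ) *
        (ENNReal.ofReal (Real.exp (-(μ * s))) * F s) := lintegral_congr fun s => by
        rw [lintegral_mul_const _ (by fun_prop), lintegral_sub_right_eq_self,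
          lintegral_expAbelKernel hρ hμ]
    _ = _ := lintegral_const_mul _ hweighted

lemma ae_fractionalLIntegral_lt_top (hρ : 0 < ρ) (hF : Measurable F)
    (hfin : ∫⁻ t in Ioc 0 T, F t < ∞) :
    ∀ᵐ t ∂volume.restrict (Ioc 0 T), fractionalLIntegral ρ F t < ∞ := by
  have hexp : Measurable fun t : ℝ => ENNReal.ofReal (Real.exp (-(1 * t))) :=
    ENNReal.measurable_ofReal.comp (by fun_prop)
  have hright : ∫⁻ t in Ioc 0 T, ENNReal.ofReal (Real.exp (-(1 * t))) * F t < ∞ :=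
    (setLIntegral_mono' measurableSet_Ioc fun t ht => mul_le_of_le_one_left' <| by
      rw [ENNReal.ofReal_le_one, Real.exp_le_one_iff]
      linarith [ht.1]).trans_lt hfin
  have hleft := (lintegral_exp_mul_fractionalLIntegral_le hρ one_pos T hF).trans_lt
    (ENNReal.mul_lt_top ENNReal.ofReal_lt_top hright)
  filter_upwards [ae_lt_top' (hexp.mul (measurable_fractionalLIntegral ρ hF)).aemeasurable hleft.ne]
    with t ht
  exact ENNReal.lt_top_of_mul_ne_top_right ht.ne (ENNReal.ofReal_pos.2 (Real.exp_pos _)).ne'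

end FractionalLIntegral

section Pairing

variable {V : Type*} [NormedAddCommGroup V] [InnerProductSpace ℝ V] [FiniteDimensional ℝ V]
  [MeasurableSpace V] [BorelSpace V] {ρ μ T t : ℝ} {W : V → ℝ → ℂ} {b : V →₂[volume] ℂ}

/-- The `L²` pairing of `W(·, t)` with the inverse Fourier transform of `b`. It reads off the
frequencies of `W(·, t)`, and, as an integral over space, it commutes with integrals in time. -/
def pairing (W : V → ℝ → ℂ) (b : V →₂[volume] ℂ) (t : ℝ) : ℂ :=
  ∫ x, inner ℂ ((𝓕⁻ b : V →₂[volume] ℂ) x) (W x t)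

lemma pairing_eq_inner_fourier (b : V →₂[volume] ℂ) (hW : MemLp (fun x => W x t) 2) :
    pairing W b t = inner ℂ b (𝓕 (hW.toLp _)) := by
  have hplancherel : inner ℂ b (𝓕 (hW.toLp _)) =
      inner ℂ (𝓕⁻ b : V →₂[volume] ℂ) (hW.toLp _) := by
    rw [← Lp.inner_fourier_eq (𝓕⁻ b), FourierTransform.fourier_fourierInv_eq]
  rw [hplancherel, L2.inner_def, pairing]
  refine integral_congr_ae ?_
  filter_upwards [hW.coeFn_toLp] with x hx
  rw [hx]

lemma stronglyMeasurable_inner_fst (hW : Measurable fun p : V × ℝ => W p.1 p.2)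
    (b : V →₂[volume] ℂ) :
    StronglyMeasurable fun p : V × ℝ => inner ℂ (b p.1) (W p.1 p.2) :=
  ((Lp.stronglyMeasurable b).comp_measurable measurable_fst).inner hW.stronglyMeasurable

lemma measurable_pairing (hW : Measurable fun p : V × ℝ => W p.1 p.2) (b : V →₂[volume] ℂ) :
    Measurable (pairing W b) :=
  (stronglyMeasurable_inner_fst hW (𝓕⁻ b)).integral_prod_left'.measurable

lemma measurable_eLpNorm_two (hW : Measurable fun p : V × ℝ => W p.1 p.2) :
    Measurable fun t => eLpNorm (fun x => W x t) 2 := by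
  simp_rw [eLpNorm_eq_lintegral_rpow_enorm_toReal two_ne_zero ENNReal.ofNat_ne_top]
  exact (Measurable.lintegral_prod_left' (f := fun p : V × ℝ => ‖W p.1 p.2‖ₑ ^ (2 : ℝ≥0∞).toReal)
    (hW.enorm.pow_const _)).pow_const _

lemma lintegral_enorm_inner_le {f g : V → ℂ} (hf : AEStronglyMeasurable f)
    (hg : AEStronglyMeasurable g) :
    ∫⁻ x, ‖inner ℂ (f x) (g x)‖ₑ ≤ eLpNorm f 2 * eLpNorm g 2 := by
  have hHolder := eLpNorm_le_eLpNorm_mul_eLpNorm'_of_norm (p := 2) (q := 2) (r := 1) hf hg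
    (fun z w : ℂ => inner ℂ z w) 1
    (Eventually.of_forall fun x => by simpa using norm_inner_le_norm (𝕜 := ℂ) (f x) (g x))
  simpa only [eLpNorm_one_eq_lintegral_enorm, ENNReal.coe_one, one_mul] using hHolder

lemma lintegral_enorm_inner_slice_le (hW : Measurable fun p : V × ℝ => W p.1 p.2)
    (b : V →₂[volume] ℂ) (t : ℝ) :
    ∫⁻ x, ‖inner ℂ (b x) (W x t)‖ₑ ≤ ‖b‖ₑ * eLpNorm (fun x => W x t) 2 := by
  rw [Lp.enorm_def]
  exact lintegral_enorm_inner_le (Lp.aestronglyMeasurable b)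
    (hW.comp (measurable_prodMk_right (y := t))).aestronglyMeasurable

lemma enorm_fourierInv (b : V →₂[volume] ℂ) : ‖(𝓕⁻ b : V →₂[volume] ℂ)‖ₑ = ‖b‖ₑ := by
  rw [enorm_eq_iff_norm_eq, ← Lp.norm_fourier_eq, FourierTransform.fourier_fourierInv_eq]

lemma enorm_pairing_le (hW : Measurable fun p : V × ℝ => W p.1 p.2) (b : V →₂[volume] ℂ)
    (t : ℝ) : ‖pairing W b t‖ₑ ≤ ‖b‖ₑ * eLpNorm (fun x => W x t) 2 := by
  rw [← enorm_fourierInv b]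
  exact (enorm_integral_le_lintegral_enorm _).trans (lintegral_enorm_inner_slice_le hW _ t)

lemma integrable_rpow_smul_inner (hW : Measurable fun p : V × ℝ => W p.1 p.2)
    (ht : fractionalLIntegral ρ (fun s => eLpNorm (fun x => W x s) 2) t < ∞) :
    Integrable (fun p : V × ℝ => ((t - p.2) ^ (ρ - 1) : ℝ) • inner ℂ (b p.1) (W p.1 p.2))
      (volume.prod (volume.restrict (Ioo 0 t))) := by
  have hmeas : StronglyMeasurable fun p : V × ℝ =>
      ((t - p.2) ^ (ρ - 1) : ℝ) • inner ℂ (b p.1) (W p.1 p.2) :=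
    ((measurable_const.sub measurable_snd).pow_const _).stronglyMeasurable.smul
      (stronglyMeasurable_inner_fst hW b)
  have hslice : ∀ s ∈ Ioo 0 t,
      ∫⁻ x, ‖((t - s) ^ (ρ - 1) : ℝ) • inner ℂ (b x) (W x s)‖ₑ ≤
        ‖b‖ₑ * (ENNReal.ofReal ((t - s) ^ (ρ - 1)) * eLpNorm (fun x => W x s) 2) := by
    intro s hs
    simp_rw [enorm_smul, Real.enorm_of_nonneg (Real.rpow_nonneg (sub_nonneg.2 hs.2.le) (ρ - 1))]
    rw [lintegral_const_mul' _ _ ENNReal.ofReal_ne_top, mul_left_comm]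
    gcongr
    exact lintegral_enorm_inner_slice_le hW b s
  refine ⟨hmeas.aestronglyMeasurable, ?_⟩
  rw [HasFiniteIntegral, lintegral_prod_symm _ hmeas.enorm.aemeasurable]
  refine (setLIntegral_mono' measurableSet_Ioo hslice).trans_lt ?_
  rw [lintegral_const_mul' _ _ enorm_ne_top]
  exact ENNReal.mul_lt_top enorm_lt_top ht

lemma pairing_fractionalIntegral (hW : Measurable fun p : V × ℝ => W p.1 p.2)
    (b : V →₂[volume] ℂ)
    (ht : fractionalLIntegral ρ (fun s => eLpNorm (fun x => W x s) 2) t < ∞) :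
    pairing (fun x t => ∫ s in Ioo 0 t, ((t - s) ^ (ρ - 1) : ℝ) • W x s) b t =
      ∫ s in Ioo 0 t, ((t - s) ^ (ρ - 1) : ℝ) • pairing W b s := by
  simp_rw [pairing, ← integral_smul]
  rw [← integral_integral_swap (integrable_rpow_smul_inner hW ht)]
  refine integral_congr_ae (Eventually.of_forall fun x => ?_)
  simp only [RCLike.inner_apply]
  rw [← integral_mul_const]
  simp only [smul_mul_assoc]

lemma enorm_fractionalIntegral_le (ρ : ℝ) (h : ℝ → ℂ) (t : ℝ) :
    ‖∫ s in Ioo 0 t, ((t - s) ^ (ρ - 1) : ℝ) • h s‖ₑ ≤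
      fractionalLIntegral ρ (fun s => ‖h s‖ₑ) t := by
  refine (enorm_integral_le_lintegral_enorm _).trans
    (setLIntegral_mono' measurableSet_Ioo fun s hs => ?_)
  rw [enorm_smul, Real.enorm_of_nonneg (Real.rpow_nonneg (sub_nonneg.2 hs.2.le) _)]

/-- The norm of `pairing W b` in `L¹(0, T)` with the weight `e^{-μ t}`. -/
def weightedPairing (μ T : ℝ) (W : V → ℝ → ℂ) (b : V →₂[volume] ℂ) : ℝ≥0∞ :=
  ∫⁻ t in Ioc 0 T, ENNReal.ofReal (Real.exp (-(μ * t))) * ‖pairing W b t‖ₑ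

lemma weightedPairing_le (hμ : 0 ≤ μ) (T : ℝ) (hW : Measurable fun p : V × ℝ => W p.1 p.2)
    (b : V →₂[volume] ℂ) :
    weightedPairing μ T W b ≤ ‖b‖ₑ * ∫⁻ t in Ioc 0 T, eLpNorm (fun x => W x t) 2 := by
  rw [weightedPairing, ← lintegral_const_mul' _ _ enorm_ne_top]
  refine setLIntegral_mono' measurableSet_Ioc fun t ht => ?_
  have hweight : ENNReal.ofReal (Real.exp (-(μ * t))) ≤ 1 :=
    ENNReal.ofReal_le_one.2 (Real.exp_le_one_iff.2 (neg_nonpos.2 (mul_nonneg hμ ht.1.le)))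
  exact (mul_le_of_le_one_left' hweight).trans (enorm_pairing_le hW b t)

lemma ae_pairing_eq_zero_of_weightedPairing (hW : Measurable fun p : V × ℝ => W p.1 p.2)
    (h : weightedPairing μ T W b = 0) : ∀ᵐ t ∂volume.restrict (Ioc 0 T), pairing W b t = 0 := by
  have hweight : Measurable fun t : ℝ => ENNReal.ofReal (Real.exp (-(μ * t))) :=
    ENNReal.measurable_ofReal.comp (by fun_prop)
  have hzero := (lintegral_eq_zero_iff (hweight.mul (measurable_pairing hW b).enorm)).1 h
  filter_upwards [hzero] with t ht
  simpa [(Real.exp_pos (-(μ * t))).not_ge] using ht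

end Pairing

section BandLimited

variable {X : Type*} {R : ℝ} {m : X → ℝ}

/-- The power `m ^ n` of a multiplier, cut off to the band `|m| ≤ R` on which it is bounded. -/
def bandMultiplier (m : X → ℝ) (R : ℝ) (n : ℕ) : X → ℝ :=
  {η | |m η| ≤ R}.indicator fun η => m η ^ n

lemma bandMultiplier_succ (m : X → ℝ) (R : ℝ) (n : ℕ) (η : X) :
    bandMultiplier m R (n + 1) η = m η * bandMultiplier m R n η := by
  by_cases h : η ∈ {η | |m η| ≤ R}
  · simp only [bandMultiplier, indicator_of_mem h, pow_succ']
  · simp only [bandMultiplier, indicator_of_notMem h, mul_zero]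

lemma norm_bandMultiplier_le (m : X → ℝ) (hR : 0 ≤ R) (n : ℕ) (η : X) :
    ‖bandMultiplier m R n η‖ ≤ R ^ n := by
  by_cases h : η ∈ {η | |m η| ≤ R}
  · rw [bandMultiplier, indicator_of_mem h, norm_pow]
    exact pow_le_pow_left₀ (norm_nonneg _) h n
  · rw [bandMultiplier, indicator_of_notMem h, norm_zero]
    positivity

lemma norm_bandMultiplier_mul_le (m : X → ℝ) (hR : 0 ≤ R) (n : ℕ) (η : X) (z : ℂ) :
    ‖(bandMultiplier m R n η : ℂ) * z‖ ≤ R ^ n * ‖z‖ := by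
  rw [norm_mul, Complex.norm_real]
  gcongr
  exact norm_bandMultiplier_le m hR n η

variable [MeasurableSpace X] {ν : Measure X}

lemma measurable_bandMultiplier (hm : Measurable m) (R : ℝ) (n : ℕ) :
    Measurable (bandMultiplier m R n) :=
  (hm.pow_const n).indicator (measurableSet_le hm.norm measurable_const)

lemma memLp_bandMultiplier_mul (hm : Measurable m) (hR : 0 ≤ R) (n : ℕ) (β : X →₂[ν] ℂ) :
    MemLp (fun η => (bandMultiplier m R n η : ℂ) * β η) 2 ν :=
  (Lp.memLp β).of_le_mul ((Complex.measurable_ofReal.comp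
      (measurable_bandMultiplier hm R n)).aestronglyMeasurable.mul (Lp.aestronglyMeasurable β))
    (Eventually.of_forall fun η => norm_bandMultiplier_mul_le m hR n η (β η))

/-- The product of `bandMultiplier m R n` with a square-integrable function. -/
def bandLimited (hm : Measurable m) (hR : 0 ≤ R) (n : ℕ) (β : X →₂[ν] ℂ) : X →₂[ν] ℂ :=
  (memLp_bandMultiplier_mul hm hR n β).toLp _

lemma coeFn_bandLimited (hm : Measurable m) (hR : 0 ≤ R) (n : ℕ) (β : X →₂[ν] ℂ) :
    bandLimited hm hR n β =ᵐ[ν] fun η => (bandMultiplier m R n η : ℂ) * β η :=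
  MemLp.coeFn_toLp _

lemma bandLimited_succ (hm : Measurable m) (hR : 0 ≤ R) (n : ℕ) (β : X →₂[ν] ℂ) :
    bandLimited hm hR (n + 1) β =ᵐ[ν] fun η => (m η : ℂ) * bandLimited hm hR n β η := by
  filter_upwards [coeFn_bandLimited hm hR n β, coeFn_bandLimited hm hR (n + 1) β] with η hn hsucc
  rw [hn, hsucc, bandMultiplier_succ, Complex.ofReal_mul, mul_assoc]

lemma enorm_bandLimited_le (hm : Measurable m) (hR : 0 ≤ R) (n : ℕ) (β : X →₂[ν] ℂ) :
    ‖bandLimited hm hR n β‖ₑ ≤ ENNReal.ofReal (R ^ n) * ‖β‖ₑ := by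
  rw [bandLimited, Lp.enorm_toLp, Lp.enorm_def]
  exact eLpNorm_le_mul_eLpNorm_of_ae_le_mul
    (Eventually.of_forall fun η => norm_bandMultiplier_mul_le m hR n η (β η)) 2

lemma inner_bandLimited_left (hm : Measurable m) (hR : 0 ≤ R) (n : ℕ) (β γ : X →₂[ν] ℂ) :
    inner ℂ (bandLimited hm hR n β) γ = inner ℂ β (bandLimited hm hR n γ) := by
  rw [L2.inner_def, L2.inner_def]
  refine integral_congr_ae ?_
  filter_upwards [coeFn_bandLimited hm hR n β, coeFn_bandLimited hm hR n γ] with η hβ hγ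
  rw [hβ, hγ]
  simp only [RCLike.inner_apply, map_mul, Complex.conj_ofReal]
  ring

lemma eq_zero_of_bandLimited_eq_zero (hm : Measurable m) {γ : X →₂[ν] ℂ}
    (h : ∀ k : ℕ, bandLimited hm k.cast_add_one_pos.le 0 γ = 0) : γ = 0 := by
  refine (Lp.eq_zero_iff_ae_eq_zero).2 ?_
  have hband : ∀ k : ℕ, ∀ᵐ η ∂ν, (bandMultiplier m (k + 1) 0 η : ℂ) * γ η = 0 := fun k => by
    filter_upwards [coeFn_bandLimited hm k.cast_add_one_pos.le 0 γ,
      (Lp.eq_zero_iff_ae_eq_zero).1 (h k)] with η hmul hzero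
    rw [← hmul, hzero, Pi.zero_apply]
  filter_upwards [ae_all_iff.2 hband] with η hη
  obtain ⟨k, hk⟩ := exists_nat_ge |m η|
  have hmem : η ∈ {η | |m η| ≤ (k : ℝ) + 1} := hk.trans (lt_add_one _).le
  simpa only [bandMultiplier, indicator_of_mem hmem, pow_zero, Complex.ofReal_one, one_mul,
    Pi.zero_apply] using hη k

end BandLimited

section HomogeneousPair

variable {V : Type*} [NormedAddCommGroup V] [InnerProductSpace ℝ V] [FiniteDimensional ℝ V]
  [MeasurableSpace V] [BorelSpace V] {ρ μ R T t : ℝ} {m : V → ℝ} {u W : V → ℝ → ℂ}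
  {b b' : V →₂[volume] ℂ}

/-- `W` is the image of `u` under the Fourier multiplier `m`, it has finite `L¹(0, T; L²)` norm, and
`-u` is the fractional integral of `W` in time. For a solution with zero initial function this holds
with `W = Â^σ u`: it is the equation after Abel inversion. -/
structure IsHomogeneousPair (ρ T : ℝ) (m : V → ℝ) (u W : V → ℝ → ℂ) : Prop where
  measurable : Measurable fun p : V × ℝ => W p.1 p.2
  memLp_left : ∀ t ∈ Ioc 0 T, MemLp (fun x => u x t) 2
  memLp_right : ∀ t ∈ Ioc 0 T, MemLp (fun x => W x t) 2
  fourier_eq : ∀ t (ht : t ∈ Ioc 0 T),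
    (𝓕 ((memLp_right t ht).toLp _) : V →₂[volume] ℂ) =ᵐ[volume]
      fun η => (m η : ℂ) * (𝓕 ((memLp_left t ht).toLp _) : V →₂[volume] ℂ) η
  lintegral_lt_top : ∫⁻ t in Ioc 0 T, eLpNorm (fun x => W x t) 2 < ∞
  eq_integral : ∀ x, ∀ t ∈ Ioc 0 T,
    u x t = -(((Real.Gamma ρ)⁻¹ : ℝ) • ∫ s in Ioo 0 t, ((t - s) ^ (ρ - 1) : ℝ) • W x s)

namespace IsHomogeneousPair

lemma pairing_eq (H : IsHomogeneousPair ρ T m u W)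
    (hb : b' =ᵐ[volume] fun η => (m η : ℂ) * b η) (ht : t ∈ Ioc 0 T) :
    pairing W b t = pairing u b' t := by
  rw [pairing_eq_inner_fourier b (H.memLp_right t ht),
    pairing_eq_inner_fourier b' (H.memLp_left t ht), L2.inner_def, L2.inner_def]
  refine integral_congr_ae ?_
  filter_upwards [hb, H.fourier_eq t ht] with η hη hfourier
  rw [hη, hfourier]
  simp only [RCLike.inner_apply, map_mul, Complex.conj_ofReal]
  ring

lemma enorm_pairing_le (H : IsHomogeneousPair ρ T m u W) (hρ : 0 < ρ)
    (hb : b' =ᵐ[volume] fun η => (m η : ℂ) * b η) (ht : t ∈ Ioc 0 T)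
    (hfin : fractionalLIntegral ρ (fun s => eLpNorm (fun x => W x s) 2) t < ∞) :
    ‖pairing W b t‖ₑ ≤ ENNReal.ofReal (Real.Gamma ρ)⁻¹ *
      fractionalLIntegral ρ (fun s => ‖pairing W b' s‖ₑ) t := by
  have hpairing : pairing W b t = -(((Real.Gamma ρ)⁻¹ : ℝ) •
      pairing (fun x t => ∫ s in Ioo 0 t, ((t - s) ^ (ρ - 1) : ℝ) • W x s) b' t) := by
    rw [H.pairing_eq hb ht, pairing, pairing, ← integral_smul, ← integral_neg]
    refine integral_congr_ae (Eventually.of_forall fun x => ?_)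
    simp only [H.eq_integral x t ht, RCLike.inner_apply]
    rw [neg_mul, smul_mul_assoc]
  rw [hpairing, pairing_fractionalIntegral H.measurable b' hfin, enorm_neg, enorm_smul,
    Real.enorm_of_nonneg (inv_nonneg.2 (Real.Gamma_pos_of_pos hρ).le)]
  gcongr
  exact enorm_fractionalIntegral_le ρ _ t

lemma weightedPairing_le_mul (H : IsHomogeneousPair ρ T m u W) (hρ : 0 < ρ) (hμ : 0 < μ)
    (hb : b' =ᵐ[volume] fun η => (m η : ℂ) * b η) :
    weightedPairing μ T W b ≤ ENNReal.ofReal (μ ^ (-ρ)) * weightedPairing μ T W b' := by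
  have hGamma := Real.Gamma_pos_of_pos hρ
  calc weightedPairing μ T W b
      ≤ ∫⁻ t in Ioc 0 T, ENNReal.ofReal (Real.Gamma ρ)⁻¹ *
        (ENNReal.ofReal (Real.exp (-(μ * t))) *
          fractionalLIntegral ρ (fun s => ‖pairing W b' s‖ₑ) t) := by
        refine lintegral_mono_ae ?_
        filter_upwards [ae_fractionalLIntegral_lt_top hρ (measurable_eLpNorm_two H.measurable)
          H.lintegral_lt_top, ae_restrict_mem measurableSet_Ioc] with t hfin ht
        rw [mul_left_comm]
        gcongr
        exact H.enorm_pairing_le hρ hb ht hfin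
    _ ≤ ENNReal.ofReal (Real.Gamma ρ)⁻¹ *
        (ENNReal.ofReal (μ ^ (-ρ) * Real.Gamma ρ) * weightedPairing μ T W b') := by
        rw [lintegral_const_mul' _ _ ENNReal.ofReal_ne_top]
        gcongr
        exact lintegral_exp_mul_fractionalLIntegral_le hρ hμ T
          (measurable_pairing H.measurable b').enorm
    _ = ENNReal.ofReal (μ ^ (-ρ)) * weightedPairing μ T W b' := by
        rw [← mul_assoc, ← ENNReal.ofReal_mul (inv_nonneg.2 hGamma.le), mul_comm (μ ^ (-ρ)),
          inv_mul_cancel_left₀ hGamma.ne']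

lemma weightedPairing_le_pow_mul (H : IsHomogeneousPair ρ T m u W) (hρ : 0 < ρ) (hμ : 0 < μ)
    {b : ℕ → V →₂[volume] ℂ}
    (hb : ∀ n, b (n + 1) =ᵐ[volume] fun η => (m η : ℂ) * b n η) (n : ℕ) :
    weightedPairing μ T W (b 0) ≤ ENNReal.ofReal (μ ^ (-ρ)) ^ n * weightedPairing μ T W (b n) := by
  induction n with
  | zero => rw [pow_zero, one_mul]
  | succ n ih =>
    refine ih.trans ?_
    rw [pow_succ, mul_assoc]
    gcongr
    exact H.weightedPairing_le_mul hρ hμ (hb n)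

lemma weightedPairing_le_two_inv_pow (H : IsHomogeneousPair ρ T m u W) (hρ : 0 < ρ) (hR : 0 < R)
    {b : ℕ → V →₂[volume] ℂ} {K : ℝ≥0∞}
    (hb : ∀ n, b (n + 1) =ᵐ[volume] fun η => (m η : ℂ) * b n η)
    (hbK : ∀ n, ‖b n‖ₑ ≤ ENNReal.ofReal (R ^ n) * K) (n : ℕ) :
    weightedPairing ((2 * R) ^ (1 / ρ)) T W (b 0) ≤
      ENNReal.ofReal 2⁻¹ ^ n * (K * ∫⁻ t in Ioc 0 T, eLpNorm (fun x => W x t) 2) := by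
  have hμ : 0 < (2 * R) ^ (1 / ρ) := by positivity
  have hμ_rpow : ((2 * R) ^ (1 / ρ)) ^ (-ρ) = (2 * R)⁻¹ := by
    rw [← Real.rpow_mul (by positivity), mul_neg, one_div_mul_cancel hρ.ne', Real.rpow_neg_one]
  have hfactor : ENNReal.ofReal (2 * R)⁻¹ ^ n * ENNReal.ofReal (R ^ n) =
      ENNReal.ofReal 2⁻¹ ^ n := by
    rw [ENNReal.ofReal_pow hR.le, ← mul_pow, ← ENNReal.ofReal_mul (by positivity), mul_inv,
      inv_mul_cancel_right₀ hR.ne']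
  have hn : weightedPairing ((2 * R) ^ (1 / ρ)) T W (b n) ≤
      ENNReal.ofReal (R ^ n) * (K * ∫⁻ t in Ioc 0 T, eLpNorm (fun x => W x t) 2) := by
    rw [← mul_assoc]
    refine (weightedPairing_le hμ.le T H.measurable (b n)).trans ?_
    gcongr
    exact hbK n
  refine (H.weightedPairing_le_pow_mul hρ hμ hb n).trans ?_
  rw [hμ_rpow, ← hfactor, mul_assoc]
  gcongr

/- Each application of the multiplier costs a factor `R` on the band and gains `μ ^ (-ρ)` from the
fractional integral, so with `μ ^ ρ = 2 R` the pairing is at most `2⁻ⁿ` times a constant. -/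
lemma ae_pairing_bandLimited_eq_zero (H : IsHomogeneousPair ρ T m u W) (hρ : 0 < ρ)
    (hm : Measurable m) (hR : 0 < R) (β : V →₂[volume] ℂ) :
    ∀ᵐ t ∂volume.restrict (Ioc 0 T), pairing W (bandLimited hm hR.le 0 β) t = 0 := by
  have hbound := H.weightedPairing_le_two_inv_pow hρ hR (bandLimited_succ hm hR.le · β)
    (enorm_bandLimited_le hm hR.le · β)
  have hlim : Tendsto (fun n : ℕ => ENNReal.ofReal 2⁻¹ ^ n *
      (‖β‖ₑ * ∫⁻ t in Ioc 0 T, eLpNorm (fun x => W x t) 2)) atTop (𝓝 0) := by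
    simpa only [zero_mul] using ENNReal.Tendsto.mul_const
      (ENNReal.tendsto_pow_atTop_nhds_zero_of_lt_one (ENNReal.ofReal_lt_one.2 (by norm_num)))
      (Or.inr (ENNReal.mul_ne_top enorm_ne_top H.lintegral_lt_top.ne))
  exact ae_pairing_eq_zero_of_weightedPairing H.measurable
    (le_antisymm (ge_of_tendsto' hlim hbound) zero_le)

theorem ae_eq_zero (H : IsHomogeneousPair ρ T m u W) (hρ : 0 < ρ) (hm : Measurable m) :
    ∀ᵐ t ∂volume.restrict (Ioc 0 T), (fun x => W x t) =ᵐ[volume] 0 := by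
  have : Fact ((2 : ℝ≥0∞) ≠ ⊤) := ⟨ENNReal.ofNat_ne_top⟩
  have hpairing : ∀ᵐ t ∂volume.restrict (Ioc 0 T), ∀ k j : ℕ, pairing W
      (bandLimited hm k.cast_add_one_pos.le 0 (TopologicalSpace.denseSeq (V →₂[volume] ℂ) j)) t =
        0 :=
    ae_all_iff.2 fun k => ae_all_iff.2 fun j =>
      H.ae_pairing_bandLimited_eq_zero hρ hm k.cast_add_one_pos _
  filter_upwards [hpairing, ae_restrict_mem measurableSet_Ioc] with t hzero ht
  have hW := H.memLp_right t ht
  have hfourier : 𝓕 (hW.toLp _) = 0 := eq_zero_of_bandLimited_eq_zero hm fun k =>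
    (TopologicalSpace.denseRange_denseSeq (V →₂[volume] ℂ)).eq_zero_of_inner_right ℂ fun j => by
      rw [← inner_bandLimited_left, ← pairing_eq_inner_fourier, hzero k j]
  have hLp : hW.toLp _ = 0 := by
    rw [← norm_eq_zero, ← Lp.norm_fourier_eq, hfourier, norm_zero]
  exact hW.coeFn_toLp.symm.trans ((Lp.eq_zero_iff_ae_eq_zero).1 hLp)

end IsHomogeneousPair

end HomogeneousPair

section Linearity

variable {N : ℕ} {A : MvPolynomial (Fin N) ℝ} {ρ σ T t : ℝ} {h h' : ℝ → ℂ}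
  {f g f' g' φ φ' : EuclideanSpace ℝ (Fin N) → ℂ} {v v' w : EuclideanSpace ℝ (Fin N) → ℝ → ℂ}

lemma hat_sub (hf : MemLp f 2) (hf' : MemLp f' 2) : hat (f - f') =ᵐ[volume] hat f - hat f' := by
  have hcoe := (Measure.quasiMeasurePreserving_smul
    (volume : Measure (EuclideanSpace ℝ (Fin N))) (r := (2 * π)⁻¹) (by positivity)).ae_eq_comp
    (Lp.coeFn_sub (𝓕 (hf.toLp f) : Lp ℂ 2 volume) (𝓕 (hf'.toLp f')))
  filter_upwards [hcoe] with ξ hξ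
  simp only [Function.comp_apply, Pi.sub_apply] at hξ
  rw [hat_of_memLp (hf.sub hf'), Pi.sub_apply, hat_of_memLp hf, hat_of_memLp hf',
    MemLp.toLp_sub hf hf', sub_eq_add_neg, FourierTransform.fourier_add,
    FourierTransform.fourier_neg, ← sub_eq_add_neg, hξ, smul_sub]

lemma IsFractionalPower.sub (hg : IsFractionalPower A σ f g) (hg' : IsFractionalPower A σ f' g') :
    IsFractionalPower A σ (f - f') (g - g') := by
  refine ⟨hg.1.sub hg'.1, hg.2.1.sub hg'.2.1, ?_⟩
  filter_upwards [hat_sub hg.1 hg'.1, hat_sub hg.2.1 hg'.2.1, hg.2.2, hg'.2.2]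
    with ξ hsubf hsubg heq heq'
  rw [hsubf, hsubg, Pi.sub_apply, Pi.sub_apply, heq, heq', mul_sub]

lemma eqOn_deriv_sub (hh : HasCaputo ρ T h) (hh' : HasCaputo ρ T h') :
    EqOn (deriv (h - h')) (deriv h - deriv h') (Ioo 0 T) := fun t ht =>
  deriv_sub (hh.differentiableAt t ht) (hh'.differentiableAt t ht)

lemma eqOn_kernel_smul_deriv_sub (hh : HasCaputo ρ T h) (hh' : HasCaputo ρ T h') (ht : t ≤ T) :
    EqOn (fun s => ((t - s) ^ (-ρ) : ℝ) • deriv (h - h') s)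
      (fun s => ((t - s) ^ (-ρ) : ℝ) • deriv h s - ((t - s) ^ (-ρ) : ℝ) • deriv h' s)
      (Ioo 0 t) := fun s hs => by
  simp only [eqOn_deriv_sub hh hh' ⟨hs.1, hs.2.trans_le ht⟩, Pi.sub_apply, smul_sub]

lemma HasCaputo.sub (hh : HasCaputo ρ T h) (hh' : HasCaputo ρ T h') : HasCaputo ρ T (h - h') where
  continuousOn := hh.continuousOn.sub hh'.continuousOn
  differentiableAt t ht := (hh.differentiableAt t ht).sub (hh'.differentiableAt t ht)
  integrable_deriv := (hh.integrable_deriv.sub hh'.integrable_deriv).congr_fun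
    (eqOn_deriv_sub hh hh').symm measurableSet_Ioo
  integrable_kernel t ht := ((hh.integrable_kernel t ht).sub (hh'.integrable_kernel t ht)).congr_fun
    (eqOn_kernel_smul_deriv_sub hh hh' ht.2).symm measurableSet_Ioo

lemma caputo_sub (hh : HasCaputo ρ T h) (hh' : HasCaputo ρ T h') (ht : t ∈ Ioc 0 T) :
    caputo ρ (h - h') t = caputo ρ h t - caputo ρ h' t := by
  simp only [caputo, intervalIntegral.integral_of_le ht.1.le, integral_Ioc_eq_integral_Ioo]
  rw [setIntegral_congr_fun measurableSet_Ioo (eqOn_kernel_smul_deriv_sub hh hh' ht.2),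
    integral_sub (hh.integrable_kernel t ht) (hh'.integrable_kernel t ht), smul_sub]

lemma measurable_indicator_Ioc (hw : ContinuousOn
      (fun p : EuclideanSpace ℝ (Fin N) × ℝ => w p.1 p.2) (univ ×ˢ Ioc 0 T)) :
    Measurable fun p : EuclideanSpace ℝ (Fin N) × ℝ => (Ioc 0 T).indicator (w p.1) p.2 := by
  classical
  have hpiecewise := ContinuousOn.measurable_piecewise hw (continuousOn_const (c := (0 : ℂ)))
    (MeasurableSet.univ.prod measurableSet_Ioc)
  convert hpiecewise using 1
  ext p
  simp [indicator_apply, piecewise]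

lemma aemeasurable_eLpNorm_two (hw : ContinuousOn
      (fun p : EuclideanSpace ℝ (Fin N) × ℝ => w p.1 p.2) (univ ×ˢ Ioc 0 T)) :
    AEMeasurable (fun t => eLpNorm (fun x => w x t) 2) (volume.restrict (Ioc 0 T)) := by
  refine (measurable_eLpNorm_two (W := fun x => (Ioc 0 T).indicator (w x))
    (measurable_indicator_Ioc hw)).aemeasurable.congr ?_
  filter_upwards [ae_restrict_mem measurableSet_Ioc] with t ht
  simp only [indicator_of_mem ht]

lemma IsSolution.memLp (hv : IsSolution A ρ σ T φ v) (ht : t ∈ Ioc 0 T) :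
    MemLp (fun x => v x t) 2 :=
  let ⟨_, _, hpower, _⟩ := hv.equation
  (hpower t ht).1

lemma IsSolution.sub (hv : IsSolution A ρ σ T φ v) (hv' : IsSolution A ρ σ T φ' v') :
    IsSolution A ρ σ T (φ - φ') (fun x => v x - v' x) where
  initial x := by simp only [Pi.sub_apply, hv.initial, hv'.initial]
  boundary t ht := by simpa using (hv.boundary t ht).sub (hv'.boundary t ht)
  hasCaputo x := (hv.hasCaputo x).sub (hv'.hasCaputo x)
  continuousOn_caputo := (hv.continuousOn_caputo.sub hv'.continuousOn_caputo).congr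
    fun p hp => caputo_sub (hv.hasCaputo p.1) (hv'.hasCaputo p.1) hp.2
  integrable_hat t ht := ((hv.integrable_hat t ht).sub (hv'.integrable_hat t ht)).congr
    (hat_sub (hv.memLp ht) (hv'.memLp ht)).symm
  equation := by
    obtain ⟨w, hcont, hpower, hfinite, heq⟩ := hv.equation
    obtain ⟨w', hcont', hpower', hfinite', heq'⟩ := hv'.equation
    refine ⟨fun x => w x - w' x, hcont.sub hcont', fun t ht => (hpower t ht).sub (hpower' t ht),
      ?_, fun x t ht => ?_⟩
    · refine (setLIntegral_mono' measurableSet_Ioc fun t ht => eLpNorm_sub_le (hpower t ht).2.1.1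
        (hpower' t ht).2.1.1 one_le_two).trans_lt ?_
      rw [lintegral_add_left' (aemeasurable_eLpNorm_two hcont)]
      exact ENNReal.add_lt_top.2 ⟨hfinite, hfinite'⟩
    · rw [caputo_sub (hv.hasCaputo x) (hv'.hasCaputo x) ht]
      change _ + (w x t - w' x t) = 0
      rw [sub_add_sub_comm, heq x t ht, heq' x t ht, sub_zero]

end Linearity

section Uniqueness

variable {N : ℕ} {A : MvPolynomial (Fin N) ℝ} {ρ σ T t : ℝ}
  {f g φ : EuclideanSpace ℝ (Fin N) → ℂ} {v v' w : EuclideanSpace ℝ (Fin N) → ℝ → ℂ}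

lemma IsFractionalPower.fourier_toLp_eq (h : IsFractionalPower A σ f g) (hf : MemLp f 2)
    (hg : MemLp g 2) :
    (𝓕 (hg.toLp g) : Lp ℂ 2 volume) =ᵐ[volume] fun η =>
      (powerSymbol A σ η : ℂ) * (𝓕 (hf.toLp f) : Lp ℂ 2 volume) η := by
  have hhat := (Measure.quasiMeasurePreserving_smul
    (volume : Measure (EuclideanSpace ℝ (Fin N))) (r := 2 * π) (by positivity)).ae_eq_comp h.2.2
  filter_upwards [hhat] with η hη
  simp only [Function.comp_apply] at hη
  rw [fourier_eq_hat hf, fourier_eq_hat hg, hη, mul_smul_comm, powerSymbol]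

lemma eq_neg_fractionalIntegral {h w : ℝ → ℂ} (hρ : ρ ∈ Ioo (0 : ℝ) 1) (hh : HasCaputo ρ T h)
    (hh₀ : h 0 = 0) (heq : ∀ t ∈ Ioc 0 T, caputo ρ h t + w t = 0) (ht : t ∈ Ioc 0 T) :
    h t = -(((Real.Gamma ρ)⁻¹ : ℝ) • ∫ s in Ioo 0 t, ((t - s) ^ (ρ - 1) : ℝ) • w s) := by
  have hAbel := hh.integral_rpow_smul_caputo hρ ht
  have hcaputo : ∀ s ∈ Ioo 0 t, ((t - s) ^ (ρ - 1) : ℝ) • caputo ρ h s =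
      -(((t - s) ^ (ρ - 1) : ℝ) • w s) := fun s hs => by
    rw [eq_neg_of_add_eq_zero_left (heq s ⟨hs.1, hs.2.le.trans ht.2⟩), smul_neg]
  rw [setIntegral_congr_fun measurableSet_Ioo hcaputo, integral_neg, hh₀, sub_zero] at hAbel
  rw [← smul_neg, hAbel, inv_smul_smul₀ (Real.Gamma_pos_of_pos hρ.1).ne']

lemma IsSolution.exists_isHomogeneousPair (hρ : ρ ∈ Ioo (0 : ℝ) 1)
    (hv : IsSolution A ρ σ T 0 v) :
    ∃ w, IsHomogeneousPair ρ T (powerSymbol A σ) v w ∧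
      ∀ t ∈ Ioc 0 T, Continuous fun x => w x t := by
  obtain ⟨w, hcont, hpower, hfinite, heq⟩ := hv.equation
  have hslice {t : ℝ} (ht : t ∈ Ioc 0 T) : (fun x => (Ioc 0 T).indicator (w x) t) = (w · t) := by
    simp only [indicator_of_mem ht]
  refine ⟨fun x => (Ioc 0 T).indicator (w x), ⟨measurable_indicator_Ioc hcont,
    fun t ht => (hpower t ht).1, fun t ht => by rw [hslice ht]; exact (hpower t ht).2.1,
    fun t ht => ?_, ?_, fun x t ht => ?_⟩, fun t ht => ?_⟩
  · exact IsFractionalPower.fourier_toLp_eq (by rw [hslice ht]; exact hpower t ht) _ _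
  · refine (setLIntegral_congr_fun measurableSet_Ioc fun t ht => ?_).trans_lt hfinite
    simp only [hslice ht]
  · rw [eq_neg_fractionalIntegral hρ (hv.hasCaputo x) (hv.initial x) (heq x) ht,
      setIntegral_congr_fun measurableSet_Ioo fun s hs => ?_]
    simp only [indicator_of_mem (show s ∈ Ioc 0 T from ⟨hs.1, hs.2.le.trans ht.2⟩)]
  · rw [hslice ht]
    exact hcont.comp_continuous (by fun_prop : Continuous fun x => (x, t))
      fun x => ⟨mem_univ _, ht⟩

lemma IsSolution.eq_zero (hρ : ρ ∈ Ioo (0 : ℝ) 1) (hv : IsSolution A ρ σ T 0 v)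
    (x : EuclideanSpace ℝ (Fin N)) (ht : t ∈ Ioc 0 T) : v x t = 0 := by
  obtain ⟨w, hpair, hcont⟩ := hv.exists_isHomogeneousPair hρ
  have hw : ∀ᵐ s ∂volume.restrict (Ioo 0 t), ((t - s) ^ (ρ - 1) : ℝ) • w x s = 0 := by
    have hw_zero := ae_restrict_of_ae_restrict_of_subset
      (fun s hs => ⟨hs.1, hs.2.le.trans ht.2⟩ : Ioo 0 t ⊆ Ioc 0 T)
      (hpair.ae_eq_zero hρ.1 (measurable_powerSymbol A σ))
    filter_upwards [hw_zero, ae_restrict_mem measurableSet_Ioo] with s hs hst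
    have heq := ((hcont s ⟨hst.1, hst.2.le.trans ht.2⟩).ae_eq_iff_eq volume continuous_zero).1 hs
    rw [congrFun heq x, Pi.zero_apply, smul_zero]
  rw [hpair.eq_integral x t ht, integral_eq_zero_of_ae hw, smul_zero, neg_zero]

theorem IsSolution.eq (hρ : ρ ∈ Ioo (0 : ℝ) 1) (hv : IsSolution A ρ σ T φ v)
    (hv' : IsSolution A ρ σ T φ v') (x : EuclideanSpace ℝ (Fin N)) (ht : t ∈ Icc 0 T) :
    v x t = v' x t := by
  rcases ht.1.eq_or_lt with rfl | ht₀
  · rw [hv.initial, hv'.initial]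
  · have hsub := hv.sub hv'
    rw [sub_self] at hsub
    exact sub_eq_zero.1 (hsub.eq_zero hρ x ⟨ht₀, ht.2⟩)

end Uniqueness

section Observation

variable {N : ℕ} {A : MvPolynomial (Fin N) ℝ} {φ : EuclideanSpace ℝ (Fin N) → ℂ}
  {ξ : EuclideanSpace ℝ (Fin N)} {c : ℂ} {ρ ρ₀ σ σ₀ T t d : ℝ}

theorem exists_isSolution (hA₀ : ∀ ξ, 0 ≤ symbol A ξ) (hφ : MemLp φ 2)
    (hhat : Integrable (hat φ)) (hcont : Continuous φ) (hρ : ρ ∈ Ioo (0 : ℝ) 1) (σ : ℝ)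
    (hT : 0 < T) :
    ∃ v, IsSolution A ρ σ T φ v ∧ ∀ t ∈ Icc 0 T, hat (fun x => v x t) =ᵐ[volume] fun ξ =>
      (mode ρ (symbol A ξ ^ σ) t : ℂ) * hat φ ξ := by
  obtain ⟨a, ha, ha2, rfl⟩ := exists_eq_fourierInv hφ hhat hcont
  exact ⟨_, isSolution_evolution hρ hA₀ σ ha ha2 hT, fun t ht =>
    hat_evolution hρ hA₀ σ ha ha2 ht.1⟩

theorem observed_iff (hA₀ : ∀ ξ, 0 ≤ symbol A ξ) (hφ : MemLp φ 2)
    (hhat : Integrable (hat φ)) (hcont : Continuous φ) (hρ : ρ ∈ Ioo (0 : ℝ) 1) (hσ : 0 ≤ σ)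
    (hc : HasLebesgueValue (hat φ) ξ c) (hc₀ : c ≠ 0) (ht : t ∈ Ioc 0 T) :
    Observed A ρ σ T φ ξ t d ↔ mittagLeffler ρ (-(symbol A ξ ^ σ * t ^ ρ)) = d / ‖c‖ := by
  obtain ⟨v, hv, hv_hat⟩ := exists_isSolution hA₀ hφ hhat hcont hρ σ (ht.1.trans_le ht.2)
  have hpow (η) : 0 ≤ symbol A η ^ σ := Real.rpow_nonneg (hA₀ η) σ
  have hmultiplier : Continuous fun η => (mode ρ (symbol A η ^ σ) t : ℂ) :=
    Complex.continuous_ofReal.comp (continuous_mode_comp hρ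
      ((continuous_symbol A).rpow_const fun _ => .inr hσ) hpow ht.1.le)
  have hvalue : HasLebesgueValue (hat fun x => v x t) ξ (mode ρ (symbol A ξ ^ σ) t * c) :=
    (hc.mul (aestronglyMeasurable_hat hφ) hmultiplier.continuousAt).congr
      (hv_hat t ⟨ht.1.le, ht.2⟩).symm
  have hnorm : ‖(mode ρ (symbol A ξ ^ σ) t : ℂ) * c‖ = mode ρ (symbol A ξ ^ σ) t * ‖c‖ := by
    rw [norm_mul, Complex.norm_real, Real.norm_of_nonneg (mode_pos hρ (hpow ξ) ht.1.le).le]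
  rw [← mode_eq_mittagLeffler hρ (hpow ξ) ht.1.le, eq_div_iff (norm_ne_zero_iff.2 hc₀), ← hnorm]
  refine ⟨?_, fun h => ⟨v, hv, _, hvalue, h⟩⟩
  rintro ⟨v', hv', c', hc', rfl⟩
  have hvv' : (fun x => v' x t) = fun x => v x t :=
    funext fun x => hv'.eq hρ hv x ⟨ht.1.le, ht.2⟩
  rw [hvv'] at hc'
  rw [hc'.unique (aestronglyMeasurable_hat (hv.memLp ht)) hvalue]

lemma observed_iff_of_symbol_eq_one (hA₀ : ∀ ξ, 0 ≤ symbol A ξ) (hφ : MemLp φ 2)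
    (hhat : Integrable (hat φ)) (hcont : Continuous φ) (hρ : ρ ∈ Ioo (0 : ℝ) 1) (hσ : 0 ≤ σ)
    (hξ : symbol A ξ = 1) (hc : HasLebesgueValue (hat φ) ξ c) (hc₀ : c ≠ 0) (ht : t ∈ Ioc 0 T) :
    Observed A ρ σ T φ ξ t d ↔ mittagLeffler ρ (-t ^ ρ) = d / ‖c‖ := by
  rw [observed_iff hA₀ hφ hhat hcont hρ hσ hc hc₀ ht, hξ, Real.one_rpow, one_mul]

theorem exists_order_observed_iff (hA₀ : ∀ ξ, 0 ≤ symbol A ξ) (hφ : MemLp φ 2)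
    (hhat : Integrable (hat φ)) (hcont : Continuous φ) (hρ₀ : ρ₀ ∈ Ioc (0 : ℝ) 1) (hσ : 0 ≤ σ)
    (hξ : symbol A ξ = 1) (hc : HasLebesgueValue (hat φ) ξ c) (hc₀ : c ≠ 0) (ht : t ∈ Icc 1 T) :
    (∃ ρ, ρ ∈ Ico ρ₀ 1 ∧ Observed A ρ σ T φ ξ t d) ↔
      d / ‖c‖ ∈ Ioc (Real.exp (-t)) (mittagLeffler ρ₀ (-t ^ ρ₀)) := by
  rw [← image_mittagLeffler_order ht.1 hρ₀]
  exact exists_congr fun ρ => and_congr_right fun hρ =>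
    observed_iff_of_symbol_eq_one hA₀ hφ hhat hcont ⟨hρ₀.1.trans_le hρ.1, hρ.2⟩ hσ hξ hc hc₀
      ⟨one_pos.trans_le ht.1, ht.2⟩

theorem eq_order_of_observed (hA₀ : ∀ ξ, 0 ≤ symbol A ξ) (hφ : MemLp φ 2)
    (hhat : Integrable (hat φ)) (hcont : Continuous φ) (hσ : 0 ≤ σ)
    (hξ : symbol A ξ = 1) (hc : HasLebesgueValue (hat φ) ξ c) (hc₀ : c ≠ 0) (ht : t ∈ Icc 1 T)
    {ρ' : ℝ} (hρ : ρ ∈ Ioo (0 : ℝ) 1) (hρ' : ρ' ∈ Ioo (0 : ℝ) 1)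
    (h : Observed A ρ σ T φ ξ t d) (h' : Observed A ρ' σ T φ ξ t d) : ρ = ρ' := by
  have ht' : t ∈ Ioc 0 T := ⟨one_pos.trans_le ht.1, ht.2⟩
  rw [observed_iff_of_symbol_eq_one hA₀ hφ hhat hcont hρ hσ hξ hc hc₀ ht'] at h
  rw [observed_iff_of_symbol_eq_one hA₀ hφ hhat hcont hρ' hσ hξ hc hc₀ ht'] at h'
  exact (strictAntiOn_mittagLeffler_order ht.1 (lt_min hρ.1 hρ'.1)).injOn
    ⟨min_le_left _ _, hρ.2.le⟩ ⟨min_le_right _ _, hρ'.2.le⟩ (h.trans h'.symm)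

lemma strictAnti_mittagLeffler_power (hρ : ρ ∈ Ioo (0 : ℝ) 1) {lam : ℝ} (hlam : 1 < lam)
    (ht : 0 < t) : StrictAnti fun σ : ℝ => mittagLeffler ρ (-(lam ^ σ * t ^ ρ)) := by
  intro σ σ' hσ
  have hlam₀ (σ : ℝ) : 0 < lam ^ σ := Real.rpow_pos_of_pos (one_pos.trans hlam) σ
  simp only [mittagLeffler_neg_mul_rpow hρ (hlam₀ _).le ht.le]
  refine strictAntiOn_relaxation hρ (mul_nonneg (Real.rpow_nonneg (hlam₀ _).le _) ht.le)
    (mul_nonneg (Real.rpow_nonneg (hlam₀ _).le _) ht.le) (mul_lt_mul_of_pos_right ?_ ht)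
  exact Real.rpow_lt_rpow (hlam₀ _).le (Real.rpow_lt_rpow_of_exponent_lt hlam hσ)
    (one_div_pos.2 hρ.1)

lemma continuous_mittagLeffler_power (hρ : 0 < ρ) {lam : ℝ} (hlam : 0 < lam) (t : ℝ) :
    Continuous fun σ : ℝ => mittagLeffler ρ (-(lam ^ σ * t ^ ρ)) :=
  (continuous_mittagLeffler hρ).comp
    ((Real.continuous_const_rpow hlam.ne').mul continuous_const).neg

lemma image_mittagLeffler_power_Ico (hρ : ρ ∈ Ioo (0 : ℝ) 1) {lam : ℝ} (hlam : 1 < lam)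
    (ht : 0 < t) (hσ₀ : σ₀ ≤ 1) :
    (fun σ : ℝ => mittagLeffler ρ (-(lam ^ σ * t ^ ρ))) '' Ico σ₀ 1 =
      Ioc (mittagLeffler ρ (-(lam * t ^ ρ))) (mittagLeffler ρ (-(lam ^ σ₀ * t ^ ρ))) := by
  have himage := ContinuousOn.image_Ico_of_strictAntiOn hσ₀
    (continuous_mittagLeffler_power hρ.1 (one_pos.trans hlam) t).continuousOn
    ((strictAnti_mittagLeffler_power hρ hlam ht).strictAntiOn _)
  simpa only [Real.rpow_one] using himage

lemma image_mittagLeffler_power_Ioo (hρ : ρ ∈ Ioo (0 : ℝ) 1) {lam : ℝ} (hlam : 1 < lam)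
    (ht : 0 < t) (hσ₀ : σ₀ ≤ 1) :
    (fun σ : ℝ => mittagLeffler ρ (-(lam ^ σ * t ^ ρ))) '' Ioo σ₀ 1 =
      Ioo (mittagLeffler ρ (-(lam * t ^ ρ))) (mittagLeffler ρ (-(lam ^ σ₀ * t ^ ρ))) := by
  have himage := ContinuousOn.image_Ioo_of_strictAntiOn hσ₀
    (continuous_mittagLeffler_power hρ.1 (one_pos.trans hlam) t).continuousOn
    ((strictAnti_mittagLeffler_power hρ hlam ht).strictAntiOn _)
  simpa only [Real.rpow_one] using himage

theorem exists_power_observed_iff (hA₀ : ∀ ξ, 0 ≤ symbol A ξ) (hφ : MemLp φ 2)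
    (hhat : Integrable (hat φ)) (hcont : Continuous φ) (hρ : ρ ∈ Ioo (0 : ℝ) 1)
    {S : Set ℝ} (hS : S ⊆ Ici 0) (hc : HasLebesgueValue (hat φ) ξ c) (hc₀ : c ≠ 0)
    (ht : t ∈ Ioc 0 T) :
    (∃ σ, σ ∈ S ∧ Observed A ρ σ T φ ξ t d) ↔
      d / ‖c‖ ∈ (fun σ : ℝ => mittagLeffler ρ (-(symbol A ξ ^ σ * t ^ ρ))) '' S :=
  exists_congr fun _ => and_congr_right fun hσ =>
    observed_iff hA₀ hφ hhat hcont hρ (hS hσ) hc hc₀ ht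

theorem eq_power_of_observed (hA₀ : ∀ ξ, 0 ≤ symbol A ξ) (hφ : MemLp φ 2)
    (hhat : Integrable (hat φ)) (hcont : Continuous φ) (hρ : ρ ∈ Ioo (0 : ℝ) 1)
    (hξ : 1 < symbol A ξ) (hc : HasLebesgueValue (hat φ) ξ c) (hc₀ : c ≠ 0) (ht : t ∈ Ioc 0 T)
    {σ' : ℝ} (hσ : 0 ≤ σ) (hσ' : 0 ≤ σ')
    (h : Observed A ρ σ T φ ξ t d) (h' : Observed A ρ σ' T φ ξ t d) : σ = σ' := by
  rw [observed_iff hA₀ hφ hhat hcont hρ hσ hc hc₀ ht] at h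
  rw [observed_iff hA₀ hφ hhat hcont hρ hσ' hc hc₀ ht] at h'
  exact (strictAnti_mittagLeffler_power hρ hξ ht.1).injective (h.trans h'.symm)

lemma one_le_of_isTimeThreshold {lam T₀ : ℝ} (hρ₀ : 0 < ρ₀) (h : IsTimeThreshold lam ρ₀ T₀) :
    1 ≤ T₀ := by
  rcases h with ⟨k, rfl, hk⟩ | ⟨-, rfl⟩
  · refine Real.one_le_exp (le_trans ?_ hk)
    exact mul_nonneg (by positivity) (le_max_of_le_left (by norm_num))
  · norm_num

lemma one_lt_of_isSymbolThreshold {Λ₁ : ℝ} (hρ : ρ ∈ Ioo (0 : ℝ) 1) (hσ₀ : 0 < σ₀)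
    (h : IsSymbolThreshold ρ σ₀ Λ₁) : 1 < Λ₁ := by
  obtain ⟨n, rfl, hn⟩ := h
  have hΓ : Real.Gamma 1 < Real.Gamma (1 - ρ) := Real.Gamma_strictAntiOn_Ioc
    ⟨sub_pos.2 hρ.2, sub_le_self 1 hρ.1.le⟩ ⟨one_pos, le_rfl⟩ (sub_lt_self 1 hρ.1)
  rw [Real.Gamma_one] at hΓ
  exact Real.one_lt_exp_iff.2 ((div_pos (Real.log_pos (by linarith)) hσ₀).trans_le hn)

end Observation

end Subdiffusion

end

open Subdiffusion in
theorem theorem1p4_general {N : ℕ} (A : MvPolynomial (Fin N) ℝ) (hA₀ : ∀ ξ, 0 ≤ symbol A ξ)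
    (φ : EuclideanSpace ℝ (Fin N) → ℂ) (hφ : MemLp φ 2) (hhat : Integrable (hat φ))
    (hcont : Continuous φ) (ρ₀ σ₀ : ℝ) (hρ₀ : ρ₀ ∈ Ioc (0 : ℝ) 1) (hσ₀ : σ₀ ∈ Icc (0 : ℝ) 1)
    (t₀ T : ℝ) (ht₀ : t₀ ∈ Icc 1 T) (ξ₀ : EuclideanSpace ℝ (Fin N)) (hξ₀ : symbol A ξ₀ = 1)
    (φ₀ : ℂ) (hφ₀ : HasLebesgueValue (hat φ) ξ₀ φ₀) (hφ₀_ne : φ₀ ≠ 0) (d₀ : ℝ) :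
    (∀ ρ ∈ Ioo (0 : ℝ) 1, ∀ σ : ℝ, 0 ≤ σ →
      (∃ v, IsSolution A ρ σ T φ v) ∧
      ∀ v v', IsSolution A ρ σ T φ v → IsSolution A ρ σ T φ v' →
        ∀ x, ∀ t ∈ Icc 0 T, v x t = v' x t) ∧
    (∀ ρ ∈ Ioo (0 : ℝ) 1, ∀ σ : ℝ, 0 ≤ σ → ∀ σ' : ℝ, 0 ≤ σ' →
      Observed A ρ σ T φ ξ₀ t₀ d₀ → Observed A ρ σ' T φ ξ₀ t₀ d₀) ∧
    (∀ σ : ℝ, 0 ≤ σ →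
      ((∃! ρ : ℝ, ρ ∈ Ico ρ₀ 1 ∧ Observed A ρ σ T φ ξ₀ t₀ d₀) ↔
        Real.exp (-t₀) < d₀ / ‖φ₀‖ ∧ d₀ / ‖φ₀‖ ≤ mittagLeffler ρ₀ (-t₀ ^ ρ₀)) ∧
      ((∃ ρ : ℝ, ρ ∈ Ico ρ₀ 1 ∧ Observed A ρ σ T φ ξ₀ t₀ d₀) ↔
        Real.exp (-t₀) < d₀ / ‖φ₀‖ ∧ d₀ / ‖φ₀‖ ≤ mittagLeffler ρ₀ (-t₀ ^ ρ₀))) ∧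
    (∀ ρ ∈ Ioo (0 : ℝ) 1, ∀ (ξ₁ : EuclideanSpace ℝ (Fin N)) (t₁ d₁ : ℝ) (φ₁ : ℂ),
      1 < symbol A ξ₁ → t₁ ∈ Ioc 0 T → HasLebesgueValue (hat φ) ξ₁ φ₁ → φ₁ ≠ 0 →
      ((∃ σ : ℝ, σ ∈ Ico σ₀ 1 ∧ Observed A ρ σ T φ ξ₁ t₁ d₁) ↔
        mittagLeffler ρ (-(symbol A ξ₁ * t₁ ^ ρ)) < d₁ / ‖φ₁‖ ∧
          d₁ / ‖φ₁‖ ≤ mittagLeffler ρ (-(symbol A ξ₁ ^ σ₀ * t₁ ^ ρ))) ∧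
      ((∃ σ : ℝ, σ ∈ Ioo σ₀ 1 ∧ Observed A ρ σ T φ ξ₁ t₁ d₁) ↔
        mittagLeffler ρ (-(symbol A ξ₁ * t₁ ^ ρ)) < d₁ / ‖φ₁‖ ∧
          d₁ / ‖φ₁‖ < mittagLeffler ρ (-(symbol A ξ₁ ^ σ₀ * t₁ ^ ρ))) ∧
      (∀ σ ∈ Ico σ₀ 1, ∀ σ' ∈ Ico σ₀ 1,
        Observed A ρ σ T φ ξ₁ t₁ d₁ → Observed A ρ σ' T φ ξ₁ t₁ d₁ → σ = σ')) := by
  have ht₀' : t₀ ∈ Ioc 0 T := ⟨one_pos.trans_le ht₀.1, ht₀.2⟩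
  have hmem {ρ : ℝ} (hρ : ρ ∈ Ico ρ₀ 1) : ρ ∈ Ioo (0 : ℝ) 1 := ⟨hρ₀.1.trans_le hρ.1, hρ.2⟩
  have hfirst {ρ σ : ℝ} (hρ : ρ ∈ Ioo (0 : ℝ) 1) (hσ : 0 ≤ σ) :=
    observed_iff_of_symbol_eq_one (d := d₀) hA₀ hφ hhat hcont hρ hσ hξ₀ hφ₀ hφ₀_ne ht₀'
  have horder {σ : ℝ} (hσ : 0 ≤ σ) := exists_order_observed_iff (d := d₀) hA₀ hφ hhat hcont hρ₀ hσ
    hξ₀ hφ₀ hφ₀_ne ht₀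
  refine ⟨fun ρ hρ σ _ => ⟨?_, fun v v' hv hv' x t ht => hv.eq hρ hv' x ht⟩,
    fun ρ hρ σ hσ σ' hσ' h => (hfirst hρ hσ').2 ((hfirst hρ hσ).1 h),
    fun σ hσ => ⟨⟨fun h => (horder hσ).1 h.exists, fun h => existsUnique_of_exists_of_unique
      ((horder hσ).2 h) fun ρ ρ' hρ hρ' => ?_⟩, horder hσ⟩,
    fun ρ hρ ξ₁ t₁ d₁ φ₁ hξ₁ ht₁ hφ₁ hφ₁_ne => ⟨?_, ?_, fun σ hσ σ' hσ' => ?_⟩⟩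
  · exact (exists_isSolution hA₀ hφ hhat hcont hρ σ (ht₀'.1.trans_le ht₀'.2)).imp fun _ h => h.1
  · exact eq_order_of_observed hA₀ hφ hhat hcont hσ hξ₀ hφ₀ hφ₀_ne ht₀ (hmem hρ.1) (hmem hρ'.1)
      hρ.2 hρ'.2
  · rw [exists_power_observed_iff hA₀ hφ hhat hcont hρ (fun _ h => hσ₀.1.trans h.1) hφ₁ hφ₁_ne ht₁,
      image_mittagLeffler_power_Ico hρ hξ₁ ht₁.1 hσ₀.2, mem_Ioc]
  · rw [exists_power_observed_iff hA₀ hφ hhat hcont hρ (fun _ h => hσ₀.1.trans h.1.le) hφ₁ hφ₁_ne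
      ht₁, image_mittagLeffler_power_Ioo hρ hξ₁ ht₁.1 hσ₀.2, mem_Ioo]
  · exact eq_power_of_observed hA₀ hφ hhat hcont hρ hξ₁ hφ₁ hφ₁_ne ht₁ (hσ₀.1.trans hσ.1)
      (hσ₀.1.trans hσ'.1)

theorem theorem1p4 {N l : ℕ} (hl : 0 < l)
    (A : MvPolynomial (Fin N) ℝ) (hA : A.IsHomogeneous (2 * l))
    (hApos : ∀ ξ : EuclideanSpace ℝ (Fin N), ξ ≠ 0 → 0 < Subdiffusion.symbol A ξ)
    (τ : ℝ) (hτ : (N : ℝ) / 2 < τ)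
    (φ : EuclideanSpace ℝ (Fin N) → ℂ) (hφc : Continuous φ)
    (hφ : Subdiffusion.MemSobolevClass τ φ)
    (ρ₀ σ₀ : ℝ) (hρ₀ : ρ₀ ∈ Ioo (0 : ℝ) 1) (hσ₀ : σ₀ ∈ Ioo (0 : ℝ) 1)
    (T₀ t₀ T : ℝ) (hT₀ : Subdiffusion.IsTimeThreshold 1 ρ₀ T₀) (ht₀ : T₀ ≤ t₀) (hT : t₀ ≤ T)
    (ξ₀ : EuclideanSpace ℝ (Fin N)) (hξ₀ : Subdiffusion.symbol A ξ₀ = 1)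
    (φ₀ : ℂ) (hφ₀ : Subdiffusion.HasLebesgueValue (Subdiffusion.hat φ) ξ₀ φ₀) (hφ₀_ne : φ₀ ≠ 0)
    (d₀ : ℝ) :
    -- the forward problem has exactly one solution, so that the observations are well defined
    (∀ ρ ∈ Ico ρ₀ 1, ∀ σ ∈ Ioo (0 : ℝ) 1,
      (∃ v, Subdiffusion.IsSolution A ρ σ T φ v) ∧
      ∀ v v', Subdiffusion.IsSolution A ρ σ T φ v → Subdiffusion.IsSolution A ρ σ T φ v' →
        ∀ x, ∀ t ∈ Icc 0 T, v x t = v' x t) ∧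
    -- the first observation does not depend on `σ`
    (∀ ρ ∈ Ico ρ₀ 1, ∀ σ ∈ Ioo (0 : ℝ) 1, ∀ σ' ∈ Ioo (0 : ℝ) 1,
      Subdiffusion.Observed A ρ σ T φ ξ₀ t₀ d₀ → Subdiffusion.Observed A ρ σ' T φ ξ₀ t₀ d₀) ∧
    -- the order in time
    (∀ σ ∈ Ioo (0 : ℝ) 1,
      ((∃! ρ : ℝ, ρ ∈ Ico ρ₀ 1 ∧ Subdiffusion.Observed A ρ σ T φ ξ₀ t₀ d₀) ↔
        Real.exp (-t₀) < d₀ / ‖φ₀‖ ∧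
          d₀ / ‖φ₀‖ ≤ Subdiffusion.mittagLeffler ρ₀ (-t₀ ^ ρ₀)) ∧
      ((∃ ρ : ℝ, ρ ∈ Ico ρ₀ 1 ∧ Subdiffusion.Observed A ρ σ T φ ξ₀ t₀ d₀) ↔
        Real.exp (-t₀) < d₀ / ‖φ₀‖ ∧
          d₀ / ‖φ₀‖ ≤ Subdiffusion.mittagLeffler ρ₀ (-t₀ ^ ρ₀))) ∧
    -- the power of the elliptic operator
    (∀ ρs ∈ Ico ρ₀ 1,
      (∃ σ ∈ Ioo (0 : ℝ) 1, Subdiffusion.Observed A ρs σ T φ ξ₀ t₀ d₀) →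
      ∀ (ξ₁ : EuclideanSpace ℝ (Fin N)) (lam₁ Λ₁ t₁ d₁ : ℝ) (φ₁ : ℂ),
        Subdiffusion.symbol A ξ₁ = lam₁ → Subdiffusion.IsSymbolThreshold ρs σ₀ Λ₁ → Λ₁ ≤ lam₁ →
        t₁ ∈ Ioc 0 T →
        Subdiffusion.HasLebesgueValue (Subdiffusion.hat φ) ξ₁ φ₁ → φ₁ ≠ 0 →
        ((∃ σ : ℝ, σ ∈ Ico σ₀ 1 ∧ Subdiffusion.Observed A ρs σ T φ ξ₁ t₁ d₁) ↔
          Subdiffusion.mittagLeffler ρs (-(lam₁ * t₁ ^ ρs)) < d₁ / ‖φ₁‖ ∧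
            d₁ / ‖φ₁‖ ≤ Subdiffusion.mittagLeffler ρs (-(lam₁ ^ σ₀ * t₁ ^ ρs))) ∧
        ((∃ σ : ℝ, σ ∈ Ioo σ₀ 1 ∧ Subdiffusion.Observed A ρs σ T φ ξ₁ t₁ d₁) ↔
          Subdiffusion.mittagLeffler ρs (-(lam₁ * t₁ ^ ρs)) < d₁ / ‖φ₁‖ ∧
            d₁ / ‖φ₁‖ < Subdiffusion.mittagLeffler ρs (-(lam₁ ^ σ₀ * t₁ ^ ρs))) ∧
        (∀ σ ∈ Ico σ₀ 1, ∀ σ' ∈ Ico σ₀ 1,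
          Subdiffusion.Observed A ρs σ T φ ξ₁ t₁ d₁ →
          Subdiffusion.Observed A ρs σ' T φ ξ₁ t₁ d₁ → σ = σ')) := by
  have hA₀ := Subdiffusion.symbol_nonneg hl hA hApos
  have h1t₀ := (Subdiffusion.one_le_of_isTimeThreshold hρ₀.1 hT₀).trans ht₀
  have hmem {ρ : ℝ} (hρ : ρ ∈ Ico ρ₀ 1) : ρ ∈ Ioo (0 : ℝ) 1 := ⟨hρ₀.1.trans_le hρ.1, hρ.2⟩
  obtain ⟨hwell, hindep, horder, hpower⟩ := theorem1p4_general A hA₀ φ hφ.1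
    (Subdiffusion.integrable_hat_of_memSobolevClass hτ hφ) hφc ρ₀ σ₀ ⟨hρ₀.1, hρ₀.2.le⟩
    ⟨hσ₀.1.le, hσ₀.2.le⟩ t₀ T ⟨h1t₀, hT⟩ ξ₀ hξ₀ φ₀ hφ₀ hφ₀_ne d₀
  refine ⟨fun ρ hρ σ hσ => hwell ρ (hmem hρ) σ hσ.1.le,
    fun ρ hρ σ hσ σ' hσ' => hindep ρ (hmem hρ) σ hσ.1.le σ' hσ'.1.le,
    fun σ hσ => horder σ hσ.1.le, ?_⟩
  rintro ρ hρ - ξ₁ _ Λ₁ t₁ d₁ φ₁ rfl hΛ₁ hlam₁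
  exact hpower ρ (hmem hρ) ξ₁ t₁ d₁ φ₁
    ((Subdiffusion.one_lt_of_isSymbolThreshold (hmem hρ) hσ₀.1 hΛ₁).trans_le hlam₁)
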